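/- A mixed graph $M$ is a finite simple graph $\Gamma(M)$ (its underlying graph) some of whose edges are oriented; oriented edges are called arcs, and the other edges are undirected. Its Hermitian adjacency matrix $H(M)=(h_{uv})$ has $h_{uv}=\mathbf i$ if $\overrightarrow{uv}$ is an arc, $h_{uv}=-\mathbf i$ if $\overrightarrow{vu}$ is an arc, $h_{uv}=1$ if $\{u,v\}$ is an undirected edge, and $h_{uv}=0$ otherwise; the spectral radius $\rho(M)$ is the largest absolute value of an eigenvalue of $H(M)$. A four-way switching replaces $M$ by a mixed graph $M'$ with $H(M)=D^{-1}H(M')D$ for some diagonal matrix $D$ with diagonal entries in $\{\pm1,\pm\mathbf i\}$. Two mixed graphs are switching isomorphic if one arises from the other by four-way switchings and vertex relabellings, possibly followed by reversing all arcs. A subgraph of $M$ keeps the orientations of $M$. Induced subgraphs are understood up to switching isomorphism: $M'$ is called an induced subgraph of $M$ if $M'$ is switching isomorphic to $M[S]$ for some set $S$ of vertices of $M$. We say that $M$ is $N$-free if no (not necessarily induced) subgraph of $M$ is switching isomorphic to $N$. A mixed graph is unicyclic if its underlying graph is connected and contains exactly one cycle. For $n\ge 3$ let $C_n$, $C_n'$,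 $C_n''$ be the mixed graphs whose underlying graph is the cycle $v_1v_2\cdots v_nv_1$ with, respectively, no arc, exactly one arc $\overrightarrow{v_1v_2}$, and exactly the two arcs $\overrightarrow{v_1v_2},\overrightarrow{v_2v_3}$. Affixing a path of order $m+1$ at a vertex $v$ means identifying an end vertex of an undirected path on $m+1$ vertices with $v$ (so $m$ new vertices are added); affixing an edge is the case $m=1$. For $n>k\ge3$ let $C'_{k,n}$ be obtained from $C'_k$ by affixing a path of order $n-k+1$ at one vertex. For $n\ge 3$ and $2\le k\le n$ let $G''_{n,k}$ be obtained from $C''_n$ by affixing an edge at $v_1$ and an edge at $v_k$. For $k,l\ge1$ let $U''_{k,l}$ be obtained from $C''_6$ by affixing a path of order $k+1$ at $v_1$ and a path of order $l+1$ at $v_4$. Let $U''_6$ be obtained from $C''_6$ by affixing a path of order $3$ at $v_1$, an edge at $v_3$ and an edge at $v_5$, and let $U''_8$ be obtained from $C''_8$ by affixing a path of order $3$ at $v_1$ and a path of order $3$ at $v_5$. Proposition. Let $M$ be a (connected) $C_4''$-free unicyclic mixed graph. Then $\rho(M)\le\sqrt{2+\sqrt5}$ if and only if $M$ is an induced subgraph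 of one of the following mixed graphs: (i) $C_n$ for some $n\ge3$; (ii) $C_n''$ for some odd $n\ge3$; $G''_{n-2,\,n/2}$ for some even $n\ge10$; $U''_{k,\,n-6-k}$ for some integers $n,k$ with $1\le k\le n-7$; $G''_{8,4}$; $G''_{10,5}$; $U''_6$; $U''_8$; (iii) $C'_{n-1,n}$ for some $n\ge6$; $C'_{3,n}$ for some $n\ge4$; $C'_{4,6}$. -/

import Mathlib

/-- A mixed graph on the vertex set `V`: a simple graph (the underlying graph), some of whose edges
are oriented. `arc u v` says that the edge `uv` is oriented from `u` to `v`; an edge that is oriented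
in neither direction is an undirected edge. -/
structure MixedGraph (V : Type*) where
  graph : SimpleGraph V
  arc : V → V → Prop
  adj_of_arc : ∀ {u v : V}, arc u v → graph.Adj u v
  asymm : ∀ {u v : V}, arc u v → ¬ arc v u

namespace MixedGraph

universe u₁ u₂ u₃
variable {V : Type u₁} {W : Type u₂} {X : Type u₃}

/-! ### The Hermitian adjacency matrix and the spectral radius -/

open Classical in
/-- The Hermitian adjacency matrix. -/
noncomputable def hMatrix (M : MixedGraph V) : Matrix V V ℂ :=
  Matrix.of fun u v =>
    if M.arc u v then Complex.I
    else if M.arc v u then -Complex.I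
    else if M.graph.Adj u v then 1
    else 0

theorem isHermitian_hMatrix (M : MixedGraph V) : M.hMatrix.IsHermitian := by
  ext u v
  have h₁ := @M.asymm u v
  have h₂ := M.graph.adj_comm u v
  by_cases a : M.arc u v <;> by_cases b : M.arc v u <;> by_cases c : M.graph.Adj v u <;>
    simp_all [hMatrix, Matrix.conjTranspose_apply]

open Classical in
/-- The spectral radius: the largest absolute value of an eigenvalue of the Hermitian adjacency
matrix (a maximum over the finitely many eigenvalues). -/
noncomputable def spectralRadius [Fintype V] (M : MixedGraph V) : ℝ :=
  ⨆ i, |M.isHermitian_hMatrix.eigenvalues i|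

/-! ### Subgraphs and switching isomorphism -/

/-- The mixed graph obtained by reversing all arcs. -/
def converse (M : MixedGraph V) : MixedGraph V where
  graph := M.graph
  arc u v := M.arc v u
  adj_of_arc h := (M.adj_of_arc h).symm
  asymm h := M.asymm h

/-- The mixed graph structure pulled back along an injective map of vertices. For a bijection this
is a relabelling of the vertices. -/
def comap (f : V ↪ W) (M : MixedGraph W) : MixedGraph V where
  graph := M.graph.comap f
  arc u v := M.arc (f u) (f v)
  adj_of_arc h := M.adj_of_arc h
  asymm h := M.asymm h

/-- The subgraph of `M` induced on a set of vertices. -/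
def induce (M : MixedGraph V) (s : Set V) : MixedGraph s :=
  M.comap (Function.Embedding.subtype (· ∈ s))

/-- `M` and `M'` are related by a four-way switching: `H(M) = D⁻¹ H(M') D` for a diagonal matrix `D`
with diagonal entries in `{1, -1, i, -i}` (written entry by entry). -/
def FourWaySwitching (M M' : MixedGraph V) : Prop :=
  ∃ d : V → ℂ, (∀ v, d v ∈ ({1, -1, Complex.I, -Complex.I} : Set ℂ)) ∧
    ∀ u v, M.hMatrix u v = (d u)⁻¹ * M'.hMatrix u v * d v

/-- Switching isomorphism: `M` arises from `N` by four-way switchings and relabellings of the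
vertices, possibly followed by taking the converse. Relabellings and the converse commute with
four-way switchings, and a composition of four-way switchings is one, so one of each is enough;
see `SwitchingIso.refl`, `SwitchingIso.symm` and `SwitchingIso.trans`. -/
def SwitchingIso (M : MixedGraph V) (N : MixedGraph W) : Prop :=
  ∃ e : V ≃ W, FourWaySwitching M (N.comap e.toEmbedding) ∨
    FourWaySwitching M (N.comap e.toEmbedding).converse

/-- `M'` is an induced subgraph of `M` up to switching isomorphism. -/
def IsInducedSubgraph (M' : MixedGraph V) (M : MixedGraph W) : Prop :=
  ∃ s : Set W, SwitchingIso M' (M.induce s)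

/-- `N` is (a copy of) a not necessarily induced subgraph of `M`: the edges of `N` are edges of `M`,
and they are oriented in `N` as they are in `M`. -/
def IsSubgraph (N : MixedGraph W) (M : MixedGraph V) : Prop :=
  ∃ f : W ↪ V, ∀ u v, N.graph.Adj u v →
    M.graph.Adj (f u) (f v) ∧ (N.arc u v ↔ M.arc (f u) (f v))

/-- `M` is `N`-free: no subgraph of `M`, induced or not, is switching isomorphic to `N`. -/
def Free (M : MixedGraph V) (N : MixedGraph W) : Prop :=
  ∀ N' : MixedGraph W, SwitchingIso N' N → ¬ N'.IsSubgraph M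

/-- `M` is unicyclic: it is connected and contains exactly one cycle. -/
def IsUnicyclic (M : MixedGraph V) : Prop :=
  M.graph.Connected ∧
    ∃! C : M.graph.Subgraph, ∃ (v : V) (p : M.graph.Walk v v), p.IsCycle ∧ p.toSubgraph = C

/-! ### Switching isomorphism is an equivalence relation -/

theorem hMatrix_converse (M : MixedGraph V) (u v : V) :
    M.converse.hMatrix u v = (starRingEnd ℂ) (M.hMatrix u v) := by
  have h₁ := @M.asymm u v
  by_cases a : M.arc u v <;> by_cases b : M.arc v u <;> by_cases c : M.graph.Adj u v <;>
    simp_all [hMatrix, converse]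

theorem hMatrix_comap (f : V ↪ W) (M : MixedGraph W) (u v : V) :
    (M.comap f).hMatrix u v = M.hMatrix (f u) (f v) := by
  simp only [hMatrix, comap, Matrix.of_apply]
  rfl

theorem FourWaySwitching.refl (M : MixedGraph V) : FourWaySwitching M M :=
  ⟨fun _ => 1, by simp, by simp⟩

theorem FourWaySwitching.symm {M N : MixedGraph V} (h : FourWaySwitching M N) :
    FourWaySwitching N M := by
  obtain ⟨d, hd, h⟩ := h
  have h0 : ∀ v, d v ≠ 0 := fun v hv => by simpa [hv, eq_comm] using hd v
  refine ⟨fun v => (d v)⁻¹, fun v => ?_, fun u v => ?_⟩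
  · rcases hd v with h | h | h | h <;> simp_all [Set.mem_insert_iff]
  · rw [h]
    have := h0 u
    have := h0 v
    field_simp

theorem FourWaySwitching.trans {M N L : MixedGraph V} (h : FourWaySwitching M N)
    (h' : FourWaySwitching N L) : FourWaySwitching M L := by
  obtain ⟨d, hd, h⟩ := h
  obtain ⟨d', hd', h'⟩ := h'
  refine ⟨fun v => d' v * d v, fun v => ?_, fun u v => ?_⟩
  · rcases hd v with h | h | h | h <;> rcases hd' v with h' | h' | h' | h' <;>
      simp_all [Set.mem_insert_iff]
  · rw [h, h', mul_inv]
    ring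

theorem FourWaySwitching.converse {M N : MixedGraph V} (h : FourWaySwitching M N) :
    FourWaySwitching M.converse N.converse := by
  obtain ⟨d, hd, h⟩ := h
  refine ⟨fun v => (starRingEnd ℂ) (d v), fun v => ?_, fun u v => ?_⟩
  · rcases hd v with h | h | h | h <;> simp_all [Set.mem_insert_iff]
  · simp [hMatrix_converse, h]

theorem FourWaySwitching.comap {M N : MixedGraph W} (h : FourWaySwitching M N) (f : V ↪ W) :
    FourWaySwitching (M.comap f) (N.comap f) := by
  obtain ⟨d, hd, h⟩ := h
  exact ⟨fun v => d (f v), fun v => hd _, fun u v => by simp [hMatrix_comap, h]⟩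

theorem SwitchingIso.refl (M : MixedGraph V) : SwitchingIso M M :=
  ⟨Equiv.refl V, Or.inl (FourWaySwitching.refl M)⟩

theorem SwitchingIso.symm {M : MixedGraph V} {N : MixedGraph W} (h : SwitchingIso M N) :
    SwitchingIso N M := by
  obtain ⟨e, h⟩ := h
  have key : (N.comap e.toEmbedding).comap e.symm.toEmbedding = N := by simp [MixedGraph.comap]
  refine ⟨e.symm, h.imp (fun h => ?_) (fun h => ?_)⟩
  · have := (h.comap e.symm.toEmbedding).symm
    rwa [key] at this
  · have := (h.comap e.symm.toEmbedding).symm.converse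
    change FourWaySwitching
      ((N.comap e.toEmbedding).comap e.symm.toEmbedding) _ at this
    rwa [key] at this

theorem SwitchingIso.trans {M : MixedGraph V} {N : MixedGraph W} {L : MixedGraph X}
    (h : SwitchingIso M N) (h' : SwitchingIso N L) : SwitchingIso M L := by
  obtain ⟨e, h⟩ := h
  obtain ⟨e', h'⟩ := h'
  refine ⟨e.trans e', ?_⟩
  rcases h with h | h <;> rcases h' with h' | h'
  · exact Or.inl (h.trans (h'.comap e.toEmbedding))
  · exact Or.inr (h.trans (h'.comap e.toEmbedding))
  · exact Or.inr (h.trans (h'.comap e.toEmbedding).converse)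
  · exact Or.inl (h.trans (h'.comap e.toEmbedding).converse)

/-! ### The special mixed graphs

The cycles have vertex set `Fin n`; the vertex `v_k` of a cycle `v_1 v_2 ⋯ v_n v_1` is the element
with value `k - 1`. -/

/-- The mixed cycle `v_1 v_2 ⋯ v_n v_1` (for `n ≥ 3`) in which each of the first `a` of the edges
`v_1 v_2, v_2 v_3, …, v_{n-1} v_n` is an arc `v_j → v_{j+1}`, and all other edges are undirected. -/
def mixedCycle (n a : ℕ) : MixedGraph (Fin n) where
  graph := SimpleGraph.cycleGraph n
  arc u v := (SimpleGraph.cycleGraph n).Adj u v ∧ v.val = u.val + 1 ∧ u.val < a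
  adj_of_arc h := h.1
  asymm h h' := by omega

/-- `C_n`: no arc. -/
def cyclePos (n : ℕ) : MixedGraph (Fin n) := mixedCycle n 0

/-- `C'_n`: just one arc. -/
def cycleIm (n : ℕ) : MixedGraph (Fin n) := mixedCycle n 1

/-- `C''_n`: just two arcs, consecutive and in the same direction. -/
def cycleNeg (n : ℕ) : MixedGraph (Fin n) := mixedCycle n 2

/-- Affix at the vertex `v` of `M` an undirected path with `m` new vertices, that is, identify an
end vertex of a path of order `m + 1` with `v`. For `m = 1` this affixes a pendant edge. -/
def affixPath (M : MixedGraph V) (v : V) (m : ℕ) : MixedGraph (V ⊕ Fin m) where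
  graph :=
    { Adj := fun x y =>
        match x, y with
        | Sum.inl a, Sum.inl b => M.graph.Adj a b
        | Sum.inl a, Sum.inr j => a = v ∧ j.val = 0
        | Sum.inr i, Sum.inl b => b = v ∧ i.val = 0
        | Sum.inr i, Sum.inr j => i.val + 1 = j.val ∨ j.val + 1 = i.val
      symm := ⟨by
        rintro (a | i) (b | j) h
        · exact M.graph.adj_symm h
        · exact h
        · exact h
        · exact Or.symm h⟩
      loopless := ⟨by
        rintro (a | i) h
        · exact M.graph.loopless.irrefl a h
        · rcases h with h | h <;> omega⟩ }
  arc x y :=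
    match x, y with
    | Sum.inl a, Sum.inl b => M.arc a b
    | _, _ => False
  adj_of_arc {x y} h := by
    rcases x with a | i <;> rcases y with b | j
    · exact M.adj_of_arc h
    all_goals exact h.elim
  asymm {x y} h := by
    rcases x with a | i <;> rcases y with b | j
    · exact M.asymm h
    all_goals exact h.elim

/-- `C'_{k,n}` for `n > k ≥ 3`: a path of order `n - k + 1` is affixed at a vertex of `C'_k`. -/
def tailedCycleIm (k n : ℕ) (h : 3 ≤ k ∧ k < n) : MixedGraph (Fin k ⊕ Fin (n - k)) :=
  (cycleIm k).affixPath ⟨0, by omega⟩ (n - k)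

/-- `G''_{n,k}` for `n ≥ 3` and `2 ≤ k ≤ n`: a pendant edge is affixed at `v_1` and another one at
`v_k` in `C''_n`. -/
def GNeg (n k : ℕ) (h : 3 ≤ n ∧ 2 ≤ k ∧ k ≤ n) : MixedGraph ((Fin n ⊕ Fin 1) ⊕ Fin 1) :=
  ((cycleNeg n).affixPath ⟨0, by omega⟩ 1).affixPath (Sum.inl ⟨k - 1, by omega⟩) 1

/-- `U''_{k,l}`: in `C''_6`, a path of order `k + 1` is affixed at `v_1` and a path of order `l + 1`
is affixed at `v_4`. -/
def UNeg (k l : ℕ) : MixedGraph ((Fin 6 ⊕ Fin k) ⊕ Fin l) :=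
  ((cycleNeg 6).affixPath 0 k).affixPath (Sum.inl 3) l

/-- `U''_6`: in `C''_6`, a path of order `3` is affixed at `v_1`, and pendant edges are affixed at
`v_3` and at `v_5`. -/
def U6Neg : MixedGraph (((Fin 6 ⊕ Fin 2) ⊕ Fin 1) ⊕ Fin 1) :=
  (((cycleNeg 6).affixPath 0 2).affixPath (Sum.inl 2) 1).affixPath (Sum.inl (Sum.inl 4)) 1

/-- `U''_8`: in `C''_8`, paths of order `3` are affixed at `v_1` and at `v_5`. -/
def U8Neg : MixedGraph ((Fin 8 ⊕ Fin 2) ⊕ Fin 2) :=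
  ((cycleNeg 8).affixPath 0 2).affixPath (Sum.inl 4) 2

end MixedGraph

/-!
The number `√(2 + √5)` is `gr ^ 3`, where `gr` is the square root of the golden ratio (`gr_cube`). So
the spectral radius is at most this number if and only if the quadratic forms of `gr ^ 3 - H` and
`gr ^ 3 + H` are positive semidefinite (`MixedGraph.spectralRadius_le_iff`, where `energy` is the
first form). This is decided by eliminating vertices. On a path with `m` edges the Schur complement
of the inner vertices has the explicit coefficients `arcDiag m` and `arcOff m`, by `arc_ge` and
`exists_arc_eq`, which are rational functions of `gr ^ m`.

Up to switching, a cycle with paths affixed at its vertices (`IsSkeleton`) is determined by its shape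
and the weight of the cycle, the product of the entries of `H` along it, which is a fourth root of
unity. Eliminating the affixed paths leaves a form on the cycle, with lowered diagonal entries
(`CycleNonneg`, `IsSkeleton.cycle_nonneg`, `IsSkeleton.energy_nonneg`), and eliminating all but one or
two vertices of the cycle leaves explicit forms in one or two variables (`CycleNonneg.single`,
`CycleNonneg.pair`, with the converses `cycleNonneg_of_single`, `cycleNonneg_of_pair`).

For the necessity, a unicyclic mixed graph either is a cycle with paths affixed, or contains one and a
further vertex that branches off from an affixed path (`MixedGraph.IsUnicyclic.exists_isSkeleton`). A
branch weighs more than an infinite path (`IsSkeleton.cycle_pos_of_branch`), which excludes it except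
when the weight is `-1` and the cycle is odd or of length `4`. In the first case `-H` has weight `1`,
and the second is the excluded `C''_4`. The conditions on one or two paths then bound their number,
lengths and distances: none for weight `1` (`IsSkeleton.eq_zero_of_one`), at most one for weight `i`
or `-i` (`PairNonneg.false_of_im`), and nearly antipodal paths for weight `-1` and even length
(`PairNonneg.neg_dist`). The skeletons that remain are part of skeletons of the listed graphs with
the same weight or its conjugate, which gives induced subgraphs up to switching isomorphism
(`MixedGraph.isInducedSubgraph_of_isSkeleton`).

For the sufficiency, the bound passes to induced subgraphs
(`MixedGraph.spectralRadius_le_of_isInducedSubgraph`), and the same eliminations show that the listed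
graphs satisfy it. Each has affixed paths at no more than two cycle vertices, except for `U''_6`,
where a form in three variables remains (`U6_form_nonneg`).
-/

open ComplexConjugate Finset

/-! ### Hoffman's limit value -/

/-- The square root of the golden ratio. It satisfies `gr ^ 4 = gr ^ 2 + 1`, and Hoffman's limit
value `√(2 + √5)` is its cube. -/
noncomputable def gr : ℝ := √Real.goldenRatio

theorem gr_sq : gr ^ 2 = Real.goldenRatio := Real.sq_sqrt Real.goldenRatio_pos.le

theorem gr_pow_four : gr ^ 4 = gr ^ 2 + 1 := by
  have := Real.goldenRatio_sq
  rw [← gr_sq] at this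
  linear_combination this

theorem gr_pos : 0 < gr := Real.sqrt_pos.2 Real.goldenRatio_pos

theorem gr_sq_gt : 1.6 < gr ^ 2 := by
  nlinarith [gr_pow_four, sq_nonneg (gr ^ 2), pow_pos gr_pos 2]

theorem gr_sq_lt : gr ^ 2 < 1.62 := by
  nlinarith [gr_pow_four, sq_nonneg (gr ^ 2), pow_pos gr_pos 2]

theorem one_lt_gr : 1 < gr := by
  nlinarith [gr_sq_gt, gr_pos]

theorem gr_cube : gr ^ 3 = √(2 + √5) := by
  symm
  rw [Real.sqrt_eq_iff_mul_self_eq (by positivity) (pow_pos gr_pos 3).le]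
  have h : √5 = 2 * gr ^ 2 - 1 := by rw [gr_sq, Real.goldenRatio]; ring
  rw [h]
  linear_combination -(gr ^ 2 + 1) * gr_pow_four

theorem one_lt_gr_pow {m : ℕ} (hm : 1 ≤ m) : 1 < gr ^ m := one_lt_pow₀ one_lt_gr (by omega)

/-! ### Eliminating the inner vertices of a path

At the value `gr ^ 3` the quadratic form of a path with `m` edges, minimised over its inner vertices,
is a form in the two end values with the coefficients `arcDiag m` and `arcOff m`. -/

/-- The number `1 / (gr ^ (2 m) - 1)`, the deviation of `gr ^ 3 * arcDiag m` from its limit. -/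
noncomputable def arcT (m : ℕ) : ℝ := 1 / (gr ^ (2 * m) - 1)

/-- The number `gr ^ m / (gr ^ (2 m) - 1)`, which is `gr ^ 3 * arcOff m`. -/
noncomputable def arcS (m : ℕ) : ℝ := gr ^ m / (gr ^ (2 * m) - 1)

/-- The Schur complement of the inner vertices of a path with `m` edges subtracts this number
from the diagonal entries of the end vertices. -/
noncomputable def arcDiag (m : ℕ) : ℝ := (gr ^ 2 - arcT m) / gr ^ 3

/-- The Schur complement of the inner vertices of a path with `m` edges couples the end vertices
with this weight. -/
noncomputable def arcOff (m : ℕ) : ℝ := arcS m / gr ^ 3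

theorem arcT_pos {m : ℕ} (hm : 1 ≤ m) : 0 < arcT m :=
  one_div_pos.2 (sub_pos.2 (one_lt_gr_pow (by omega)))

theorem arcT_one : arcT 1 = gr ^ 2 := by
  have := gr_sq_gt
  rw [arcT, mul_one, div_eq_iff (by linarith)]
  linear_combination -gr_pow_four

theorem arcS_sq {m : ℕ} (hm : 1 ≤ m) : arcS m ^ 2 = arcT m ^ 2 + arcT m := by
  have : gr ^ (2 * m) - 1 ≠ 0 := (sub_pos.2 (one_lt_gr_pow (by omega))).ne'
  rw [arcS, arcT]
  field_simp
  rw [← pow_mul, mul_comm m 2]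
  ring

theorem arcDiag_one : arcDiag 1 = 0 := by rw [arcDiag, arcT_one]; simp

theorem arcOff_one : arcOff 1 = 1 := by
  have := gr_sq_gt
  have := gr_pos
  rw [arcOff, arcS, mul_one, pow_one, div_div,
    div_eq_iff (mul_ne_zero (by linarith) (pow_ne_zero 3 this.ne'))]
  linear_combination -gr * gr_pow_four

theorem arcDiag_lt {m : ℕ} (hm : 1 ≤ m) : arcDiag m < gr ^ 2 / gr ^ 3 := by
  rw [arcDiag]
  exact div_lt_div_of_pos_right (by linarith [arcT_pos hm]) (pow_pos gr_pos 3)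

theorem arcDiag_lt_cube {m : ℕ} (hm : 1 ≤ m) : arcDiag m < gr ^ 3 := by
  refine (arcDiag_lt hm).trans ?_
  have := gr_pos
  rw [div_lt_iff₀ (by positivity)]
  nlinarith [gr_pow_four, gr_sq_gt]

theorem cube_sub_arcDiag {m : ℕ} (hm : 1 ≤ m) :
    gr ^ 3 - arcDiag m = gr ^ 2 * (gr ^ 2 * gr ^ (2 * m) - 1) / ((gr ^ (2 * m) - 1) * gr ^ 3) := by
  have h1 : gr ^ (2 * m) - 1 ≠ 0 := (sub_pos.2 (one_lt_gr_pow (by omega))).ne'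
  have := gr_pos
  rw [arcDiag, arcT]
  field_simp
  generalize gr ^ (2 * m) = P
  linear_combination ((P - 1) * (gr ^ 2 + 1) - P) * gr_pow_four

/-- One step of the elimination: the diagonal entry `gr ^ 3 - arcDiag m` is inverted. -/
theorem arcDiag_succ_mul {m : ℕ} (hm : 1 ≤ m) : arcDiag (m + 1) * (gr ^ 3 - arcDiag m) = 1 := by
  have h1 : gr ^ (2 * m) - 1 ≠ 0 := (sub_pos.2 (one_lt_gr_pow (by omega))).ne'
  have h2 : gr ^ 2 * gr ^ (2 * m) - 1 ≠ 0 := by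
    rw [← pow_add]
    exact (sub_pos.2 (one_lt_gr_pow (by omega))).ne'
  have := gr_pos
  rw [cube_sub_arcDiag hm, arcDiag, arcT, show 2 * (m + 1) = 2 + 2 * m by ring, pow_add]
  field_simp
  generalize gr ^ (2 * m) = P
  linear_combination gr_pow_four

theorem arcOff_succ {m : ℕ} (hm : 1 ≤ m) : arcOff (m + 1) = arcOff m * arcDiag (m + 1) := by
  have h1 : gr ^ (2 * m) - 1 ≠ 0 := (sub_pos.2 (one_lt_gr_pow (by omega))).ne'
  have h2 : gr ^ 2 * gr ^ (2 * m) - 1 ≠ 0 := by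
    rw [← pow_add]
    exact (sub_pos.2 (one_lt_gr_pow (by omega))).ne'
  have := gr_pos
  rw [arcOff, arcOff, arcDiag, arcT, arcS, arcS, show 2 * (m + 1) = 2 + 2 * m by ring,
    pow_add gr 2, pow_succ gr m]
  generalize gr ^ (2 * m) = P at *
  generalize gr ^ m = p
  field_simp
  linear_combination (-p) * gr_pow_four

theorem arcDiag_succ_sub {m : ℕ} (hm : 1 ≤ m) :
    arcDiag (m + 1) - arcDiag m = arcOff m ^ 2 * arcDiag (m + 1) := by
  have h1 : gr ^ (2 * m) - 1 ≠ 0 := (sub_pos.2 (one_lt_gr_pow (by omega))).ne'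
  have h2 : gr ^ 2 * gr ^ (2 * m) - 1 ≠ 0 := by
    rw [← pow_add]
    exact (sub_pos.2 (one_lt_gr_pow (by omega))).ne'
  have := gr_pos
  have h3 : (gr ^ m) ^ 2 = gr ^ (2 * m) := by rw [← pow_mul, mul_comm m 2]
  rw [arcOff, arcDiag, arcDiag, arcT, arcT, arcS, show 2 * (m + 1) = 2 + 2 * m by ring, pow_add,
    div_pow, div_pow, h3]
  generalize gr ^ (2 * m) = P at *
  field_simp
  linear_combination (-P - gr ^ 4 * P * (1 - P)) * gr_pow_four

/-- The quadratic form `gr ^ 3 |y_j|² - 2 Re (conj y_j y_{j+1})` of one vertex of a path together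
with the edge that follows it. -/
noncomputable def edgeEnergy (y : ℕ → ℂ) (j : ℕ) : ℝ :=
  gr ^ 3 * Complex.normSq (y j) - 2 * (conj (y j) * y (j + 1)).re

/-- Each step of the induction completes the square at the last inner vertex, whose diagonal entry has
become `gr ^ 3 - arcDiag m` by eliminating the vertices before it. -/
theorem arc_ge {m : ℕ} (hm : 1 ≤ m) (y : ℕ → ℂ) :
    gr ^ 3 * Complex.normSq (y 0) - arcDiag m * (Complex.normSq (y 0) + Complex.normSq (y m))
      - 2 * arcOff m * (conj (y 0) * y m).re ≤ ∑ j ∈ range m, edgeEnergy y j := by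
  induction m, hm using Nat.le_induction with
  | base => simp [arcDiag_one, arcOff_one, edgeEnergy]
  | succ m hm ih =>
    rw [sum_range_succ, edgeEnergy]
    have hA : 0 ≤ arcDiag (m + 1) := by
      nlinarith [arcDiag_succ_mul hm, arcDiag_lt_cube hm]
    have key := mul_nonneg hA (Complex.normSq_nonneg
      ((gr ^ 3 - arcDiag m : ℝ) * y m - y (m + 1) - (arcOff m : ℝ) * y 0))
    have h1 := arcDiag_succ_mul hm
    have h2 := arcOff_succ hm
    have h3 := arcDiag_succ_sub hm
    simp only [Complex.normSq_apply, Complex.mul_re, Complex.mul_im, Complex.sub_re,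
      Complex.sub_im, Complex.ofReal_re, Complex.ofReal_im, Complex.conj_re, Complex.conj_im]
      at key ih ⊢
    generalize (y 0).re = x1 at *
    generalize (y 0).im = x2 at *
    generalize (y m).re = z1 at *
    generalize (y m).im = z2 at *
    generalize (y (m + 1)).re = w1 at *
    generalize (y (m + 1)).im = w2 at *
    rw [h2]
    generalize arcDiag (m + 1) = A' at *
    generalize arcDiag m = A at *
    generalize arcOff m = B at *
    have e : A' * (gr ^ 3 - A) ^ 2 = gr ^ 3 - A := by rw [sq, ← mul_assoc, h1, one_mul]
    have key' : A' * (((gr ^ 3 - A) * z1 - 0 * z2 - w1 - (B * x1 - 0 * x2)) *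
          ((gr ^ 3 - A) * z1 - 0 * z2 - w1 - (B * x1 - 0 * x2)) +
        ((gr ^ 3 - A) * z2 + 0 * z1 - w2 - (B * x2 + 0 * x1)) *
          ((gr ^ 3 - A) * z2 + 0 * z1 - w2 - (B * x2 + 0 * x1))) =
        (gr ^ 3 - A) * (z1 * z1 + z2 * z2) - 2 * (z1 * (w1 + B * x1) + z2 * (w2 + B * x2))
          + A' * (w1 * w1 + w2 * w2) + 2 * A' * B * (w1 * x1 + w2 * x2)
          + (A' - A) * (x1 * x1 + x2 * x2) := by
      linear_combination (z1 * z1 + z2 * z2) * e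
        - 2 * (z1 * (w1 + B * x1) + z2 * (w2 + B * x2)) * h1 - (x1 * x1 + x2 * x2) * h3
    rw [key'] at key
    linarith

/-- The bound `arc_ge` is attained for any prescribed end values. -/
theorem exists_arc_eq {m : ℕ} (hm : 1 ≤ m) (p q : ℂ) : ∃ y : ℕ → ℂ, y 0 = p ∧ y m = q ∧
    ∑ j ∈ range m, edgeEnergy y j =
      gr ^ 3 * Complex.normSq p - arcDiag m * (Complex.normSq p + Complex.normSq q)
        - 2 * arcOff m * (conj p * q).re := by
  induction m, hm using Nat.le_induction generalizing q with
  | base =>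
    refine ⟨fun j => if j = 0 then p else q, by simp, by simp, ?_⟩
    simp [arcDiag_one, arcOff_one, edgeEnergy]
  | succ m hm ih =>
    obtain ⟨y, h0, hy, h⟩ := ih ((arcDiag (m + 1) : ℝ) * (q + (arcOff m : ℝ) * p))
    refine ⟨Function.update y (m + 1) q, by simp [h0], by simp, ?_⟩
    have hs : ∑ j ∈ range m, edgeEnergy (Function.update y (m + 1) q) j =
        ∑ j ∈ range m, edgeEnergy y j := by
      refine sum_congr rfl fun j hj => ?_
      have := mem_range.1 hj
      rw [edgeEnergy, edgeEnergy, Function.update_of_ne (by omega), Function.update_of_ne (by omega)]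
    rw [sum_range_succ, hs, h, edgeEnergy, Function.update_self, Function.update_of_ne (by omega),
      hy]
    have h1 := arcDiag_succ_mul hm
    have h2 := arcOff_succ hm
    have h3 := arcDiag_succ_sub hm
    simp only [Complex.normSq_apply, Complex.mul_re, Complex.mul_im, Complex.add_re,
      Complex.add_im, Complex.ofReal_re, Complex.ofReal_im, Complex.conj_re, Complex.conj_im]
    rw [h2]
    generalize arcDiag (m + 1) = A' at *
    generalize arcDiag m = A at *
    generalize arcOff m = B at *
    have e : A' ^ 2 * (gr ^ 3 - A) = A' := by rw [sq, mul_assoc, h1, mul_one]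
    linear_combination ((q.re + B * p.re) ^ 2 + (q.im + B * p.im) ^ 2) * e
      + (p.re ^ 2 + p.im ^ 2) * h3

/-- A path with `a` edges affixed at a vertex contributes at least this to the quadratic form: it is
a path with `a + 1` edges whose last vertex carries the value `0`. -/
theorem tail_ge (a : ℕ) (z : ℕ → ℂ) :
    -(arcDiag (a + 1) * Complex.normSq (z 0)) ≤
      ∑ k ∈ range a, (gr ^ 3 * Complex.normSq (z (k + 1)) - 2 * (conj (z k) * z (k + 1)).re) := by
  have h := arc_ge (Nat.le_add_left 1 a) (fun k => if k ≤ a then z k else 0)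
  have hs : ∑ j ∈ range (a + 1), edgeEnergy (fun k => if k ≤ a then z k else 0) j =
      gr ^ 3 * Complex.normSq (z 0) + ∑ k ∈ range a,
        (gr ^ 3 * Complex.normSq (z (k + 1)) - 2 * (conj (z k) * z (k + 1)).re) := by
    simp only [edgeEnergy, sum_sub_distrib]
    rw [sum_range_succ', sum_range_succ (fun x => 2 * _)]
    have e1 : ∑ k ∈ range a, gr ^ 3 * Complex.normSq (if k + 1 ≤ a then z (k + 1) else 0) =
        ∑ k ∈ range a, gr ^ 3 * Complex.normSq (z (k + 1)) :=
      sum_congr rfl fun k hk => by rw [if_pos (by have := mem_range.1 hk; omega)]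
    have e2 : ∑ k ∈ range a, 2 * (conj (if k ≤ a then z k else 0) *
        (if k + 1 ≤ a then z (k + 1) else 0)).re =
        ∑ k ∈ range a, 2 * (conj (z k) * z (k + 1)).re :=
      sum_congr rfl fun k hk => by
        have := mem_range.1 hk
        rw [if_pos (by omega), if_pos (by omega)]
    rw [e1, e2]
    simp
    ring
  rw [hs] at h
  simp [sum_sub_distrib] at h ⊢
  linarith

/-- The bound `tail_ge` is attained for any prescribed value at the vertex of attachment. -/
theorem exists_tail_eq (a : ℕ) (p : ℂ) : ∃ z : ℕ → ℂ, z 0 = p ∧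
    ∑ k ∈ range a, (gr ^ 3 * Complex.normSq (z (k + 1)) - 2 * (conj (z k) * z (k + 1)).re) =
      -(arcDiag (a + 1) * Complex.normSq p) := by
  obtain ⟨z, h0, ha, h⟩ := exists_arc_eq (Nat.le_add_left 1 a) p 0
  refine ⟨z, h0, ?_⟩
  simp only [edgeEnergy, sum_sub_distrib] at h ⊢
  rw [sum_range_succ', sum_range_succ (fun x => 2 * _), h0, ha] at h
  simp at h ⊢
  linarith

/-! ### The spectral radius and the quadratic form -/

section Energy

variable {V : Type*} [Fintype V]

/-- The value at `x` of the quadratic form of `gr ^ 3 - H`. -/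
noncomputable def energy (H : Matrix V V ℂ) (x : V → ℂ) : ℝ :=
  gr ^ 3 * ∑ v, Complex.normSq (x v) - ∑ u, ∑ v, (conj (x u) * H u v * x v).re

theorem energy_eq (H : Matrix V V ℂ) (x : V → ℂ) :
    energy H x = gr ^ 3 * (star x ⬝ᵥ x).re - (star x ⬝ᵥ H.mulVec x).re := by
  simp only [energy, dotProduct, Matrix.mulVec, Complex.re_sum, mul_sum, Pi.star_apply, mul_assoc,
    RCLike.star_def]
  congr 1
  refine sum_congr rfl fun v _ => ?_
  rw [← Complex.normSq_eq_conj_mul_self, Complex.ofReal_re]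

open scoped ComplexOrder in
/-- An upper bound for the eigenvalues of `H` (for `ε = 1`) or of `-H` (for `ε = -1`) amounts to a
positive semidefinite form. -/
theorem eigenvalues_le_iff_energy [DecidableEq V] {H : Matrix V V ℂ} (hH : H.IsHermitian) (ε : ℝ) :
    (∀ i, ε * hH.eigenvalues i ≤ gr ^ 3) ↔ ∀ x, 0 ≤ energy ((ε : ℂ) • H) x := by
  constructor
  · intro h x
    obtain ⟨U, hU⟩ : ∃ U : Matrix V V ℂ, U = hH.eigenvectorUnitary.1 := ⟨_, rfl⟩
    have hUU : U * star U = 1 := hU ▸ Unitary.coe_mul_star_self _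
    set D : Matrix V V ℂ :=
      Matrix.diagonal (fun i => ((gr ^ 3 - ε * hH.eigenvalues i : ℝ) : ℂ)) with hD
    have hP : D.PosSemidef := by
      rw [hD, Matrix.posSemidef_diagonal_iff]
      intro i
      exact_mod_cast sub_nonneg.2 (h i)
    have hQ : (U * D * star U).PosSemidef := hP.mul_mul_conjTranspose_same U
    have key : U * D * star U = ((gr ^ 3 : ℝ) : ℂ) • 1 - (ε : ℂ) • H := by
      have hs := hH.spectral_theorem
      rw [Unitary.conjStarAlgAut_apply] at hs
      have : D = ((gr ^ 3 : ℝ) : ℂ) • 1 -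
          (ε : ℂ) • Matrix.diagonal (RCLike.ofReal ∘ hH.eigenvalues) := by
        ext i j
        by_cases hij : i = j <;> simp [hD, Matrix.diagonal, hij]
      rw [this, mul_sub, sub_mul]
      conv_rhs => rw [hs]
      simp [← hU, hUU]
    have := hQ.re_dotProduct_nonneg x
    rw [key, Matrix.sub_mulVec, dotProduct_sub, Matrix.smul_mulVec, Matrix.one_mulVec,
      dotProduct_smul, smul_eq_mul] at this
    rw [energy_eq]
    simpa [-Complex.ofReal_pow, -Complex.ofReal_mul] using this
  · intro h i
    have := h (hH.eigenvectorBasis i)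
    rw [energy_eq] at this
    have e := hH.eigenvalues_eq i
    have n : (star (hH.eigenvectorBasis i).ofLp ⬝ᵥ (hH.eigenvectorBasis i).ofLp) = 1 := by
      rw [dotProduct_comm, ← EuclideanSpace.inner_eq_star_dotProduct, inner_self_eq_norm_sq_to_K,
        hH.eigenvectorBasis.orthonormal.1 i]
      simp
    rw [n] at this
    rw [e]
    simpa [Matrix.smul_mulVec] using this

theorem MixedGraph.spectralRadius_le_iff (M : MixedGraph V) :
    M.spectralRadius ≤ gr ^ 3 ↔
      (∀ x, 0 ≤ energy M.hMatrix x) ∧ ∀ x, 0 ≤ energy (-M.hMatrix) x := by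
  classical
  have h1 := eigenvalues_le_iff_energy M.isHermitian_hMatrix 1
  have h2 := eigenvalues_le_iff_energy M.isHermitian_hMatrix (-1)
  simp only [one_mul, Complex.ofReal_one, one_smul, Complex.ofReal_neg, neg_smul, neg_mul]
    at h1 h2
  rw [← h1, ← h2, ← forall_and, MixedGraph.spectralRadius]
  constructor
  · intro h i
    have := abs_le.1 ((le_ciSup (Set.finite_range _).bddAbove i).trans h)
    constructor
    · convert this.2
    · convert neg_le.1 this.1
  · intro h
    refine Real.iSup_le (fun i => abs_le.2 ⟨?_, ?_⟩) (pow_pos gr_pos 3).le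
    · convert neg_le.1 (h i).2
    · convert (h i).1

/-- The change of the quadratic form when a vector receives a value at a vertex `v` that lies outside
its support and has at most the neighbour `s` in it. -/
theorem energy_update [DecidableEq V] {H : Matrix V V ℂ} (hH : H.IsHermitian) {x : V → ℂ} {s v : V}
    (hv : x v = 0) (hvv : H v v = 0) (hs : ∀ u, H v u ≠ 0 → x u ≠ 0 → u = s) (z : ℂ) :
    energy H (Function.update x v z) =
      energy H x + gr ^ 3 * Complex.normSq z - 2 * (conj z * H v s * x s).re := by
  have hup : Function.update x v z = x + Pi.single v z := by
    ext u
    by_cases h : u = v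
    · subst h; simp [hv]
    · simp [h]
  have hHx : ∑ u, H v u * x u = H v s * x s := by
    refine sum_eq_single s (fun u _ hu => ?_) (by simp)
    by_contra h
    exact hu (hs u (left_ne_zero_of_mul h) (right_ne_zero_of_mul h))
  have hxH : ∑ u, conj (x u) * H u v = conj (H v s * x s) := by
    rw [← hHx, map_sum]
    refine sum_congr rfl fun u _ => ?_
    rw [map_mul, mul_comm, ← hH.apply u v]
    simp
  have e1 : star x ⬝ᵥ H.mulVec (Pi.single v z) = conj (H v s * x s) * z := by
    rw [← hxH, sum_mul]
    simp [dotProduct, Matrix.mulVec_single, mul_assoc]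
  have e2 : star (Pi.single v z : V → ℂ) ⬝ᵥ H.mulVec x = conj z * (H v s * x s) := by
    rw [← hHx, Pi.star_single, single_dotProduct]
    rfl
  have e3 : star (Pi.single v z : V → ℂ) ⬝ᵥ H.mulVec (Pi.single v z) = 0 := by
    rw [Pi.star_single, single_dotProduct]
    simp [hvv]
  have e4 : star x ⬝ᵥ (Pi.single v z) = 0 := by simp [hv]
  have e5 : star (Pi.single v z : V → ℂ) ⬝ᵥ x = 0 := by rw [Pi.star_single]; simp [hv]
  have e6 : star (Pi.single v z : V → ℂ) ⬝ᵥ (Pi.single v z) = Complex.normSq z := by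
    rw [Pi.star_single, single_dotProduct, Complex.normSq_eq_conj_mul_self]; simp
  rw [energy_eq, energy_eq, hup, star_add, Matrix.mulVec_add]
  simp only [dotProduct_add, add_dotProduct, e1, e2, e3, e4, e5, e6, Complex.add_re,
    Complex.zero_re, Complex.ofReal_re]
  simp only [Complex.mul_re, Complex.mul_im, Complex.conj_re, Complex.conj_im]
  ring

end Energy

/-! ### Skeletons: cycles with paths affixed -/

/-- The group of fourth roots of unity in `ℂ`. -/
def fourthRoots : Set ℂ := {1, -1, Complex.I, -Complex.I}

theorem one_mem_fourthRoots : (1 : ℂ) ∈ fourthRoots := by simp [fourthRoots]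

theorem mul_mem_fourthRoots {a b : ℂ} (ha : a ∈ fourthRoots) (hb : b ∈ fourthRoots) :
    a * b ∈ fourthRoots := by
  rcases ha with rfl | rfl | rfl | rfl <;> rcases hb with rfl | rfl | rfl | rfl <;>
    simp [fourthRoots]

theorem inv_mem_fourthRoots {a : ℂ} (ha : a ∈ fourthRoots) : a⁻¹ ∈ fourthRoots := by
  rcases ha with rfl | rfl | rfl | rfl <;> simp [fourthRoots]

theorem neg_mem_fourthRoots {a : ℂ} (ha : a ∈ fourthRoots) : -a ∈ fourthRoots := by
  rcases ha with rfl | rfl | rfl | rfl <;> simp [fourthRoots]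

theorem conj_mem_fourthRoots {a : ℂ} (ha : a ∈ fourthRoots) : conj a ∈ fourthRoots := by
  rcases ha with rfl | rfl | rfl | rfl <;> simp [fourthRoots]

theorem conj_eq_inv_of_mem_fourthRoots {a : ℂ} (ha : a ∈ fourthRoots) : conj a = a⁻¹ := by
  rcases ha with rfl | rfl | rfl | rfl <;> simp

theorem normSq_of_mem_fourthRoots {a : ℂ} (ha : a ∈ fourthRoots) : Complex.normSq a = 1 := by
  rcases ha with rfl | rfl | rfl | rfl <;> simp

theorem ne_zero_of_mem_fourthRoots {a : ℂ} (ha : a ∈ fourthRoots) : a ≠ 0 := by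
  rcases ha with rfl | rfl | rfl | rfl <;> simp

theorem prod_mem_fourthRoots {ι : Type*} (s : Finset ι) (F : ι → ℂ)
    (h : ∀ i ∈ s, F i ∈ fourthRoots) : ∏ i ∈ s, F i ∈ fourthRoots :=
  prod_induction F (· ∈ fourthRoots) (fun _ _ => mul_mem_fourthRoots) one_mem_fourthRoots h

/-- The vertex `(i, k)` at height `k` above the cycle vertex `i` is followed by the vertex `(j, l)`:
along the cycle, or along the path affixed at `i`. -/
def SkelLink {g : ℕ} (i : ZMod g) (k : ℕ) (j : ZMod g) (l : ℕ) : Prop :=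
  (k = 0 ∧ l = 0 ∧ j = i + 1) ∨ (j = i ∧ l = k + 1)

/-- The vertices `f i k` with `i : ZMod g` and `k ≤ ℓ i` are distinct and induce in the matrix `H` a
cycle `f 0 0, f 1 0, …` of length `g` with a path of `ℓ i` new vertices `f i 1, …, f i (ℓ i)` affixed
at each cycle vertex `f i 0`: the entries of `H` along these edges are fourth roots of unity, and
the other entries between such vertices vanish. Values `f i k` with `k > ℓ i` are irrelevant. -/
structure IsSkeleton {V : Type*} (H : Matrix V V ℂ) (g : ℕ) (ℓ : ZMod g → ℕ)
    (f : ZMod g → ℕ → V) : Prop where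
  three_le : 3 ≤ g
  herm : H.IsHermitian
  inj : ∀ i k j l, k ≤ ℓ i → l ≤ ℓ j → f i k = f j l → i = j ∧ k = l
  cyc : ∀ i, H (f i 0) (f (i + 1) 0) ∈ fourthRoots
  tail : ∀ i k, k < ℓ i → H (f i k) (f i (k + 1)) ∈ fourthRoots
  zero : ∀ i k j l, k ≤ ℓ i → l ≤ ℓ j → H (f i k) (f j l) ≠ 0 →
    SkelLink i k j l ∨ SkelLink j l i k

/-- The vertices of a skeleton are all vertices. -/
def SkelCovers {V : Type*} {g : ℕ} (ℓ : ZMod g → ℕ) (f : ZMod g → ℕ → V) : Prop :=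
  ∀ u, ∃ i k, k ≤ ℓ i ∧ f i k = u

/-- The weight of the cycle of a skeleton. -/
noncomputable def skelWeight {V : Type*} (H : Matrix V V ℂ) (g : ℕ) (f : ZMod g → ℕ → V) : ℂ :=
  ∏ j ∈ range g, H (f j 0) (f (j + 1) 0)

theorem sum_zmod_eq_sum_range {β : Type*} [AddCommMonoid β] (g : ℕ) [NeZero g] (F : ZMod g → β) :
    ∑ i, F i = ∑ j ∈ range g, F j := by
  refine sum_nbij' (fun i => i.val) (fun j => (j : ZMod g)) ?_ ?_ ?_ ?_ ?_
  · intro i _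
    exact mem_range.2 i.val_lt
  · simp
  · intro i _
    simp
  · intro j hj
    exact ZMod.val_natCast_of_lt (mem_range.1 hj)
  · intro i _
    simp

theorem prod_zmod_eq_prod_range {β : Type*} [CommMonoid β] (g : ℕ) [NeZero g] (F : ZMod g → β) :
    ∏ i, F i = ∏ j ∈ range g, F j :=
  sum_zmod_eq_sum_range (β := Additive β) g F

theorem zmod_two_ne_zero {g : ℕ} (hg : 3 ≤ g) : (2 : ZMod g) ≠ 0 := by
  intro h
  have := (ZMod.natCast_eq_zero_iff 2 g).1 (by exact_mod_cast h)
  have := Nat.le_of_dvd (by norm_num) this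
  omega

theorem SkelLink.asymm {g : ℕ} (hg : 3 ≤ g) {i j : ZMod g} {k l : ℕ} (h : SkelLink i k j l) :
    ¬ SkelLink j l i k := by
  rintro (⟨h1, h2, h3⟩ | ⟨h1, h2⟩) <;> rcases h with ⟨h4, h5, h6⟩ | ⟨h4, h5⟩ <;> try omega
  rw [h6, add_assoc, left_eq_add, one_add_one_eq_two] at h3
  exact zmod_two_ne_zero hg h3

namespace IsSkeleton

variable {V : Type*} {H : Matrix V V ℂ} {g : ℕ} {ℓ : ZMod g → ℕ} {f : ZMod g → ℕ → V}

theorem neZero (hs : IsSkeleton H g ℓ f) : NeZero g := ⟨by have := hs.three_le; omega⟩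

theorem mono (hs : IsSkeleton H g ℓ f) {ℓ' : ZMod g → ℕ} (h : ∀ i, ℓ' i ≤ ℓ i) :
    IsSkeleton H g ℓ' f where
  three_le := hs.three_le
  herm := hs.herm
  inj i k j l hk hl := hs.inj i k j l (hk.trans (h i)) (hl.trans (h j))
  cyc := hs.cyc
  tail i k hk := hs.tail i k (hk.trans_le (h i))
  zero i k j l hk hl := hs.zero i k j l (hk.trans (h i)) (hl.trans (h j))

theorem rotate (hs : IsSkeleton H g ℓ f) (r : ZMod g) :
    IsSkeleton H g (fun i => ℓ (i + r)) (fun i => f (i + r)) where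
  three_le := hs.three_le
  herm := hs.herm
  inj i k j l hk hl h := by
    have := hs.inj _ _ _ _ hk hl h
    exact ⟨add_right_cancel this.1, this.2⟩
  cyc i := by
    have := hs.cyc (i + r)
    rwa [add_right_comm] at this
  tail i k hk := hs.tail _ k hk
  zero i k j l hk hl h := by
    have := hs.zero _ _ _ _ hk hl h
    simp only [SkelLink, add_right_comm _ r (1 : ZMod g), add_left_inj] at this ⊢
    exact this

theorem skelWeight_rotate (hs : IsSkeleton H g ℓ f) (r : ZMod g) :
    skelWeight H g (fun i => f (i + r)) = skelWeight H g f := by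
  have := hs.neZero
  simp only [skelWeight]
  rw [← prod_zmod_eq_prod_range g (fun i => H (f (i + r) 0) (f (i + 1 + r) 0)),
    ← prod_zmod_eq_prod_range g (fun i => H (f i 0) (f (i + 1) 0))]
  exact Fintype.prod_equiv (Equiv.addRight r) _ _ fun i => by simp [add_right_comm]

theorem neg (hs : IsSkeleton H g ℓ f) : IsSkeleton (-H) g ℓ f where
  three_le := hs.three_le
  herm := hs.herm.neg
  inj := hs.inj
  cyc i := neg_mem_fourthRoots (hs.cyc i)
  tail i k hk := neg_mem_fourthRoots (hs.tail i k hk)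
  zero i k j l hk hl h := hs.zero i k j l hk hl fun h' => h (by simp [h'])

theorem skelWeight_neg : skelWeight (-H) g f = (-1) ^ g * skelWeight H g f := by
  simp only [skelWeight, Matrix.neg_apply]
  rw [prod_neg, card_range]

theorem skelWeight_mem (hs : IsSkeleton H g ℓ f) : skelWeight H g f ∈ fourthRoots :=
  prod_mem_fourthRoots _ _ fun _ _ => hs.cyc _

section Sums

variable [Fintype V]

theorem sum_eq (hs : IsSkeleton H g ℓ f) [NeZero g] {β : Type*} [AddCommMonoid β] (F : V → β)
    (hF : ∀ u, F u ≠ 0 → ∃ i k, k ≤ ℓ i ∧ f i k = u) :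
    ∑ u, F u = ∑ i, ∑ k ∈ range (ℓ i + 1), F (f i k) := by
  rw [sum_sigma']
  symm
  refine sum_of_injOn (fun a => f a.1 a.2) ?_ ?_ ?_ ?_
  · rintro ⟨i, k⟩ hi ⟨j, l⟩ hj h
    simp only [coe_sigma, Set.mem_sigma_iff, coe_range, Set.mem_Iio] at hi hj
    obtain ⟨h1, h2⟩ := hs.inj i k j l (by omega) (by omega) h
    subst h1 h2
    rfl
  · simp
  · intro u _ hu
    by_contra h
    obtain ⟨i, k, hk, rfl⟩ := hF u h
    exact hu ⟨⟨i, k⟩, by simp; omega, rfl⟩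
  · simp

/-- The quadratic form on vectors supported on a skeleton. -/
theorem energy_eq_sum (hs : IsSkeleton H g ℓ f) [NeZero g] (x : V → ℂ)
    (hx : ∀ u, x u ≠ 0 → ∃ i k, k ≤ ℓ i ∧ f i k = u) :
    energy H x = ∑ i, (gr ^ 3 * Complex.normSq (x (f i 0))
      - 2 * (conj (x (f i 0)) * H (f i 0) (f (i + 1) 0) * x (f (i + 1) 0)).re
      + ∑ k ∈ range (ℓ i), (gr ^ 3 * Complex.normSq (x (f i (k + 1)))
        - 2 * (conj (x (f i k)) * H (f i k) (f i (k + 1)) * x (f i (k + 1))).re)) := by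
  classical
  set B : ZMod g → ℕ → ZMod g → ℕ → ℝ := fun i k j l =>
    (conj (x (f i k)) * H (f i k) (f j l) * x (f j l)).re with hB
  have hBsymm : ∀ i k j l, B i k j l = B j l i k := by
    intro i k j l
    simp only [hB]
    rw [← Complex.conj_re, ← hs.herm.apply (f i k) (f j l)]
    simp only [map_mul, Complex.conj_conj, RCLike.star_def]
    ring_nf
  -- the part of the form that belongs to the links leaving a given vertex
  have hL : ∀ i, ∀ k ∈ range (ℓ i + 1), ∑ j, ∑ l ∈ range (ℓ j + 1),
      (if SkelLink i k j l then B i k j l else 0) =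
      (if k = 0 then B i 0 (i + 1) 0 else 0) + if k < ℓ i then B i k i (k + 1) else 0 := by
    intro i k hk
    have h1 : ∀ j, ∀ l ∈ range (ℓ j + 1), (if SkelLink i k j l then B i k j l else 0) =
        (if j = i + 1 then (if l = 0 then (if k = 0 then B i 0 j 0 else 0) else 0) else 0) +
        (if j = i then (if l = k + 1 then B i k j l else 0) else 0) := by
      intro j l _
      by_cases a : l = 0
      · by_cases b : k = 0 <;> by_cases c : j = i + 1 <;> simp [SkelLink, a, b, c]
      · by_cases c : j = i <;> by_cases d : l = k + 1 <;> simp [SkelLink, a, c, d]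
    rw [sum_congr rfl fun j _ => sum_congr rfl (h1 j)]
    simp only [sum_add_distrib]
    congr 1
    · rw [sum_eq_single (i + 1) (fun j _ hj => by simp [hj]) (by simp)]
      simp
    · rw [sum_eq_single i (fun j _ hj => by simp [hj]) (by simp)]
      simp
  have hterm : ∀ i, ∀ k ∈ range (ℓ i + 1), ∀ j, ∀ l ∈ range (ℓ j + 1), B i k j l =
      (if SkelLink i k j l then B i k j l else 0) +
        if SkelLink j l i k then B j l i k else 0 := by
    intro i k hk j l hl
    by_cases a : SkelLink i k j l
    · simp [a, a.asymm hs.three_le]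
    · by_cases b : SkelLink j l i k
      · simp [a, b, hBsymm i k j l]
      · have : H (f i k) (f j l) = 0 := by
          by_contra h
          exact (hs.zero i k j l (by simp at hk; omega) (by simp at hl; omega) h).elim a b
        simp [a, b, hB, this]
  have hdouble : ∑ u, ∑ v, (conj (x u) * H u v * x v).re =
      2 * ∑ i, ∑ k ∈ range (ℓ i + 1), ∑ j, ∑ l ∈ range (ℓ j + 1),
        (if SkelLink i k j l then B i k j l else 0) := by
    rw [hs.sum_eq (fun u => ∑ v, (conj (x u) * H u v * x v).re) (fun u hu => hx u (by
      rintro h; simp [h] at hu))]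
    have e1 : ∀ i k, ∑ v, (conj (x (f i k)) * H (f i k) v * x v).re =
        ∑ j, ∑ l ∈ range (ℓ j + 1), B i k j l := fun i k =>
      hs.sum_eq (fun v => (conj (x (f i k)) * H (f i k) v * x v).re) (fun u hu => hx u (by
        rintro h; simp [h] at hu))
    simp only [e1]
    rw [sum_congr rfl fun i _ => sum_congr rfl fun k hk => sum_congr rfl fun j _ =>
      sum_congr rfl fun l hl => hterm i k hk j l hl]
    simp only [sum_add_distrib]
    rw [two_mul]
    congr 1
    have hP : ∀ G : ZMod g → ℕ → ℝ, ∑ i, ∑ k ∈ range (ℓ i + 1), G i k =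
        ∑ a ∈ univ.sigma fun i => range (ℓ i + 1), G a.1 a.2 := fun G => sum_sigma' _ _ _
    simp only [hP]
    exact sum_comm
  rw [energy, hdouble, sum_congr rfl fun i _ => sum_congr rfl (hL i),
    hs.sum_eq (fun u => Complex.normSq (x u)) (fun u hu => hx u (by rintro h; simp [h] at hu)),
    mul_sum, mul_sum, ← sum_sub_distrib]
  refine sum_congr rfl fun i _ => ?_
  rw [sum_range_succ', sum_add_distrib, sum_ite_eq' , if_pos (by simp), sum_range_succ _ (ℓ i),
    if_neg (lt_irrefl _), add_zero,
    sum_congr rfl fun k hk => if_pos (mem_range.1 hk), sum_sub_distrib, ← mul_sum, ← mul_sum]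
  simp only [hB]
  ring

end Sums

end IsSkeleton

namespace IsSkeleton

variable {V : Type*} {H : Matrix V V ℂ} {g : ℕ} {ℓ : ZMod g → ℕ} {f : ZMod g → ℕ → V}

/-! ### Switching a skeleton to standard form -/

/-- The product of the matrix entries along the cycle, from the vertex `f 0 0` to `f j 0`. -/
noncomputable def cycPot (H : Matrix V V ℂ) (f : ZMod g → ℕ → V) (j : ℕ) : ℂ :=
  ∏ m ∈ range j, H (f m 0) (f (m + 1) 0)

/-- The product of the matrix entries on the way from `f 0 0` to `f i k`, along the cycle first and
then along the affixed path. As a diagonal switching it turns all entries along a skeleton into `1`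
except for that of the edge that closes the cycle, which becomes the weight of the cycle. -/
noncomputable def pot (H : Matrix V V ℂ) (f : ZMod g → ℕ → V) (i : ZMod g) (k : ℕ) : ℂ :=
  cycPot H f i.val * ∏ m ∈ range k, H (f i m) (f i (m + 1))

theorem cycPot_mem (hs : IsSkeleton H g ℓ f) (j : ℕ) : cycPot H f j ∈ fourthRoots :=
  prod_mem_fourthRoots _ _ fun _ _ => hs.cyc _

theorem pot_mem (hs : IsSkeleton H g ℓ f) {i : ZMod g} {k : ℕ} (hk : k ≤ ℓ i) :
    pot H f i k ∈ fourthRoots :=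
  mul_mem_fourthRoots (hs.cycPot_mem _) (prod_mem_fourthRoots _ _ fun m hm =>
    hs.tail i m ((mem_range.1 hm).trans_le hk))

theorem cycPot_zero : cycPot H f 0 = 1 := by simp [cycPot]

theorem cycPot_self : cycPot H f g = skelWeight H g f := rfl

theorem cycPot_succ (j : ℕ) : cycPot H f (j + 1) = cycPot H f j * H (f j 0) (f (j + 1) 0) :=
  prod_range_succ _ _

theorem pot_succ (i : ZMod g) (k : ℕ) : pot H f i (k + 1) = pot H f i k * H (f i k) (f i (k + 1)) := by
  rw [pot, prod_range_succ, ← mul_assoc, pot]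

theorem pot_natCast_zero {j : ℕ} (hj : j < g) : pot H f (j : ZMod g) 0 = cycPot H f j := by
  rw [pot, ZMod.val_natCast_of_lt hj]; simp

theorem normSq_switch {a : ℂ} (ha : a ∈ fourthRoots) (x : ℂ) :
    Complex.normSq (a * x) = Complex.normSq x := by
  rw [map_mul, normSq_of_mem_fourthRoots ha, one_mul]

theorem conj_mul_switch {a : ℂ} (ha : a ∈ fourthRoots) (h x y : ℂ) :
    conj (a * x) * (a * h * y) = conj x * h * y := by
  have : conj a * a = 1 := by
    rw [← Complex.normSq_eq_conj_mul_self, normSq_of_mem_fourthRoots ha, Complex.ofReal_one]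
  rw [map_mul]
  linear_combination (conj x * h * y) * this

variable [Fintype V]

/-- The quadratic form of a skeleton in standard form. -/
theorem energy_eq_of_gauge (hs : IsSkeleton H g ℓ f) {x : V → ℂ}
    (hx : ∀ u, x u ≠ 0 → ∃ i k, k ≤ ℓ i ∧ f i k = u) {y : ℕ → ℂ}
    (hy : ∀ j ≤ g, y j = cycPot H f j * x (f j 0)) {z : ZMod g → ℕ → ℂ}
    (hz : ∀ i k, k ≤ ℓ i → z i k = pot H f i k * x (f i k)) :
    energy H x = ∑ j ∈ range g, (edgeEnergy y j + ∑ k ∈ range (ℓ j),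
      (gr ^ 3 * Complex.normSq (z j (k + 1)) - 2 * (conj (z j k) * z j (k + 1)).re)) := by
  have := hs.neZero
  rw [hs.energy_eq_sum x hx, sum_zmod_eq_sum_range]
  refine sum_congr rfl fun j hj => ?_
  have hj := mem_range.1 hj
  congr 1
  · rw [edgeEnergy, hy j hj.le, hy (j + 1) hj, cycPot_succ, normSq_switch (hs.cycPot_mem j)]
    push_cast
    rw [conj_mul_switch (hs.cycPot_mem j)]
  · refine sum_congr rfl fun k hk => ?_
    have hk := mem_range.1 hk
    rw [hz _ k hk.le, hz _ (k + 1) hk, normSq_switch (hs.pot_mem hk), pot_succ,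
      conj_mul_switch (hs.pot_mem hk.le)]

/-- Vectors on a skeleton can be prescribed in standard form. -/
theorem exists_vector (hs : IsSkeleton H g ℓ f) {y : ℕ → ℂ} (hy : y g = skelWeight H g f * y 0)
    {z : ZMod g → ℕ → ℂ} (hz : ∀ j < g, z (j : ZMod g) 0 = y j) :
    ∃ x : V → ℂ, (∀ u, x u ≠ 0 → ∃ i k, k ≤ ℓ i ∧ f i k = u) ∧
      (∀ i k, k ≤ ℓ i → z i k = pot H f i k * x (f i k)) ∧
      energy H x = ∑ j ∈ range g, (edgeEnergy y j + ∑ k ∈ range (ℓ j),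
        (gr ^ 3 * Complex.normSq (z j (k + 1)) - 2 * (conj (z j k) * z j (k + 1)).re)) := by
  classical
  have hg := hs.three_le
  let x : V → ℂ := fun u => if h : ∃ a : ZMod g × ℕ, a.2 ≤ ℓ a.1 ∧ f a.1 a.2 = u then
    conj (pot H f h.choose.1 h.choose.2) * z h.choose.1 h.choose.2 else 0
  have hxf : ∀ i k, k ≤ ℓ i → x (f i k) = conj (pot H f i k) * z i k := by
    intro i k hk
    have h : ∃ a : ZMod g × ℕ, a.2 ≤ ℓ a.1 ∧ f a.1 a.2 = f i k := ⟨(i, k), hk, rfl⟩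
    obtain ⟨e1, e2⟩ := hs.inj _ _ _ _ h.choose_spec.1 hk h.choose_spec.2
    simp only [x]
    rw [dif_pos h, e1, e2]
  have hx : ∀ u, x u ≠ 0 → ∃ i k, k ≤ ℓ i ∧ f i k = u := by
    intro u hu
    by_cases h : ∃ a : ZMod g × ℕ, a.2 ≤ ℓ a.1 ∧ f a.1 a.2 = u
    · exact ⟨h.choose.1, h.choose.2, h.choose_spec⟩
    · exact absurd (dif_neg h) hu
  have hz' : ∀ i k, k ≤ ℓ i → z i k = pot H f i k * x (f i k) := by
    intro i k hk
    rw [hxf i k hk, ← mul_assoc, Complex.mul_conj, normSq_of_mem_fourthRoots (hs.pot_mem hk)]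
    simp
  have hlt : ∀ j < g, y j = cycPot H f j * x (f j 0) := by
    intro j hj
    rw [← hz j hj, hz' _ 0 (Nat.zero_le _), pot_natCast_zero hj]
  refine ⟨x, hx, hz', hs.energy_eq_of_gauge hx (fun j hj => ?_) hz'⟩
  rcases hj.lt_or_eq with hj | rfl
  · exact hlt j hj
  · rw [hy, cycPot_self, hlt 0 (by omega), cycPot_zero, one_mul]
    simp

/-- If `gr ^ 3 - H` is positive semidefinite, then so is the form on the cycle of a skeleton that
results from eliminating the affixed paths. -/
theorem cycle_nonneg (hs : IsSkeleton H g ℓ f) (h : ∀ x, 0 ≤ energy H x) {y : ℕ → ℂ}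
    (hy : y g = skelWeight H g f * y 0) :
    0 ≤ ∑ j ∈ range g, (edgeEnergy y j - arcDiag (ℓ j + 1) * Complex.normSq (y j)) := by
  choose z hz0 hz using fun i : ZMod g => exists_tail_eq (ℓ i) (y i.val)
  obtain ⟨x, -, -, hx⟩ := hs.exists_vector hy (z := z) fun j hj => by
    rw [hz0, ZMod.val_natCast_of_lt hj]
  refine (h x).trans_eq (hx.trans (sum_congr rfl fun j hj => ?_))
  rw [hz, ZMod.val_natCast_of_lt (mem_range.1 hj), sub_eq_add_neg]

/-- Conversely, if the skeleton covers all vertices, it is enough that the form on its cycle is positive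
semidefinite. -/
theorem energy_nonneg (hs : IsSkeleton H g ℓ f) (hf : SkelCovers ℓ f)
    (h : ∀ y : ℕ → ℂ, y g = skelWeight H g f * y 0 →
      0 ≤ ∑ j ∈ range g, (edgeEnergy y j - arcDiag (ℓ j + 1) * Complex.normSq (y j))) (x : V → ℂ) :
    0 ≤ energy H x := by
  rw [hs.energy_eq_of_gauge (fun u _ => hf u) (y := fun j => cycPot H f j * x (f j 0))
    (fun _ _ => rfl) (z := fun i k => pot H f i k * x (f i k)) (fun _ _ _ => rfl)]
  refine (h (fun j => cycPot H f j * x (f j 0))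
    (by simp [cycPot_zero, cycPot_self])).trans (sum_le_sum fun j hj => ?_)
  have := tail_ge (ℓ j) (fun k => pot H f j k * x (f j k))
  simp only [pot_natCast_zero (mem_range.1 hj)] at this
  linarith

/-- The energy on a path of length `k` whose end has two further neighbours, of the vector with the
geometric values `gr⁻¹ ^ m` on the path and the best values on these two, is below the minimal
energy `-gr⁻¹` of an infinite path. -/
theorem geom_tail_lt (k : ℕ) :
    ∑ m ∈ range k, (gr ^ 3 * (gr⁻¹ ^ (m + 1)) ^ 2 - 2 * (gr⁻¹ ^ m * gr⁻¹ ^ (m + 1)))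
      - 2 * (gr ^ 3)⁻¹ * (gr⁻¹ ^ k) ^ 2 < - gr⁻¹ := by
  have hg := gr_pos
  have h0 : gr * gr⁻¹ = 1 := mul_inv_cancel₀ hg.ne'
  have h1 : gr = gr⁻¹ + gr⁻¹ ^ 3 := by
    field_simp
    linear_combination gr_pow_four
  have hq : 0 < gr⁻¹ := inv_pos.2 hg
  have hsum : ∑ m ∈ range k, (gr ^ 3 * (gr⁻¹ ^ (m + 1)) ^ 2 - 2 * (gr⁻¹ ^ m * gr⁻¹ ^ (m + 1))) =
      -gr⁻¹ * (1 - (gr⁻¹ ^ k) ^ 2) := by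
    induction k with
    | zero => simp
    | succ k ih =>
      rw [sum_range_succ, ih, pow_succ gr⁻¹ k]
      generalize gr⁻¹ ^ k = p
      have : gr ^ 3 * gr⁻¹ ^ 2 = gr := by
        linear_combination (gr ^ 2 * gr⁻¹ + gr) * h0
      linear_combination p ^ 2 * this + p ^ 2 * h1
  have h2 : gr⁻¹ < 2 * (gr ^ 3)⁻¹ := by
    have : gr⁻¹ = gr ^ 2 * (gr ^ 3)⁻¹ := by field_simp
    rw [this]
    exact mul_lt_mul_of_pos_right (by linarith [gr_sq_lt]) (by positivity)
  rw [hsum]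
  have : 0 < (gr⁻¹ ^ k) ^ 2 := by positivity
  nlinarith

/-- Suppose that a vertex `v` is adjacent to an inner vertex of a path affixed at `f 0 0`, or to `f 0 0`
itself when a path is affixed there. Eliminating this path together with `v` lowers the diagonal
entry of `f 0 0` by more than an infinite path would, which would lower it by `gr⁻¹`. -/
theorem cycle_pos_of_branch (hs : IsSkeleton H g ℓ f) (h : ∀ x, 0 ≤ energy H x) {k : ℕ}
    (hk : k < ℓ 0) {v : V} (hv : ∀ i m, m ≤ ℓ i → f i m ≠ v) (hvv : H v v = 0)
    (hvk : H v (f 0 k) ∈ fourthRoots)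
    (hvz : ∀ i m, m ≤ ℓ i → H v (f i m) ≠ 0 → f i m = f 0 k) {y : ℕ → ℂ}
    (hy : y g = skelWeight H g f * y 0) (hy0 : y 0 ≠ 0) :
    gr⁻¹ * Complex.normSq (y 0) < ∑ j ∈ range g, edgeEnergy y j := by
  classical
  have hg := hs.three_le
  have hgr := gr_pos
  have hle : ∀ i, (Pi.single 0 (k + 1) : ZMod g → ℕ) i ≤ ℓ i := by
    intro i
    by_cases hi : i = 0
    · subst hi; simpa using hk
    · simp [hi]
  have hs' := hs.mono hle
  obtain ⟨z, hz⟩ : ∃ z : ZMod g → ℕ → ℂ, z = fun i m =>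
    if i = 0 then (if m ≤ k then ((gr⁻¹ ^ m : ℝ) : ℂ) else ((gr ^ 3)⁻¹ * gr⁻¹ ^ k : ℝ)) * y 0
      else y i.val := ⟨_, rfl⟩
  obtain ⟨x, hsupp, hzx, hx⟩ := hs'.exists_vector hy (z := z) fun j hj => by
    by_cases h0 : j = 0
    · subst h0; simp [hz]
    · have : (j : ZMod g) ≠ 0 := by
        intro h'
        have := congrArg ZMod.val h'
        rw [ZMod.val_natCast_of_lt hj, ZMod.val_zero] at this
        exact h0 this
      simp [hz, this, ZMod.val_natCast_of_lt hj]
  have hxv : x v = 0 := by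
    by_contra hne
    obtain ⟨i, m, hm, hf⟩ := hsupp v hne
    exact hv i m (hm.trans (hle i)) hf
  have hs0 : ∀ u, H v u ≠ 0 → x u ≠ 0 → u = f 0 k := by
    intro u hu hxu
    obtain ⟨i, m, hm, rfl⟩ := hsupp u hxu
    exact hvz i m (hm.trans (hle i)) hu
  have hE := h (Function.update x v ((gr ^ 3 : ℝ)⁻¹ * (H v (f 0 k) * x (f 0 k))))
  rw [energy_update hs.herm hxv hvv hs0, hx, sum_add_distrib] at hE
  have hxk : Complex.normSq (x (f 0 k)) = (gr⁻¹ ^ k) ^ 2 * Complex.normSq (y 0) := by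
    have h1 := hzx 0 k (by simp)
    have h2 : z 0 k = ((gr⁻¹ ^ k : ℝ) : ℂ) * y 0 := by simp [hz]
    rw [← normSq_switch (hs'.pot_mem (i := 0) (k := k) (by simp)) (x (f 0 k)), ← h1, h2, map_mul,
      Complex.normSq_ofReal]
    ring
  have hleaf : gr ^ 3 * Complex.normSq ((gr ^ 3 : ℝ)⁻¹ * (H v (f 0 k) * x (f 0 k))) -
      2 * (conj ((gr ^ 3 : ℝ)⁻¹ * (H v (f 0 k) * x (f 0 k))) * H v (f 0 k) * x (f 0 k)).re =
      -((gr ^ 3)⁻¹ * Complex.normSq (x (f 0 k))) := by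
    rw [map_mul (starRingEnd ℂ), Complex.conj_ofReal, mul_assoc, mul_assoc,
      ← Complex.normSq_eq_conj_mul_self, ← Complex.ofReal_mul, Complex.ofReal_re, map_mul,
      Complex.normSq_ofReal, normSq_switch hvk]
    field_simp
    ring
  have htail : ∑ j ∈ range g, ∑ m ∈ range ((Pi.single 0 (k + 1) : ZMod g → ℕ) j),
      (gr ^ 3 * Complex.normSq (z j (m + 1)) - 2 * (conj (z j m) * z j (m + 1)).re) =
      (∑ m ∈ range k, (gr ^ 3 * (gr⁻¹ ^ (m + 1)) ^ 2 - 2 * (gr⁻¹ ^ m * gr⁻¹ ^ (m + 1)))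
        - (gr ^ 3)⁻¹ * (gr⁻¹ ^ k) ^ 2) * Complex.normSq (y 0) := by
    have := hs.neZero
    rw [← sum_zmod_eq_sum_range g (fun j => ∑ m ∈ range ((Pi.single 0 (k + 1) : ZMod g → ℕ) j),
      (gr ^ 3 * Complex.normSq (z j (m + 1)) - 2 * (conj (z j m) * z j (m + 1)).re)),
      sum_eq_single 0 (fun j _ hj => by simp [hj]) (by simp), Pi.single_eq_same, sum_range_succ,
      sub_mul, sum_mul]
    have key : ∀ a b : ℝ, gr ^ 3 * Complex.normSq ((b : ℂ) * y 0) -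
        2 * (conj ((a : ℂ) * y 0) * ((b : ℂ) * y 0)).re =
        (gr ^ 3 * b ^ 2 - 2 * (a * b)) * Complex.normSq (y 0) := by
      intro a b
      simp only [Complex.normSq_apply, Complex.mul_re, Complex.mul_im, Complex.ofReal_re,
        Complex.ofReal_im, Complex.conj_re, Complex.conj_im]
      ring
    have hz1 : ∀ m ≤ k, z 0 m = ((gr⁻¹ ^ m : ℝ) : ℂ) * y 0 := fun m hm => by simp [hz, hm]
    have hz2 : z 0 (k + 1) = (((gr ^ 3)⁻¹ * gr⁻¹ ^ k : ℝ) : ℂ) * y 0 := by simp [hz]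
    rw [hz2, hz1 k le_rfl, key, sub_eq_add_neg, ← neg_mul]
    congr 1
    · refine sum_congr rfl fun m hm => ?_
      have := mem_range.1 hm
      rw [hz1 m (by omega), hz1 (m + 1) (by omega), key]
    · field_simp
      ring
  rw [htail] at hE
  have := geom_tail_lt k
  have hpos : 0 < Complex.normSq (y 0) := Complex.normSq_pos.2 hy0
  have := mul_lt_mul_of_pos_right this hpos
  rw [hxk] at hleaf
  linarith

end IsSkeleton

/-! ### Values of the coefficients -/

theorem gr_pow_six : gr ^ 6 = 2 * gr ^ 2 + 1 := by
  linear_combination (gr ^ 2 + 1) * gr_pow_four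

theorem arcT_two : arcT 2 = gr ^ 2 - 1 := by
  rw [arcT, div_eq_iff (sub_pos.2 (one_lt_gr_pow (by norm_num))).ne']
  linear_combination -(gr ^ 2) * gr_pow_four

theorem arcT_three : arcT 3 = (gr ^ 2 - 1) / 2 := by
  rw [arcT, div_eq_iff (sub_pos.2 (one_lt_gr_pow (by norm_num))).ne']
  linear_combination -(gr ^ 4 + 1) / 2 * gr_pow_four

theorem arcT_four : arcT 4 = (3 * gr ^ 2 - 4) / 5 := by
  rw [arcT, div_eq_iff (sub_pos.2 (one_lt_gr_pow (by norm_num))).ne']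
  linear_combination -(3 * gr ^ 6 - gr ^ 4 + 2 * gr ^ 2 + 1) / 5 * gr_pow_four

theorem arcT_five : arcT 5 = (5 * gr ^ 2 - 7) / 11 := by
  rw [arcT, div_eq_iff (sub_pos.2 (one_lt_gr_pow (by norm_num))).ne']
  linear_combination -(5 * gr ^ 8 - 2 * gr ^ 6 + 3 * gr ^ 4 + gr ^ 2 + 4) / 11 * gr_pow_four

theorem arcT_six : arcT 6 = (2 * gr ^ 2 - 3) / 4 := by
  rw [arcT, div_eq_iff (sub_pos.2 (one_lt_gr_pow (by norm_num))).ne']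
  linear_combination -(2 * gr ^ 10 - gr ^ 8 + gr ^ 6 + gr ^ 2 + 1) / 4 * gr_pow_four

theorem arcS_eq (m : ℕ) : arcS m = gr ^ m * arcT m := by rw [arcS, arcT, mul_one_div]

theorem arcT_anti {m n : ℕ} (hm : 1 ≤ m) (h : m ≤ n) : arcT n ≤ arcT m :=
  one_div_le_one_div_of_le (sub_pos.2 (one_lt_gr_pow (by omega)))
    (sub_le_sub_right (pow_le_pow_right₀ one_lt_gr.le (by omega)) 1)

theorem arcDiag_nonneg {m : ℕ} (hm : 1 ≤ m) : 0 ≤ arcDiag m :=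
  div_nonneg (sub_nonneg.2 (arcT_one ▸ arcT_anti le_rfl hm)) (pow_pos gr_pos 3).le

theorem cube_mul_arcDiag (m : ℕ) : gr ^ 3 * arcDiag m = gr ^ 2 - arcT m :=
  mul_div_cancel₀ _ (pow_pos gr_pos 3).ne'

theorem cube_mul_arcOff (m : ℕ) : gr ^ 3 * arcOff m = arcS m :=
  mul_div_cancel₀ _ (pow_pos gr_pos 3).ne'

/-- For a cycle of weight `-1` the coefficients combine to a simple fraction. -/
theorem arcT_add_arcS {m : ℕ} (hm : 1 ≤ m) : arcT m + arcS m = 1 / (gr ^ m - 1) := by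
  have h1 : gr ^ m - 1 ≠ 0 := (sub_pos.2 (one_lt_gr_pow hm)).ne'
  have h2 : gr ^ m + 1 ≠ 0 := (add_pos (pow_pos gr_pos m) one_pos).ne'
  have e : gr ^ (2 * m) - 1 = (gr ^ m - 1) * (gr ^ m + 1) := by rw [mul_comm 2 m, pow_mul]; ring
  rw [arcT, arcS, e]
  field_simp
  ring

/-- For a cycle of weight `1` the coefficients combine to a simple fraction. -/
theorem arcT_sub_arcS {m : ℕ} (hm : 1 ≤ m) : arcT m - arcS m = -(1 / (gr ^ m + 1)) := by
  have h1 : gr ^ m - 1 ≠ 0 := (sub_pos.2 (one_lt_gr_pow hm)).ne'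
  have h2 : gr ^ m + 1 ≠ 0 := (add_pos (pow_pos gr_pos m) one_pos).ne'
  have e : gr ^ (2 * m) - 1 = (gr ^ m - 1) * (gr ^ m + 1) := by rw [mul_comm 2 m, pow_mul]; ring
  rw [arcT, arcS, e]
  field_simp
  ring

theorem arcT_add_arcS_two_mul {m : ℕ} (hm : 1 ≤ m) : arcT (2 * m) + arcS (2 * m) = arcT m := by
  rw [arcT_add_arcS (by omega), arcT]

/-! ### The forms on a cycle after eliminating all but one or two of its vertices -/

theorem sum_edgeEnergy_add (y : ℕ → ℂ) (d e : ℕ) : ∑ j ∈ range (d + e), edgeEnergy y j =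
    ∑ j ∈ range d, edgeEnergy y j + ∑ j ∈ range e, edgeEnergy (fun j => y (d + j)) j := by
  rw [sum_range_add]
  rfl

/-- Two vertices cut a cycle into two arcs, on which minimising vectors can be chosen independently. -/
theorem exists_two_arcs_eq {d e : ℕ} (hd : 1 ≤ d) (he : 1 ≤ e) (w p q : ℂ) :
    ∃ y : ℕ → ℂ, y 0 = p ∧ y d = q ∧ y (d + e) = w * p ∧
      ∑ j ∈ range (d + e), edgeEnergy y j =
        (gr ^ 3 * Complex.normSq p - arcDiag d * (Complex.normSq p + Complex.normSq q)
          - 2 * arcOff d * (conj p * q).re) +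
        (gr ^ 3 * Complex.normSq q - arcDiag e * (Complex.normSq q + Complex.normSq (w * p))
          - 2 * arcOff e * (conj q * (w * p)).re) := by
  obtain ⟨y₁, h0, hd1, h1⟩ := exists_arc_eq hd p q
  obtain ⟨y₂, k0, he1, h2⟩ := exists_arc_eq he q (w * p)
  have hy2 : ∀ j, (fun j => if j ≤ d then y₁ j else y₂ (j - d)) (d + j) = y₂ j := by
    intro j
    rcases Nat.eq_zero_or_pos j with rfl | hj
    · simp [hd1, k0]
    · have : ¬ d + j ≤ d := by omega
      simp [this]
  refine ⟨fun j => if j ≤ d then y₁ j else y₂ (j - d), by simp [h0], by simp [hd1], ?_, ?_⟩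
  · rw [hy2, he1]
  · rw [sum_edgeEnergy_add, ← h1, ← h2]
    simp only [hy2]
    congr 1
    refine sum_congr rfl fun j hj => ?_
    have := mem_range.1 hj
    simp only [edgeEnergy]
    rw [if_pos (by omega), if_pos (by omega)]

/-- The quadratic form of `gr ^ 3 - H`, where `H` belongs to a cycle of length `g` and weight `w`, is
nonnegative after its diagonal entries are lowered by `c`. The vectors are written as sequences `y`
with `y g = w * y 0`. -/
def CycleNonneg (g : ℕ) (w : ℂ) (c : ℕ → ℝ) : Prop :=
  ∀ y : ℕ → ℂ, y g = w * y 0 → 0 ≤ ∑ j ∈ range g, (edgeEnergy y j - c j * Complex.normSq (y j))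

/-- The necessary condition from eliminating all vertices of the cycle but one, the lowering of the other
diagonal entries being neglected. -/
theorem CycleNonneg.single {g : ℕ} {w : ℂ} {c : ℕ → ℝ} (h : CycleNonneg g w c) (hg : 1 ≤ g)
    (hw : w ∈ fourthRoots) (hc : ∀ j, 0 ≤ c j) {a : ℕ} (h0 : c 0 = arcDiag a) :
    gr ^ 2 - 1 ≤ arcT a + 2 * arcT g - 2 * arcS g * w.re := by
  obtain ⟨y, hy0, hyg, hy⟩ := exists_arc_eq hg 1 w
  have := h y (by rw [hyg, hy0, mul_one])
  have hle : c 0 * Complex.normSq (y 0) ≤ ∑ j ∈ range g, c j * Complex.normSq (y j) :=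
    single_le_sum (f := fun j => c j * Complex.normSq (y j))
      (fun j _ => mul_nonneg (hc j) (Complex.normSq_nonneg _)) (mem_range.2 hg)
  rw [sum_sub_distrib, hy, normSq_of_mem_fourthRoots hw] at this
  rw [hy0, h0] at hle
  simp only [map_one, one_mul, mul_one] at this hle
  have h3 := pow_pos gr_pos 3
  have := mul_nonneg h3.le (this.trans (sub_le_sub_left hle _))
  have e1 := cube_mul_arcDiag g
  have e2 := cube_mul_arcDiag a
  have e3 := cube_mul_arcOff g
  have e4 := gr_pow_six
  linear_combination this - (2 * e1 + e2 + 2 * w.re * e3 - e4)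

/-- The necessary condition from eliminating all vertices of the cycle but two, at distances `d` and `e`
along the cycle. -/
theorem CycleNonneg.pair {d e : ℕ} {w : ℂ} {c : ℕ → ℝ} (h : CycleNonneg (d + e) w c) (hd : 1 ≤ d)
    (he : 1 ≤ e) (hw : w ∈ fourthRoots) (hc : ∀ j, 0 ≤ c j) {a b : ℕ} (h0 : c 0 = arcDiag a)
    (h1 : c d = arcDiag b) (p q : ℂ) :
    0 ≤ (arcT a + arcT d + arcT e - (gr ^ 2 - 1)) * Complex.normSq p +
      (arcT b + arcT d + arcT e - (gr ^ 2 - 1)) * Complex.normSq q -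
      2 * arcS d * (conj p * q).re - 2 * arcS e * (conj q * (w * p)).re := by
  obtain ⟨y, hy0, hyd, hyg, hy⟩ := exists_two_arcs_eq hd he w p q
  have := h y (by rw [hyg, hy0])
  have hle : c 0 * Complex.normSq (y 0) + c d * Complex.normSq (y d) ≤
      ∑ j ∈ range (d + e), c j * Complex.normSq (y j) := by
    rw [← sum_pair (f := fun j => c j * Complex.normSq (y j)) (show 0 ≠ d by omega)]
    refine sum_le_sum_of_subset_of_nonneg ?_
      (fun j _ _ => mul_nonneg (hc j) (Complex.normSq_nonneg _))
    intro j hj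
    simp only [mem_insert, mem_singleton] at hj
    exact mem_range.2 (by omega)
  rw [sum_sub_distrib, hy, map_mul Complex.normSq, normSq_of_mem_fourthRoots hw, one_mul] at this
  rw [hy0, h0, hyd, h1] at hle
  have h3 := pow_pos gr_pos 3
  have := mul_nonneg h3.le (this.trans (sub_le_sub_left hle _))
  have e1 := cube_mul_arcDiag d
  have e2 := cube_mul_arcDiag e
  have e3 := cube_mul_arcOff d
  have e4 := cube_mul_arcOff e
  have e5 := cube_mul_arcDiag a
  have e6 := cube_mul_arcDiag b
  have e7 := gr_pow_six
  generalize (conj p * q).re = z1 at *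
  generalize (conj q * (w * p)).re = z2 at *
  generalize Complex.normSq p = P at *
  generalize Complex.normSq q = Q at *
  linear_combination this - ((P + Q) * e1 + (P + Q) * e2 + 2 * z1 * e3 + 2 * z2 * e4
    + P * e5 + Q * e6 - (P + Q) * e7)

/-- If only one diagonal entry is lowered, the condition of `CycleNonneg.single` is sufficient. -/
theorem cycleNonneg_of_single {g a : ℕ} (hg : 1 ≤ g) {w : ℂ} (hw : w ∈ fourthRoots) {c : ℕ → ℝ}
    (h0 : c 0 = arcDiag a) (hc : ∀ j < g, j ≠ 0 → c j = 0)
    (h : gr ^ 2 - 1 ≤ arcT a + 2 * arcT g - 2 * arcS g * w.re) : CycleNonneg g w c := by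
  intro y hy
  have hs : ∑ j ∈ range g, c j * Complex.normSq (y j) = c 0 * Complex.normSq (y 0) :=
    sum_eq_single 0 (fun j hj h => by rw [hc j (mem_range.1 hj) h, zero_mul])
      (fun h => absurd (mem_range.2 hg) h)
  have key := arc_ge hg y
  rw [sum_sub_distrib, hs, h0]
  have hre : (conj (y 0) * (w * y 0)).re = w.re * Complex.normSq (y 0) := by
    rw [mul_left_comm, ← Complex.normSq_eq_conj_mul_self, Complex.re_mul_ofReal]
  rw [hy, hre, map_mul, normSq_of_mem_fourthRoots hw, one_mul] at key
  refine le_trans ?_ (sub_le_sub_right key _)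
  have h3 := pow_pos gr_pos 3
  refine nonneg_of_mul_nonneg_right (a := gr ^ 3) ?_ h3
  have := mul_nonneg (sub_nonneg.2 h) (Complex.normSq_nonneg (y 0))
  have e1 := cube_mul_arcDiag g
  have e2 := cube_mul_arcDiag a
  have e3 := cube_mul_arcOff g
  have e4 := gr_pow_six
  generalize Complex.normSq (y 0) = P at *
  linear_combination this + P * (2 * e1 + e2 + 2 * w.re * e3 - e4)

/-- If only two diagonal entries are lowered, the condition of `CycleNonneg.pair` is sufficient. -/
theorem cycleNonneg_of_pair {d e a b : ℕ} (hd : 1 ≤ d) (he : 1 ≤ e) {w : ℂ} (hw : w ∈ fourthRoots)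
    {c : ℕ → ℝ} (h0 : c 0 = arcDiag a) (h1 : c d = arcDiag b)
    (hc : ∀ j < d + e, j ≠ 0 → j ≠ d → c j = 0)
    (h : ∀ p q : ℂ, 0 ≤ (arcT a + arcT d + arcT e - (gr ^ 2 - 1)) * Complex.normSq p +
      (arcT b + arcT d + arcT e - (gr ^ 2 - 1)) * Complex.normSq q -
      2 * arcS d * (conj p * q).re - 2 * arcS e * (conj q * (w * p)).re) :
    CycleNonneg (d + e) w c := by
  intro y hy
  have hs : ∑ j ∈ range (d + e), c j * Complex.normSq (y j) =
      c 0 * Complex.normSq (y 0) + c d * Complex.normSq (y d) := by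
    rw [← sum_pair (f := fun j => c j * Complex.normSq (y j)) (show 0 ≠ d by omega)]
    symm
    refine sum_subset ?_ fun j hj hj' => ?_
    · intro j hj
      simp only [mem_insert, mem_singleton] at hj
      exact mem_range.2 (by omega)
    · simp only [mem_insert, mem_singleton, not_or] at hj'
      rw [hc j (mem_range.1 hj) hj'.1 hj'.2, zero_mul]
  have key1 := arc_ge hd y
  have key2 := arc_ge he (fun j => y (d + j))
  rw [sum_sub_distrib, hs, h0, h1, sum_edgeEnergy_add]
  rw [hy, map_mul Complex.normSq, normSq_of_mem_fourthRoots hw, one_mul, add_zero] at key2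
  refine le_trans ?_ (sub_le_sub_right (add_le_add key1 key2) _)
  have h3 := pow_pos gr_pos 3
  refine nonneg_of_mul_nonneg_right (a := gr ^ 3) ?_ h3
  have := h (y 0) (y d)
  have e1 := cube_mul_arcDiag d
  have e2 := cube_mul_arcDiag e
  have e3 := cube_mul_arcOff d
  have e4 := cube_mul_arcOff e
  have e5 := cube_mul_arcDiag a
  have e6 := cube_mul_arcDiag b
  have e7 := gr_pow_six
  generalize (conj (y 0) * y d).re = z1 at *
  generalize (conj (y d) * (w * y 0)).re = z2 at *
  generalize Complex.normSq (y 0) = P at *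
  generalize Complex.normSq (y d) = Q at *
  linear_combination this + ((P + Q) * e1 + (P + Q) * e2 + 2 * z1 * e3 + 2 * z2 * e4
    + P * e5 + Q * e6 - (P + Q) * e7)

/-- Without lowered diagonal entries no arithmetic is needed, since `2 ≤ gr ^ 3`. -/
theorem cycleNonneg_zero {g : ℕ} {w : ℂ} (hw : w ∈ fourthRoots) {c : ℕ → ℝ}
    (hc : ∀ j < g, c j = 0) : CycleNonneg g w c := by
  intro y hy
  have h2 : 2 ≤ gr ^ 3 := by
    have := gr_pow_six
    have := gr_sq_gt
    nlinarith [pow_pos gr_pos 3]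
  have hj : ∀ j ∈ range g, Complex.normSq (y j) - Complex.normSq (y (j + 1)) ≤
      edgeEnergy y j - c j * Complex.normSq (y j) := by
    intro j hj
    rw [hc j (mem_range.1 hj), edgeEnergy]
    have := mul_nonneg (sub_nonneg.2 h2) (Complex.normSq_nonneg (y j))
    have := Complex.normSq_nonneg (y j - y (j + 1))
    rw [Complex.normSq_sub] at this
    have e : (y j * conj (y (j + 1))).re = (conj (y j) * y (j + 1)).re := by
      rw [← Complex.conj_re, map_mul, Complex.conj_conj]
    rw [e] at this
    linarith
  refine le_trans ?_ (sum_le_sum hj)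
  rw [sum_range_sub' (fun j => Complex.normSq (y j)), hy, map_mul, normSq_of_mem_fourthRoots hw]
  simp

/-! ### Consequences of the forms with one or two vertices -/

theorem le_two_of_single {a m : ℕ} (hm : 5 ≤ m) (h : gr ^ 2 - 1 ≤ arcT a + 2 * arcT m) :
    a ≤ 2 := by
  by_contra ha
  have h1 := arcT_anti (show 1 ≤ 3 by norm_num) (show 3 ≤ a by omega)
  have h2 := arcT_anti (show 1 ≤ 5 by norm_num) hm
  rw [arcT_three] at h1
  rw [arcT_five] at h2
  linarith [gr_sq_gt, gr_sq_lt]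

theorem le_three_of_single {a : ℕ} (h : gr ^ 2 - 1 ≤ arcT a + 2 * arcT 4) : a ≤ 3 := by
  by_contra ha
  have h1 := arcT_anti (show 1 ≤ 4 by norm_num) (show 4 ≤ a by omega)
  rw [arcT_four] at h h1
  linarith [gr_sq_gt, gr_sq_lt]

theorem two_mul_arcT_le {m : ℕ} (hm : 3 ≤ m) : 2 * arcT m ≤ gr ^ 2 - 1 := by
  have h1 := arcT_anti (show 1 ≤ 3 by norm_num) hm
  rw [arcT_three] at h1
  linarith

/-- The condition of `CycleNonneg.single` for an even cycle of weight `-1` is that for a cycle of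
purely imaginary weight and half the length. -/
theorem arc_neg_two_mul {m : ℕ} (hm : 1 ≤ m) :
    2 * arcT (2 * m) - 2 * arcS (2 * m) * (-1 : ℂ).re = 2 * arcT m := by
  rw [← arcT_add_arcS_two_mul hm]
  simp
  ring

/-- The form of `CycleNonneg.pair` for a cycle of weight `w` with paths of `a - 1` and `b - 1` new
vertices affixed at distances `d` and `e` along the cycle. -/
def PairNonneg (d e a b : ℕ) (w : ℂ) : Prop :=
  ∀ p q : ℂ, 0 ≤ (arcT a + arcT d + arcT e - (gr ^ 2 - 1)) * Complex.normSq p +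
      (arcT b + arcT d + arcT e - (gr ^ 2 - 1)) * Complex.normSq q -
      2 * arcS d * (conj p * q).re - 2 * arcS e * (conj q * (w * p)).re

theorem PairNonneg.neg_real {d e a b : ℕ} (h : PairNonneg d e a b (-1)) (p q : ℝ) :
    0 ≤ (arcT a + arcT d + arcT e - (gr ^ 2 - 1)) * p ^ 2 +
      (arcT b + arcT d + arcT e - (gr ^ 2 - 1)) * q ^ 2 - 2 * (arcS d - arcS e) * (p * q) := by
  have := h p q
  simp [Complex.normSq_ofReal] at this
  linarith

/-- The test vector `(1, 1)`, together with `arcT_sub_arcS` and `arcT_add_arcS`. -/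
theorem PairNonneg.neg_pow_le {d e a b : ℕ} (h : PairNonneg d e a b (-1)) (hd : 1 ≤ d) (he : 1 ≤ e)
    (ha : 2 ≤ a) (hb : 2 ≤ b) : gr ^ e ≤ gr ^ d + 2 := by
  have h1 := h.neg_real 1 1
  have ha' := arcT_anti (show 1 ≤ 2 by norm_num) ha
  have hb' := arcT_anti (show 1 ≤ 2 by norm_num) hb
  rw [arcT_two] at ha' hb'
  have h2 := arcT_sub_arcS hd
  have h3 := arcT_add_arcS he
  have h4 : 1 / (gr ^ d + 1) ≤ 1 / (gr ^ e - 1) := by linarith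
  have h5 : 0 < gr ^ e - 1 := sub_pos.2 (one_lt_gr_pow he)
  have h6 : 0 < gr ^ d + 1 := by linarith [pow_pos gr_pos d]
  have := (one_div_le_one_div h6 h5).1 h4
  linarith

theorem two_lt_gr_cube : 2 < gr ^ 3 := by
  have := gr_pow_six
  have := gr_sq_gt
  nlinarith [pow_pos gr_pos 3]

/-- On a cycle of weight `-1` two affixed paths are nearly antipodal. -/
theorem PairNonneg.neg_dist {d e a b : ℕ} (h : PairNonneg d e a b (-1)) (hd : 1 ≤ d) (he : 1 ≤ e)
    (ha : 2 ≤ a) (hb : 2 ≤ b) : e < d + 4 ∧ (d + 2 ≤ e → d ≤ 4) := by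
  have hle := h.neg_pow_le hd he ha hb
  have h1 := gr_sq_gt
  have h3 := two_lt_gr_cube
  constructor
  · by_contra hlt
    have h2 := pow_le_pow_right₀ one_lt_gr.le (not_lt.1 hlt)
    have h4 := pow_le_pow_right₀ one_lt_gr.le hd
    rw [pow_add, gr_pow_four] at h2
    nlinarith [gr_pos]
  · intro hde
    by_contra hlt
    have h2 := pow_le_pow_right₀ one_lt_gr.le hde
    have h4 := pow_le_pow_right₀ one_lt_gr.le (show 5 ≤ d by omega)
    rw [pow_add] at h2
    -- `gr ^ 5 (gr ^ 2 - 1) = gr ^ 3`, which exceeds `2`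
    have h5 : gr ^ 5 * (gr ^ 2 - 1) = gr ^ 3 := by linear_combination gr ^ 3 * gr_pow_four
    nlinarith

/-- On a cycle of purely imaginary weight there is at most one affixed path. -/
theorem PairNonneg.false_of_im {d e a b : ℕ} {w : ℂ} (h : PairNonneg d e a b w)
    (hw : w = Complex.I ∨ w = -Complex.I) (hd : 1 ≤ d) (he : 1 ≤ e) (hde : 3 ≤ d + e)
    (ha : 2 ≤ a) (hb : 2 ≤ b) : False := by
  have ha' := arcT_anti (show 1 ≤ 2 by norm_num) ha
  have hb' := arcT_anti (show 1 ≤ 2 by norm_num) hb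
  rw [arcT_two] at ha' hb'
  have hd1 := arcT_pos hd
  have he1 := arcT_pos he
  have hds := arcS_sq hd
  have hes := arcS_sq he
  obtain ⟨T, hT⟩ : ∃ T, T = arcT d + arcT e := ⟨_, rfl⟩
  -- the test vector makes the coupling real: its entries are `arcS d + arcS e * conj w` and `T`
  have h1 := h (arcS d + arcS e * conj w) T
  have hn : Complex.normSq (arcS d + arcS e * conj w) = arcS d ^ 2 + arcS e ^ 2 := by
    rcases hw with rfl | rfl <;> simp [Complex.normSq_apply] <;> ring
  have hr1 : (conj (arcS d + arcS e * conj w : ℂ) * T).re = arcS d * T := by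
    rcases hw with rfl | rfl <;> simp
  have hr2 : (conj (T : ℂ) * (w * (arcS d + arcS e * conj w))).re = arcS e * T := by
    rcases hw with rfl | rfl <;> simp [Complex.mul_re] <;> ring
  rw [hn, hr1, hr2, Complex.normSq_ofReal] at h1
  have hN : 0 ≤ arcS d ^ 2 + arcS e ^ 2 := by positivity
  have hTT : 0 ≤ T * T := mul_self_nonneg T
  have hA : arcT a + arcT d + arcT e - (gr ^ 2 - 1) ≤ T := by linarith
  have hB : arcT b + arcT d + arcT e - (gr ^ 2 - 1) ≤ T := by linarith
  have h2 := mul_le_mul_of_nonneg_right hA hN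
  have h3 := mul_le_mul_of_nonneg_right hB hTT
  have hT0 : 0 < T := by linarith
  have h4 : 0 ≤ T * (T ^ 2 - (arcS d ^ 2 + arcS e ^ 2)) := by nlinarith
  have h5 : 0 ≤ T ^ 2 - (arcS d ^ 2 + arcS e ^ 2) := nonneg_of_mul_nonneg_right h4 hT0
  rw [hds, hes, hT] at h5
  have h6 : arcT d + arcT e ≤ 2 * arcT d * arcT e := by linarith
  have h7 : gr ^ (2 * d) - 1 + (gr ^ (2 * e) - 1) ≤ 2 := by
    have hd0 : 0 < gr ^ (2 * d) - 1 := sub_pos.2 (one_lt_gr_pow (by omega))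
    have he0 : 0 < gr ^ (2 * e) - 1 := sub_pos.2 (one_lt_gr_pow (by omega))
    rw [arcT, arcT] at h6
    field_simp at h6
    linarith
  have h8 : gr ^ 2 ≤ gr ^ (2 * d) := pow_le_pow_right₀ one_lt_gr.le (by omega)
  have h9 : gr ^ 2 ≤ gr ^ (2 * e) := pow_le_pow_right₀ one_lt_gr.le (by omega)
  have h10 : gr ^ 4 ≤ gr ^ (2 * d) ∨ gr ^ 4 ≤ gr ^ (2 * e) := by
    rcases Nat.lt_or_ge d 2 with hd2 | hd2
    · exact Or.inr (pow_le_pow_right₀ one_lt_gr.le (by omega))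
    · exact Or.inl (pow_le_pow_right₀ one_lt_gr.le (by omega))
  have := gr_pow_four
  have := gr_sq_gt
  rcases h10 with h | h <;> linarith

theorem arcS_two_sub_arcS_four : arcS 2 - arcS 4 = (6 - 2 * gr ^ 2) / 5 := by
  rw [arcS_eq, arcS_eq, arcT_two, arcT_four]
  linear_combination (1 - (3 * gr ^ 2 - 1) / 5) * gr_pow_four

theorem arcS_three_sub_arcS_five : 0.3 < arcS 3 - arcS 5 ∧ arcS 3 - arcS 5 < 0.32 := by
  have h : arcS 3 - arcS 5 = gr * (15 - 6 * gr ^ 2) / 22 := by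
    rw [arcS_eq, arcS_eq, arcT_three, arcT_five]
    linear_combination (gr / 2 - gr * (5 * gr ^ 2 - 2) / 11) * gr_pow_four
  have h1 := gr_sq_gt
  have h2 := gr_sq_lt
  have h3 : 1.26 < gr := by nlinarith [gr_pos]
  have h4 : gr < 1.273 := by nlinarith [gr_pos]
  rw [h]
  constructor <;> nlinarith

theorem PairNonneg.two_four {a b : ℕ} (h : PairNonneg 2 4 a b (-1)) (ha : 2 ≤ a) (hb : 2 ≤ b) :
    a ≤ 3 ∧ b ≤ 3 ∧ (a ≤ 2 ∨ b ≤ 2) := by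
  have h1 := gr_sq_gt
  have h2 := gr_sq_lt
  have ha' := arcT_anti (show 1 ≤ 2 by norm_num) ha
  have hb' := arcT_anti (show 1 ≤ 2 by norm_num) hb
  rw [arcT_two] at ha' hb'
  refine ⟨?_, ?_, ?_⟩
  · by_contra hlt
    have h3 := h.neg_real 3 2
    have h4 := arcT_anti (show 1 ≤ 4 by norm_num) (show 4 ≤ a by omega)
    rw [arcS_two_sub_arcS_four, arcT_two, arcT_four] at h3
    rw [arcT_four] at h4
    linarith
  · by_contra hlt
    have h3 := h.neg_real 2 3
    have h4 := arcT_anti (show 1 ≤ 4 by norm_num) (show 4 ≤ b by omega)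
    rw [arcS_two_sub_arcS_four, arcT_two, arcT_four] at h3
    rw [arcT_four] at h4
    linarith
  · by_contra! hlt
    have h3 := h.neg_real 1 1
    have h4 := arcT_anti (show 1 ≤ 3 by norm_num) (show 3 ≤ a by omega)
    have h5 := arcT_anti (show 1 ≤ 3 by norm_num) (show 3 ≤ b by omega)
    rw [arcS_two_sub_arcS_four, arcT_two, arcT_four] at h3
    rw [arcT_three] at h4 h5
    linarith

theorem PairNonneg.three_five {a b : ℕ} (h : PairNonneg 3 5 a b (-1)) (ha : 2 ≤ a) (hb : 2 ≤ b) :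
    a ≤ 2 ∧ b ≤ 2 := by
  have h1 := gr_sq_gt
  have h2 := gr_sq_lt
  have ha' := arcT_anti (show 1 ≤ 2 by norm_num) ha
  have hb' := arcT_anti (show 1 ≤ 2 by norm_num) hb
  have hs := arcS_three_sub_arcS_five.1
  rw [arcT_two] at ha' hb'
  constructor
  · by_contra hlt
    have h3 := h.neg_real 3 1
    have h4 := arcT_anti (show 1 ≤ 3 by norm_num) (show 3 ≤ a by omega)
    rw [arcT_three, arcT_five] at h3
    rw [arcT_three] at h4
    linarith
  · by_contra hlt
    have h3 := h.neg_real 1 3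
    have h4 := arcT_anti (show 1 ≤ 3 by norm_num) (show 3 ≤ b by omega)
    rw [arcT_three, arcT_five] at h3
    rw [arcT_three] at h4
    linarith

/-! ### Sufficient conditions -/

theorem pairNonneg_neg_of_le {d e a b : ℕ}
    (ha : |arcS d - arcS e| ≤ arcT a + arcT d + arcT e - (gr ^ 2 - 1))
    (hb : |arcS d - arcS e| ≤ arcT b + arcT d + arcT e - (gr ^ 2 - 1)) :
    PairNonneg d e a b (-1) := by
  intro p q
  generalize arcT a + arcT d + arcT e - (gr ^ 2 - 1) = A at *
  generalize arcT b + arcT d + arcT e - (gr ^ 2 - 1) = B at *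
  have e1 : 2 * arcS d * (conj p * q).re + 2 * arcS e * (conj q * (-1 * p)).re =
      2 * (arcS d - arcS e) * (conj p * q).re := by
    simp [Complex.mul_re]; ring
  generalize arcS d - arcS e = s at *
  have h1 := mul_le_mul_of_nonneg_right ha (Complex.normSq_nonneg p)
  have h2 := mul_le_mul_of_nonneg_right hb (Complex.normSq_nonneg q)
  have h3 : 2 * s * (conj p * q).re ≤ |s| * (Complex.normSq p + Complex.normSq q) := by
    have h4 := Complex.normSq_nonneg (p - q)
    have h5 := Complex.normSq_nonneg (p + q)
    simp only [Complex.normSq_apply, Complex.sub_re, Complex.sub_im, Complex.add_re,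
      Complex.add_im, Complex.mul_re, Complex.conj_re, Complex.conj_im] at h4 h5 ⊢
    rcases abs_cases s with ⟨hs, hs'⟩ | ⟨hs, hs'⟩ <;> rw [hs] <;> nlinarith
  linarith

theorem pairNonneg_neg_antipodal {d a b : ℕ} (ha : gr ^ 2 - 1 ≤ arcT a + 2 * arcT d)
    (hb : gr ^ 2 - 1 ≤ arcT b + 2 * arcT d) : PairNonneg d d a b (-1) :=
  pairNonneg_neg_of_le (by rw [sub_self, abs_zero]; linarith) (by rw [sub_self, abs_zero]; linarith)

theorem pairNonneg_three_five : PairNonneg 3 5 2 2 (-1) := by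
  have h1 := gr_sq_gt
  have h2 := gr_sq_lt
  have hs := arcS_three_sub_arcS_five
  have : |arcS 3 - arcS 5| ≤ arcT 2 + arcT 3 + arcT 5 - (gr ^ 2 - 1) := by
    rw [abs_of_pos (by linarith), arcT_two, arcT_three, arcT_five]
    linarith
  exact pairNonneg_neg_of_le this this

theorem pairNonneg_four_six : PairNonneg 4 6 2 2 (-1) := by
  have h1 := gr_sq_gt
  have h2 := gr_sq_lt
  have hs : arcS 4 - arcS 6 = (2 * gr ^ 2 - 1) / 5 - 1 / 4 := by
    rw [arcS_eq, arcS_eq, arcT_four, arcT_six]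
    linear_combination ((3 * gr ^ 2 - 1) / 5 - (2 * gr ^ 4 - gr ^ 2 + 1) / 4) * gr_pow_four
  have : |arcS 4 - arcS 6| ≤ arcT 2 + arcT 4 + arcT 6 - (gr ^ 2 - 1) := by
    rw [abs_of_pos (by rw [hs]; linarith), hs, arcT_two, arcT_four, arcT_six]
    linarith
  exact pairNonneg_neg_of_le this this

namespace IsSkeleton

variable {V : Type*} {H : Matrix V V ℂ} {g : ℕ} {ℓ : ZMod g → ℕ} {f : ZMod g → ℕ → V}

/-! ### Conditions on a skeleton in a matrix bounded by the limit value -/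

/-- A vertex outside of a skeleton whose only neighbour in it is a vertex of an affixed path other than
its end, or the vertex to which a path is affixed. -/
def IsBranch {V : Type*} (H : Matrix V V ℂ) {g : ℕ} (ℓ : ZMod g → ℕ) (f : ZMod g → ℕ → V)
    (v : V) : Prop :=
  (∀ j m, m ≤ ℓ j → f j m ≠ v) ∧ H v v = 0 ∧ ∃ i k, k < ℓ i ∧ H v (f i k) ∈ fourthRoots ∧
    ∀ j m, m ≤ ℓ j → H v (f j m) ≠ 0 → f j m = f i k

theorem IsBranch.neg {v : V} (h : IsBranch H ℓ f v) : IsBranch (-H) ℓ f v := by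
  obtain ⟨h1, h2, i, k, hk, h3, h4⟩ := h
  exact ⟨h1, by simp [h2], i, k, hk, neg_mem_fourthRoots h3,
    fun j m hm hne => h4 j m hm (by simpa using hne)⟩

theorem _root_.SkelCovers.rotate (hf : SkelCovers ℓ f) (r : ZMod g) :
    SkelCovers (fun i => ℓ (i + r)) (fun i => f (i + r)) := fun u => by
  obtain ⟨i, k, hk, rfl⟩ := hf u
  exact ⟨i - r, k, by simpa using hk, by simp⟩

variable [Fintype V]

theorem cycleNonneg (hs : IsSkeleton H g ℓ f) (h : ∀ x, 0 ≤ energy H x) :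
    CycleNonneg g (skelWeight H g f) (fun j => arcDiag (ℓ j + 1)) :=
  fun _ hy => hs.cycle_nonneg h hy

/-- The condition on the length of a single affixed path. -/
theorem single (hs : IsSkeleton H g ℓ f) (h : ∀ x, 0 ≤ energy H x) (i : ZMod g) :
    gr ^ 2 - 1 ≤ arcT (ℓ i + 1) + 2 * arcT g - 2 * arcS g * (skelWeight H g f).re := by
  have hg := hs.three_le
  have h1 := (hs.rotate i).cycleNonneg h
  rw [hs.skelWeight_rotate] at h1
  exact h1.single (by omega) hs.skelWeight_mem (fun j => arcDiag_nonneg (by omega)) (by simp)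

/-- The condition on two affixed paths and their distances along the cycle. -/
theorem pair (hs : IsSkeleton H g ℓ f) (h : ∀ x, 0 ≤ energy H x) (i : ZMod g) {d e : ℕ}
    (hd : 1 ≤ d) (he : 1 ≤ e) (hde : d + e = g) :
    PairNonneg d e (ℓ i + 1) (ℓ (i + d) + 1) (skelWeight H g f) := by
  have h1 := (hs.rotate i).cycleNonneg h
  rw [hs.skelWeight_rotate] at h1
  subst hde
  exact h1.pair hd he hs.skelWeight_mem (fun j => arcDiag_nonneg (by omega)) (by simp)
    (by simp [add_comm])

/-- A branch acts as an affixed path of infinite length, for which `arcT` vanishes, and the inequality is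
strict. -/
theorem of_isBranch (hs : IsSkeleton H g ℓ f) (h : ∀ x, 0 ≤ energy H x) {v : V}
    (hv : IsBranch H ℓ f v) :
    gr ^ 2 - 1 < 2 * arcT g - 2 * arcS g * (skelWeight H g f).re := by
  have hg := hs.three_le
  obtain ⟨hv, hvv, i, k, hk, hvk, hvz⟩ := hv
  obtain ⟨y, hy0, hyg, hy⟩ := exists_arc_eq (show 1 ≤ g by omega) 1 (skelWeight H g f)
  have h1 := (hs.rotate i).cycle_pos_of_branch h (k := k) (by simpa using hk)
    (fun j m hm => hv _ m hm) hvv (by simpa using hvk)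
    (fun j m hm hne => by simpa using hvz _ m hm hne)
    (y := y) (by rw [hs.skelWeight_rotate, hyg, hy0, mul_one]) (by simp [hy0])
  rw [hy, hy0, normSq_of_mem_fourthRoots hs.skelWeight_mem] at h1
  simp only [map_one, one_mul, mul_one] at h1
  have h3 := pow_pos gr_pos 3
  have h2 := mul_lt_mul_of_pos_left h1 h3
  have h4 : gr ^ 3 * gr⁻¹ = gr ^ 2 := by
    have := gr_pos
    field_simp
  have e1 := cube_mul_arcDiag g
  have e3 := cube_mul_arcOff g
  have e4 := gr_pow_six
  linear_combination h2 - h4 + (- 2 * e1 - 2 * (skelWeight H g f).re * e3 + e4)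

/-- No path is affixed to a cycle of weight `1`. -/
theorem eq_zero_of_one (hs : IsSkeleton H g ℓ f) (h : ∀ x, 0 ≤ energy H x)
    (hw : skelWeight H g f = 1) (i : ZMod g) : ℓ i = 0 := by
  have hg := hs.three_le
  by_contra h0
  have h1 := hs.single h i
  have h2 := arcT_anti (show 1 ≤ 2 by norm_num) (show 2 ≤ ℓ i + 1 by omega)
  have h3 := arcT_sub_arcS (show 1 ≤ g by omega)
  have h4 : 0 < 1 / (gr ^ g + 1) := by have := gr_pos; positivity
  rw [arcT_two] at h2
  rw [hw, Complex.one_re] at h1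
  linarith

theorem not_isBranch_of_one (hs : IsSkeleton H g ℓ f) (h : ∀ x, 0 ≤ energy H x)
    (hw : skelWeight H g f = 1) (v : V) : ¬ IsBranch H ℓ f v := by
  intro hv
  have hg := hs.three_le
  have h1 := hs.of_isBranch h hv
  have h3 := arcT_sub_arcS (show 1 ≤ g by omega)
  have h4 : 0 < 1 / (gr ^ g + 1) := by have := gr_pos; positivity
  rw [hw, Complex.one_re] at h1
  linarith [gr_sq_gt]

theorem not_isBranch_of_im (hs : IsSkeleton H g ℓ f) (h : ∀ x, 0 ≤ energy H x)
    (hw : (skelWeight H g f).re = 0) (v : V) : ¬ IsBranch H ℓ f v := by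
  intro hv
  have h1 := hs.of_isBranch h hv
  rw [hw] at h1
  linarith [two_mul_arcT_le hs.three_le]

theorem not_isBranch_of_neg {m : ℕ} (hm : 3 ≤ m) {ℓ : ZMod (2 * m) → ℕ} {f : ZMod (2 * m) → ℕ → V}
    (hs : IsSkeleton H (2 * m) ℓ f) (h : ∀ x, 0 ≤ energy H x)
    (hw : skelWeight H (2 * m) f = -1) (v : V) : ¬ IsBranch H ℓ f v := by
  intro hv
  have h1 := hs.of_isBranch h hv
  rw [hw, arc_neg_two_mul (by omega)] at h1
  linarith [two_mul_arcT_le hm]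

end IsSkeleton

/-! ### Skeletons in unicyclic graphs -/

namespace SimpleGraph

variable {V : Type*} {G : SimpleGraph V}

/-- The cycle of a unicyclic graph; an edge that does not belong to it is a bridge. -/
theorem exists_cycle_isBridge
    (h : ∃! C : G.Subgraph, ∃ (v : V) (p : G.Walk v v), p.IsCycle ∧ p.toSubgraph = C) :
    ∃ g, 3 ≤ g ∧ ∃ c : ZMod g → V, Function.Injective c ∧ (∀ i, G.Adj (c i) (c (i + 1))) ∧
      ∀ u v, G.Adj u v → (∀ i, s(u, v) ≠ s(c i, c (i + 1))) → G.IsBridge s(u, v) := by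
  obtain ⟨C, ⟨v, p, hp, hpC⟩, huniq⟩ := h
  have hg := hp.three_le_length
  have : NeZero p.length := ⟨by omega⟩
  have hc : ∀ i : ZMod p.length, p.getVert ((i + 1).val) = p.getVert (i.val + 1) := by
    intro i
    have hi := i.val_lt
    have h1 : (i + 1).val = (i.val + 1) % p.length := by
      rw [ZMod.val_add, ZMod.val_one'' (by omega)]
    rcases Nat.lt_or_ge (i.val + 1) p.length with hlt | hge
    · rw [h1, Nat.mod_eq_of_lt hlt]
    · have : i.val + 1 = p.length := by omega
      rw [h1, this, Nat.mod_self, Walk.getVert_zero, Walk.getVert_length]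
  refine ⟨p.length, hg, fun i => p.getVert i.val, ?_, ?_, ?_⟩
  · intro i j hij
    have hi := i.val_lt
    have hj := j.val_lt
    exact ZMod.val_injective _ (hp.getVert_injOn' (by simp; omega) (by simp; omega) hij)
  · intro i
    beta_reduce
    rw [hc]
    exact p.adj_getVert_succ i.val_lt
  · intro a b hab hne
    rw [isBridge_iff_forall_cycle_notMem hab]
    intro u q hq hmem
    have hqC := huniq q.toSubgraph ⟨u, q, hq, rfl⟩
    rw [← Walk.adj_toSubgraph_iff_mem_edges, hqC, ← hpC, Walk.toSubgraph_adj_iff] at hmem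
    obtain ⟨i, he, hi⟩ := hmem
    apply hne i
    beta_reduce
    rw [hc, ZMod.val_natCast_of_lt hi, he]

/-- The vertices `f i k` with `k ≤ ℓ i` are distinct and carry the edges of a skeleton in the graph `G`. -/
structure IsSkeleton (G : SimpleGraph V) {g : ℕ} (ℓ : ZMod g → ℕ) (f : ZMod g → ℕ → V) : Prop where
  inj : ∀ i k j l, k ≤ ℓ i → l ≤ ℓ j → f i k = f j l → i = j ∧ k = l
  cyc : ∀ i, G.Adj (f i 0) (f (i + 1) 0)
  tail : ∀ i k, k < ℓ i → G.Adj (f i k) (f i (k + 1))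

namespace IsSkeleton

variable {g : ℕ} {ℓ : ZMod g → ℕ} {f : ZMod g → ℕ → V}

theorem reachable_cyc [NeZero g] (hs : G.IsSkeleton ℓ f) (i : ZMod g) :
    G.Reachable (f 0 0) (f i 0) := by
  have : ∀ n : ℕ, G.Reachable (f 0 0) (f (n : ZMod g) 0) := by
    intro n
    induction n with
    | zero => simp
    | succ n ih =>
      push_cast
      exact ih.trans (hs.cyc n).reachable
  simpa using this i.val

theorem reachable [NeZero g] (hs : G.IsSkeleton ℓ f) {i j : ZMod g} {k l : ℕ} (hk : k ≤ ℓ i)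
    (hl : l ≤ ℓ j) : G.Reachable (f i k) (f j l) := by
  have key : ∀ {i : ZMod g} {k : ℕ}, k ≤ ℓ i → G.Reachable (f 0 0) (f i k) := by
    intro i k hk
    induction k with
    | zero => exact hs.reachable_cyc i
    | succ k ih => exact (ih (by omega)).trans (hs.tail i k hk).reachable
  exact (key hk).symm.trans (key hl)

/-- A skeleton survives the deletion of an edge that is not one of its own. -/
theorem deleteEdges (hs : G.IsSkeleton ℓ f) {e : Sym2 V} (hc : ∀ i, s(f i 0, f (i + 1) 0) ≠ e)
    (ht : ∀ i k, k < ℓ i → s(f i k, f i (k + 1)) ≠ e) :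
    (G.deleteEdges {e}).IsSkeleton ℓ f where
  inj := hs.inj
  cyc i := by rw [deleteEdges_adj]; exact ⟨hs.cyc i, hc i⟩
  tail i k hk := by rw [deleteEdges_adj]; exact ⟨hs.tail i k hk, ht i k hk⟩

/-- If the edges outside of the cycle are bridges, then a skeleton is an induced subgraph. -/
theorem skelLink_of_adj [NeZero g] (hs : G.IsSkeleton ℓ f)
    (hb : ∀ u v, G.Adj u v → (∀ i, s(u, v) ≠ s(f i 0, f (i + 1) 0)) → G.IsBridge s(u, v))
    {i j : ZMod g} {k l : ℕ} (hk : k ≤ ℓ i) (hl : l ≤ ℓ j) (h : G.Adj (f i k) (f j l)) :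
    SkelLink i k j l ∨ SkelLink j l i k := by
  by_contra hne
  have key : ∀ {i₁ j₁ : ZMod g} {k₁ l₁ : ℕ}, k₁ ≤ ℓ i₁ → l₁ ≤ ℓ j₁ → SkelLink i₁ k₁ j₁ l₁ →
      s(f i₁ k₁, f j₁ l₁) ≠ s(f i k, f j l) := by
    intro i₁ j₁ k₁ l₁ hk₁ hl₁ hL he
    rw [Sym2.eq_iff] at he
    rcases he with ⟨h1, h2⟩ | ⟨h1, h2⟩
    · obtain ⟨rfl, rfl⟩ := hs.inj _ _ _ _ hk₁ hk h1
      obtain ⟨rfl, rfl⟩ := hs.inj _ _ _ _ hl₁ hl h2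
      exact hne (Or.inl hL)
    · obtain ⟨rfl, rfl⟩ := hs.inj _ _ _ _ hk₁ hl h1
      obtain ⟨rfl, rfl⟩ := hs.inj _ _ _ _ hl₁ hk h2
      exact hne (Or.inr hL)
  have h1 : ∀ i', s(f i' 0, f (i' + 1) 0) ≠ s(f i k, f j l) := fun i' =>
    key (Nat.zero_le _) (Nat.zero_le _) (Or.inl ⟨rfl, rfl, rfl⟩)
  have h2 : ∀ i' k', k' < ℓ i' → s(f i' k', f i' (k' + 1)) ≠ s(f i k, f j l) := fun i' k' hk' =>
    key hk'.le hk' (Or.inr ⟨rfl, rfl⟩)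
  exact hb _ _ h (fun i' => (h1 i').symm) ((hs.deleteEdges h1 h2).reachable hk hl)

/-- If the edges outside of the cycle are bridges, then a vertex outside of a skeleton has at most
one neighbour in it. -/
theorem eq_of_adj [NeZero g] (hs : G.IsSkeleton ℓ f)
    (hb : ∀ u v, G.Adj u v → (∀ i, s(u, v) ≠ s(f i 0, f (i + 1) 0)) → G.IsBridge s(u, v))
    {v : V} (hv : ∀ j m, m ≤ ℓ j → f j m ≠ v) {i j : ZMod g} {k l : ℕ} (hk : k ≤ ℓ i)
    (hl : l ≤ ℓ j) (h : G.Adj v (f i k)) (h' : G.Adj v (f j l)) : f j l = f i k := by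
  by_contra hne
  have key : ∀ {i₁ j₁ : ZMod g} {k₁ l₁ : ℕ}, k₁ ≤ ℓ i₁ → l₁ ≤ ℓ j₁ →
      s(f i₁ k₁, f j₁ l₁) ≠ s(v, f i k) := by
    intro i₁ j₁ k₁ l₁ hk₁ hl₁ he
    rw [Sym2.eq_iff] at he
    rcases he with ⟨h1, -⟩ | ⟨-, h1⟩
    · exact hv _ _ hk₁ h1
    · exact hv _ _ hl₁ h1
  have hs' := hs.deleteEdges (e := s(v, f i k)) (fun i' => key (Nat.zero_le _) (Nat.zero_le _))
    (fun i' k' hk' => key hk'.le hk')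
  have hadj : (G.deleteEdges {s(v, f i k)}).Adj v (f j l) := by
    rw [deleteEdges_adj]
    refine ⟨h', fun he => ?_⟩
    rw [Set.mem_singleton_iff, Sym2.eq_iff] at he
    rcases he with ⟨-, h1⟩ | ⟨-, h1⟩
    · exact hne h1
    · exact hv _ _ hl h1
  exact hb _ _ h (fun i' => (key (Nat.zero_le _) (Nat.zero_le _)).symm)
    (hadj.reachable.trans (hs'.reachable hl hk))

/-- A vertex adjacent to the end of an affixed path extends the path. -/
theorem extend (hs : G.IsSkeleton ℓ f) {v : V} (hv : ∀ j m, m ≤ ℓ j → f j m ≠ v) {i : ZMod g}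
    (h : G.Adj v (f i (ℓ i))) :
    G.IsSkeleton (fun j => if j = i then ℓ i + 1 else ℓ j)
      (fun j m => if j = i ∧ m = ℓ i + 1 then v else f j m) where
  inj a k b l hk hl := by
    intro he
    have hk' : ¬ (a = i ∧ k = ℓ i + 1) → k ≤ ℓ a := by
      intro hn
      by_cases ha : a = i
      · subst ha; simp at hk hn; omega
      · simpa [ha] using hk
    have hl' : ¬ (b = i ∧ l = ℓ i + 1) → l ≤ ℓ b := by
      intro hn
      by_cases hb : b = i
      · subst hb; simp at hl hn; omega
      · simpa [hb] using hl
    by_cases h1 : a = i ∧ k = ℓ i + 1 <;> by_cases h2 : b = i ∧ l = ℓ i + 1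
    · exact ⟨h1.1.trans h2.1.symm, h1.2.trans h2.2.symm⟩
    · rw [if_pos h1, if_neg h2] at he
      exact absurd he.symm (hv _ _ (hl' h2))
    · rw [if_neg h1, if_pos h2] at he
      exact absurd he (hv _ _ (hk' h1))
    · rw [if_neg h1, if_neg h2] at he
      exact hs.inj _ _ _ _ (hk' h1) (hl' h2) he
  cyc j := by simpa using hs.cyc j
  tail j k hk := by
    by_cases hj : j = i
    · subst hj
      simp only [if_true] at hk
      rcases (show k < ℓ j ∨ k = ℓ j by omega) with h1 | rfl
      · have h2 : k ≠ ℓ j + 1 := by omega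
        have h3 : k ≠ ℓ j := by omega
        simpa [h2, h3] using hs.tail j k h1
      · simpa using h.symm
    · simp only [hj, if_false, false_and] at hk ⊢
      exact hs.tail j k hk

end IsSkeleton

end SimpleGraph

namespace MixedGraph

variable {V : Type*}

theorem hMatrix_ne_zero_iff (M : MixedGraph V) (u v : V) : M.hMatrix u v ≠ 0 ↔ M.graph.Adj u v := by
  have h₁ := @M.adj_of_arc u v
  have h₂ := @M.adj_of_arc v u
  by_cases a : M.arc u v <;> by_cases b : M.arc v u <;> by_cases c : M.graph.Adj u v <;>
    simp_all [hMatrix, SimpleGraph.adj_comm]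

theorem hMatrix_mem {M : MixedGraph V} {u v : V} (h : M.graph.Adj u v) :
    M.hMatrix u v ∈ fourthRoots := by
  by_cases a : M.arc u v <;> by_cases b : M.arc v u <;> simp_all [hMatrix, fourthRoots]

theorem hMatrix_self (M : MixedGraph V) (v : V) : M.hMatrix v v = 0 := by
  by_contra h
  exact M.graph.irrefl ((M.hMatrix_ne_zero_iff v v).1 h)

theorem isSkeleton_hMatrix (M : MixedGraph V) {g : ℕ} (hg : 3 ≤ g) {ℓ : ZMod g → ℕ}
    {f : ZMod g → ℕ → V} (hs : M.graph.IsSkeleton ℓ f)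
    (h : ∀ i k j l, k ≤ ℓ i → l ≤ ℓ j → M.graph.Adj (f i k) (f j l) →
      SkelLink i k j l ∨ SkelLink j l i k) :
    _root_.IsSkeleton M.hMatrix g ℓ f where
  three_le := hg
  herm := M.isHermitian_hMatrix
  inj := hs.inj
  cyc i := hMatrix_mem (hs.cyc i)
  tail i k hk := hMatrix_mem (hs.tail i k hk)
  zero i k j l hk hl hne := h i k j l hk hl ((M.hMatrix_ne_zero_iff _ _).1 hne)

/-- A unicyclic mixed graph is a cycle with paths affixed, or it contains such a graph together with
a vertex that branches off from one of the affixed paths. -/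
theorem IsUnicyclic.exists_isSkeleton [Fintype V] {M : MixedGraph V} (hM : M.IsUnicyclic) :
    ∃ (g : ℕ) (ℓ : ZMod g → ℕ) (f : ZMod g → ℕ → V), IsSkeleton M.hMatrix g ℓ f ∧
      (SkelCovers ℓ f ∨ ∃ v, IsSkeleton.IsBranch M.hMatrix ℓ f v) := by
  classical
  obtain ⟨g, hg, c, hinj, hadj, hb⟩ := SimpleGraph.exists_cycle_isBridge hM.2
  have : NeZero g := ⟨by omega⟩
  have key : ∀ n : ℕ, ∀ (ℓ : ZMod g → ℕ) (f : ZMod g → ℕ → V), (∀ i, f i 0 = c i) →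
      M.graph.IsSkeleton ℓ f → #{v | ∀ j m, m ≤ ℓ j → f j m ≠ v} = n →
      ∃ (ℓ : ZMod g → ℕ) (f : ZMod g → ℕ → V), IsSkeleton M.hMatrix g ℓ f ∧
        (SkelCovers ℓ f ∨ ∃ v, IsSkeleton.IsBranch M.hMatrix ℓ f v) := by
    intro n
    induction n using Nat.strong_induction_on with
    | _ n ih =>
    intro ℓ f hfc hs hn
    have hb' : ∀ u v, M.graph.Adj u v → (∀ i, s(u, v) ≠ s(f i 0, f (i + 1) 0)) →
        M.graph.IsBridge s(u, v) := by simpa only [hfc] using hb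
    have hS := M.isSkeleton_hMatrix hg hs fun i k j l hk hl => hs.skelLink_of_adj hb' hk hl
    by_cases hcov : SkelCovers ℓ f
    · exact ⟨ℓ, f, hS, Or.inl hcov⟩
    simp only [SkelCovers, not_forall] at hcov
    obtain ⟨u, hu⟩ := hcov
    obtain ⟨p⟩ := hM.1.preconnected (f 0 0) u
    obtain ⟨d, -, ⟨i, k, hk, hd1⟩, hd2⟩ := p.exists_boundary_dart
      {u | ∃ i k, k ≤ ℓ i ∧ f i k = u} ⟨0, 0, Nat.zero_le _, rfl⟩ hu
    have hv : ∀ j m, m ≤ ℓ j → f j m ≠ d.snd := fun j m hm he => hd2 ⟨j, m, hm, he⟩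
    have hadj' : M.graph.Adj d.snd (f i k) := by rw [hd1]; exact d.adj.symm
    rcases hk.lt_or_eq with hlt | rfl
    · refine ⟨ℓ, f, hS, Or.inr ⟨d.snd, hv, M.hMatrix_self _, i, k, hlt, hMatrix_mem hadj', ?_⟩⟩
      intro j m hm hne
      exact hs.eq_of_adj hb' hv hk hm hadj' ((M.hMatrix_ne_zero_iff _ _).1 hne)
    · refine ih _ ?_ _ _ (fun j => ?_) (hs.extend hv hadj') rfl
      · rw [← hn]
        refine card_lt_card (ssubset_iff_of_subset ?_ |>.2 ⟨d.snd, by simpa using hv, ?_⟩)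
        · intro w hw
          simp only [mem_filter, mem_univ, true_and] at hw ⊢
          intro j m hm
          have hm' : ¬ (j = i ∧ m = ℓ i + 1) := by
            rintro ⟨rfl, rfl⟩; omega
          have := hw j m (by split_ifs with hj <;> [(subst hj; omega); exact hm])
          rwa [if_neg hm'] at this
        · simp only [mem_filter, mem_univ, true_and, not_forall]
          exact ⟨i, ℓ i + 1, by simp, by simp⟩
      · simp [hfc]
  obtain ⟨ℓ, f, h⟩ := key _ (fun _ => 0) (fun i _ => c i) (fun _ => rfl)
    ⟨fun i k j l hk hl h => ⟨hinj h, by omega⟩, hadj, fun i k hk => absurd hk (by simp)⟩ rfl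
  exact ⟨g, ℓ, f, h⟩

end MixedGraph

/-! ### Comparing skeletons -/

namespace IsSkeleton

variable {V W : Type*} {H : Matrix V V ℂ} {H' : Matrix W W ℂ} {g : ℕ} {ℓ : ZMod g → ℕ}
  {f : ZMod g → ℕ → V} {f' : ZMod g → ℕ → W}

/-- Switching by `pot` turns the entries along the cycle into `1`, except for the last one. -/
theorem pot_mul_conj_succ (hs : IsSkeleton H g ℓ f) (i : ZMod g) :
    pot H f i 0 * H (f i 0) (f (i + 1) 0) * conj (pot H f (i + 1) 0) =
      if i.val + 1 = g then skelWeight H g f else 1 := by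
  have := hs.neZero
  have hg := hs.three_le
  have hp : ∀ j, cycPot H f j * conj (cycPot H f j) = 1 := fun j => by
    rw [Complex.mul_conj, normSq_of_mem_fourthRoots (hs.cycPot_mem j), Complex.ofReal_one]
  have h1 : (i + 1).val = (i.val + 1) % g := by rw [ZMod.val_add, ZMod.val_one'' (by omega)]
  have h2 := cycPot_succ (H := H) (f := f) i.val
  rw [ZMod.natCast_zmod_val] at h2
  simp only [pot, range_zero, prod_empty, mul_one]
  rw [← h2, h1]
  split_ifs with h
  · rw [h, Nat.mod_self, cycPot_zero, cycPot_self, map_one, mul_one]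
  · rw [Nat.mod_eq_of_lt (by have := i.val_lt; omega), hp]

theorem pot_mul_conj_tail (hs : IsSkeleton H g ℓ f) {i : ZMod g} {k : ℕ} (hk : k + 1 ≤ ℓ i) :
    pot H f i k * H (f i k) (f i (k + 1)) * conj (pot H f i (k + 1)) = 1 := by
  rw [← pot_succ, Complex.mul_conj, normSq_of_mem_fourthRoots (hs.pot_mem hk), Complex.ofReal_one]

/-- The standard form of a skeleton is determined by its shape and its weight. -/
theorem pot_mul_conj_eq (hs : IsSkeleton H g ℓ f) (hs' : IsSkeleton H' g ℓ f')
    (hw : skelWeight H g f = skelWeight H' g f') {i j : ZMod g} {k l : ℕ} (hk : k ≤ ℓ i)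
    (hl : l ≤ ℓ j) : pot H f i k * H (f i k) (f j l) * conj (pot H f j l) =
      pot H' f' i k * H' (f' i k) (f' j l) * conj (pot H' f' j l) := by
  have key : ∀ {i j : ZMod g} {k l : ℕ}, k ≤ ℓ i → l ≤ ℓ j → SkelLink i k j l →
      pot H f i k * H (f i k) (f j l) * conj (pot H f j l) =
        pot H' f' i k * H' (f' i k) (f' j l) * conj (pot H' f' j l) := by
    rintro i j k l hk hl (⟨rfl, rfl, rfl⟩ | ⟨rfl, rfl⟩)
    · rw [hs.pot_mul_conj_succ, hs'.pot_mul_conj_succ, hw]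
    · rw [hs.pot_mul_conj_tail hl, hs'.pot_mul_conj_tail hl]
  by_cases h1 : SkelLink i k j l
  · exact key hk hl h1
  by_cases h2 : SkelLink j l i k
  · have := congrArg conj (key hl hk h2)
    simp only [map_mul, Complex.conj_conj] at this
    have e : conj (H (f j l) (f i k)) = H (f i k) (f j l) := hs.herm.apply _ _
    have e' : conj (H' (f' j l) (f' i k)) = H' (f' i k) (f' j l) := hs'.herm.apply _ _
    rw [e, e'] at this
    linear_combination this
  · have e : H (f i k) (f j l) = 0 := by
      by_contra h
      exact (hs.zero i k j l hk hl h).elim h1 h2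
    have e' : H' (f' i k) (f' j l) = 0 := by
      by_contra h
      exact (hs'.zero i k j l hk hl h).elim h1 h2
    rw [e, e']
    simp

end IsSkeleton

namespace MixedGraph

variable {V W : Type*}

theorem isSkeleton_converse {N : MixedGraph W} {g : ℕ} {ℓ : ZMod g → ℕ} {f : ZMod g → ℕ → W}
    (hs : IsSkeleton N.hMatrix g ℓ f) : IsSkeleton N.converse.hMatrix g ℓ f where
  three_le := hs.three_le
  herm := N.converse.isHermitian_hMatrix
  inj := hs.inj
  cyc i := by rw [hMatrix_converse]; exact conj_mem_fourthRoots (hs.cyc i)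
  tail i k hk := by rw [hMatrix_converse]; exact conj_mem_fourthRoots (hs.tail i k hk)
  zero i k j l hk hl h := hs.zero i k j l hk hl (by rw [hMatrix_converse] at h; simpa using h)

theorem skelWeight_converse (N : MixedGraph W) (g : ℕ) (f : ZMod g → ℕ → W) :
    skelWeight N.converse.hMatrix g f = conj (skelWeight N.hMatrix g f) := by
  simp only [skelWeight, hMatrix_converse, map_prod]

/-- The correspondence between the vertices of two skeletons of the same shape is a four-way switching
onto an induced subgraph when their cycles have the same weight. The correspondence depends only on
the vertices, so that it serves `N` as well as its converse. -/
theorem exists_equiv_switching {M : MixedGraph V} {N : MixedGraph W} {g : ℕ} {ℓ : ZMod g → ℕ}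
    {f : ZMod g → ℕ → V} {f' : ZMod g → ℕ → W} (hs : IsSkeleton M.hMatrix g ℓ f)
    (hf : SkelCovers ℓ f) (hs' : IsSkeleton N.hMatrix g ℓ f') :
    ∃ (s : Set W) (e : V ≃ s), ∀ N' : MixedGraph W, IsSkeleton N'.hMatrix g ℓ f' →
      skelWeight M.hMatrix g f = skelWeight N'.hMatrix g f' →
      FourWaySwitching M ((N'.induce s).comap e.toEmbedding) := by
  choose a b hab hfab using hf
  have hinv : ∀ i k, k ≤ ℓ i → a (f i k) = i ∧ b (f i k) = k := fun i k hk =>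
    hs.inj _ _ _ _ (hab _) hk (hfab _)
  have hbij : Function.Bijective
      (fun v => (⟨f' (a v) (b v), a v, b v, hab v, rfl⟩ : {u | ∃ i k, k ≤ ℓ i ∧ f' i k = u})) := by
    constructor
    · intro u v h
      obtain ⟨h1, h2⟩ := hs'.inj _ _ _ _ (hab u) (hab v) (congrArg Subtype.val h)
      rw [← hfab u, ← hfab v, h1, h2]
    · rintro ⟨_, i, k, hk, rfl⟩
      refine ⟨f i k, Subtype.ext ?_⟩
      simp only [hinv i k hk]
  refine ⟨_, Equiv.ofBijective _ hbij, fun N' hN' hw => ?_⟩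
  refine ⟨fun v => (IsSkeleton.pot N'.hMatrix f' (a v) (b v))⁻¹ *
      IsSkeleton.pot M.hMatrix f (a v) (b v),
    fun v => mul_mem_fourthRoots (inv_mem_fourthRoots (hN'.pot_mem (hab v))) (hs.pot_mem (hab v)),
    fun u v => ?_⟩
  have key := hs.pot_mul_conj_eq hN' hw (hab u) (hab v)
  rw [hfab, hfab] at key
  have e : ((N'.induce {u | ∃ i k, k ≤ ℓ i ∧ f' i k = u}).comap
      (Equiv.ofBijective _ hbij).toEmbedding).hMatrix u v =
      N'.hMatrix (f' (a u) (b u)) (f' (a v) (b v)) := by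
    rw [hMatrix_comap, induce, hMatrix_comap]
    rfl
  rw [e]
  rw [conj_eq_inv_of_mem_fourthRoots (hs.pot_mem (hab v)),
    conj_eq_inv_of_mem_fourthRoots (hN'.pot_mem (hab v))] at key
  have h1 := ne_zero_of_mem_fourthRoots (hs.pot_mem (hab u))
  have h2 := ne_zero_of_mem_fourthRoots (hs.pot_mem (hab v))
  have h3 := ne_zero_of_mem_fourthRoots (hN'.pot_mem (hab u))
  have h4 := ne_zero_of_mem_fourthRoots (hN'.pot_mem (hab v))
  field_simp at key ⊢
  linear_combination key

/-- A mixed graph with a covering skeleton is an induced subgraph of every mixed graph with a larger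
skeleton of the same weight, up to complex conjugation. -/
theorem isInducedSubgraph_of_isSkeleton {M : MixedGraph V} {N : MixedGraph W} {g : ℕ}
    {ℓ ℓ' : ZMod g → ℕ} {f : ZMod g → ℕ → V} {f' : ZMod g → ℕ → W}
    (hs : IsSkeleton M.hMatrix g ℓ f) (hf : SkelCovers ℓ f) (hs' : IsSkeleton N.hMatrix g ℓ' f')
    (hl : ∀ i, ℓ i ≤ ℓ' i)
    (hw : skelWeight M.hMatrix g f = skelWeight N.hMatrix g f' ∨
      skelWeight M.hMatrix g f = conj (skelWeight N.hMatrix g f')) : M.IsInducedSubgraph N := by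
  have hs' := hs'.mono hl
  obtain ⟨s, e, h⟩ := exists_equiv_switching hs hf hs'
  refine ⟨s, e, hw.imp (h N hs') fun hw => ?_⟩
  exact h N.converse (isSkeleton_converse hs') (by rw [skelWeight_converse, hw])

/-! ### The special mixed graphs as skeletons -/

/-- The whole of `N` is a skeleton: it is, up to switching, a cycle of length `g` and weight `w` with a
path of `ℓ i` new vertices affixed at the cycle vertex `i`. -/
structure HasSkeleton (N : MixedGraph W) (g : ℕ) (ℓ : ZMod g → ℕ) (w : ℂ) (f : ZMod g → ℕ → W) :
    Prop where
  isSkeleton : IsSkeleton N.hMatrix g ℓ f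
  covers : SkelCovers ℓ f
  weight : skelWeight N.hMatrix g f = w

/-- The vertex of `Fin n` with the value of a residue class modulo `n`. -/
def finOfZMod {n : ℕ} (hn : 3 ≤ n) (i : ZMod n) : Fin n :=
  ⟨i.val, haveI : NeZero n := ⟨by omega⟩; i.val_lt⟩

theorem isSkeleton_mixedCycle {n : ℕ} (hn : 3 ≤ n) (a : ℕ) :
    IsSkeleton (mixedCycle n a).hMatrix n (fun _ => 0) (fun i _ => finOfZMod hn i) := by
  have : NeZero n := ⟨by omega⟩
  have hadj : ∀ i j : ZMod n, (mixedCycle n a).graph.Adj (finOfZMod hn i) (finOfZMod hn j) ↔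
      j = i + 1 ∨ i = j + 1 := by
    intro i j
    obtain ⟨m, rfl⟩ : ∃ m, n = m + 2 := ⟨n - 2, by omega⟩
    have key : ∀ i j : Fin (m + 2), (SimpleGraph.cycleGraph (m + 2)).Adj i j ↔
        j = i + 1 ∨ i = j + 1 := by
      intro i j
      rw [SimpleGraph.cycleGraph_adj, sub_eq_iff_eq_add, sub_eq_iff_eq_add,
        add_comm (1 : Fin (m + 2)), add_comm (1 : Fin (m + 2)), or_comm]
    exact key i j
  refine isSkeleton_hMatrix _ hn ⟨?_, ?_, ?_⟩ ?_
  · intro i k j l hk hl h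
    refine ⟨ZMod.val_injective _ (congrArg Fin.val h), by omega⟩
  · intro i
    rw [hadj]
    exact Or.inl rfl
  · intro i k hk
    exact absurd hk (Nat.not_lt_zero _)
  · intro i k j l hk hl h
    rw [hadj] at h
    have hk : k = 0 := by omega
    have hl : l = 0 := by omega
    exact h.imp (fun h => Or.inl ⟨hk, hl, h⟩) (fun h => Or.inl ⟨hl, hk, h⟩)

theorem hasSkeleton_mixedCycle {n : ℕ} (hn : 3 ≤ n) {a : ℕ} (ha : a < n) :
    (mixedCycle n a).HasSkeleton n (fun _ => 0) (Complex.I ^ a)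
      (fun i _ => finOfZMod hn i) := by
  have : NeZero n := ⟨by omega⟩
  refine ⟨isSkeleton_mixedCycle hn a, fun u => ?_, ?_⟩
  · exact ⟨(u.val : ZMod n), 0, le_rfl, Fin.ext (ZMod.val_natCast_of_lt u.isLt)⟩
  have h1 : ∀ j ∈ range n, (mixedCycle n a).hMatrix (finOfZMod hn (j : ZMod n))
      (finOfZMod hn ((j : ZMod n) + 1)) = if j < a then Complex.I else 1 := by
    intro j hj
    have hj := mem_range.1 hj
    have hadj := (hMatrix_ne_zero_iff _ _ _).1
      (ne_zero_of_mem_fourthRoots ((isSkeleton_mixedCycle hn a).cyc j))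
    have hv : (finOfZMod hn (j : ZMod n)).val = j := ZMod.val_natCast_of_lt hj
    have hv' : (finOfZMod hn ((j : ZMod n) + 1)).val = (j + 1) % n := by
      change ((j : ZMod n) + 1).val = _
      rw [ZMod.val_add, ZMod.val_natCast_of_lt hj, ZMod.val_one'' (by omega)]
    have harc : (mixedCycle n a).arc (finOfZMod hn (j : ZMod n))
        (finOfZMod hn ((j : ZMod n) + 1)) ↔ j < a := by
      change _ ∧ _ ∧ _ ↔ _
      rw [hv, hv']
      refine ⟨fun h => h.2.2, fun h => ⟨hadj, ?_, h⟩⟩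
      rw [Nat.mod_eq_of_lt (by omega)]
    have harc' : ¬ (mixedCycle n a).arc (finOfZMod hn ((j : ZMod n) + 1))
        (finOfZMod hn (j : ZMod n)) := by
      rintro ⟨-, h, -⟩
      rw [hv, hv'] at h
      rcases Nat.lt_or_ge (j + 1) n with h2 | h2
      · rw [Nat.mod_eq_of_lt h2] at h; omega
      · rw [show j + 1 = n by omega, Nat.mod_self] at h; omega
    simp only [hMatrix, Matrix.of_apply, harc, harc', if_false, hadj, if_true]
  rw [skelWeight, prod_congr rfl h1, prod_ite, prod_const, prod_const_one, mul_one]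
  congr 1
  rw [show {x ∈ range n | x < a} = range a by ext; simp; omega, card_range]

/-- The vertices of a skeleton after affixing a path of `m` new vertices at the cycle vertex `i`. -/
def affixSkel {g : ℕ} (f : ZMod g → ℕ → W) (i : ZMod g) (m : ℕ) (j : ZMod g) (k : ℕ) :
    W ⊕ Fin m :=
  open Classical in
  if h : j = i ∧ 1 ≤ k ∧ k ≤ m then Sum.inr ⟨k - 1, by omega⟩ else Sum.inl (f j k)

theorem affixSkel_zero {g : ℕ} (f : ZMod g → ℕ → W) (i : ZMod g) (m : ℕ) (j : ZMod g) :
    affixSkel f i m j 0 = Sum.inl (f j 0) :=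
  dif_neg (by omega)

theorem affixSkel_self {g : ℕ} (f : ZMod g → ℕ → W) (i : ZMod g) {m k : ℕ} (hk : k + 1 ≤ m) :
    affixSkel f i m i (k + 1) = Sum.inr ⟨k, hk⟩ :=
  dif_pos ⟨rfl, by omega, hk⟩

theorem affixSkel_of_ne {g : ℕ} (f : ZMod g → ℕ → W) {i j : ZMod g} (h : j ≠ i) (m k : ℕ) :
    affixSkel f i m j k = Sum.inl (f j k) :=
  dif_neg fun h' => h h'.1

theorem hMatrix_affixPath (N : MixedGraph W) (v : W) (m : ℕ) (a b : W) :
    (N.affixPath v m).hMatrix (Sum.inl a) (Sum.inl b) = N.hMatrix a b := by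
  simp only [hMatrix, affixPath, Matrix.of_apply]
  rfl

/-- Affixing a path at a cycle vertex to which none has been affixed. -/
theorem HasSkeleton.affixPath {N : MixedGraph W} {g : ℕ} {ℓ : ZMod g → ℕ} {w : ℂ}
    {f : ZMod g → ℕ → W} (hs : N.HasSkeleton g ℓ w f) {i : ZMod g} (hi : ℓ i = 0) {v : W}
    (hv : v = f i 0) (m : ℕ) :
    (N.affixPath v m).HasSkeleton g (Function.update ℓ i m) w (affixSkel f i m) := by
  subst hv
  have hsk := hs.isSkeleton
  have hadj : ∀ a b, N.graph.Adj a b → (N.affixPath (f i 0) m).graph.Adj (Sum.inl a) (Sum.inl b) :=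
    fun a b h => h
  -- a vertex of the new skeleton is a vertex of the old one or lies on the new path
  have hcases : ∀ j k, k ≤ Function.update ℓ i m j →
      (k ≤ ℓ j ∧ affixSkel f i m j k = Sum.inl (f j k)) ∨
      (j = i ∧ ∃ k', ∃ h : k' + 1 ≤ m, k = k' + 1 ∧ affixSkel f i m j k = Sum.inr ⟨k', h⟩) := by
    intro j k hk
    by_cases hj : j = i
    · subst hj
      rw [Function.update_self] at hk
      rcases k with - | k
      · exact Or.inl ⟨Nat.zero_le _, affixSkel_zero f j m j⟩
      · exact Or.inr ⟨rfl, k, hk, rfl, affixSkel_self f j hk⟩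
    · rw [Function.update_of_ne hj] at hk
      exact Or.inl ⟨hk, affixSkel_of_ne f hj m k⟩
  refine ⟨isSkeleton_hMatrix _ hsk.three_le ⟨?_, ?_, ?_⟩ ?_, ?_, ?_⟩
  · intro j k j' k' hk hk' h
    rcases hcases j k hk with ⟨h1, h2⟩ | ⟨rfl, k₁, h1, rfl, h2⟩ <;>
      rcases hcases j' k' hk' with ⟨h3, h4⟩ | ⟨h0, k₂, h3, rfl, h4⟩ <;> rw [h2, h4] at h
    · exact hsk.inj _ _ _ _ h1 h3 (Sum.inl_injective h)
    · cases h
    · cases h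
    · have := congrArg Fin.val (Sum.inr_injective h)
      exact ⟨h0.symm, congrArg (· + 1) this⟩
  · intro j
    rw [affixSkel_zero, affixSkel_zero]
    exact hadj _ _ ((hMatrix_ne_zero_iff _ _ _).1 (ne_zero_of_mem_fourthRoots (hsk.cyc j)))
  · intro j k hk
    by_cases hj : j = i
    · subst hj
      rw [Function.update_self] at hk
      rw [affixSkel_self f j hk]
      rcases k with - | k
      · rw [affixSkel_zero]
        exact ⟨rfl, rfl⟩
      · rw [affixSkel_self f j hk.le]
        exact Or.inl rfl
    · rw [Function.update_of_ne hj] at hk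
      rw [affixSkel_of_ne f hj, affixSkel_of_ne f hj]
      exact hadj _ _ ((hMatrix_ne_zero_iff _ _ _).1 (ne_zero_of_mem_fourthRoots (hsk.tail j k hk)))
  · intro j k j' k' hk hk' h
    rcases hcases j k hk with ⟨h1, h2⟩ | ⟨rfl, k₁, h1, rfl, h2⟩ <;>
      rcases hcases j' k' hk' with ⟨h3, h4⟩ | ⟨h0, k₂, h3, rfl, h4⟩ <;> rw [h2, h4] at h
    · exact hsk.zero _ _ _ _ h1 h3 ((hMatrix_ne_zero_iff _ _ _).2 h)
    · obtain ⟨h5, h6⟩ : f j k = f i 0 ∧ k₂ = 0 := h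
      obtain ⟨rfl, rfl⟩ := hsk.inj _ _ _ _ h1 (Nat.zero_le _) h5
      exact Or.inl (Or.inr ⟨h0, by omega⟩)
    · obtain ⟨h5, h6⟩ : f j' k' = f j 0 ∧ k₁ = 0 := h
      obtain ⟨rfl, rfl⟩ := hsk.inj _ _ _ _ h3 (Nat.zero_le _) h5
      exact Or.inr (Or.inr ⟨rfl, by omega⟩)
    · rcases (show k₁ + 1 = k₂ ∨ k₂ + 1 = k₁ from h) with h | h
      · exact Or.inl (Or.inr ⟨h0, by omega⟩)
      · exact Or.inr (Or.inr ⟨h0.symm, by omega⟩)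
  · rintro (u | k)
    · obtain ⟨j, k, hk, rfl⟩ := hs.covers u
      by_cases hj : j = i
      · subst hj
        have : k = 0 := by omega
        subst this
        exact ⟨j, 0, Nat.zero_le _, affixSkel_zero f j m j⟩
      · exact ⟨j, k, by rwa [Function.update_of_ne hj], affixSkel_of_ne f hj m k⟩
    · exact ⟨i, k.val + 1, by rw [Function.update_self]; omega, affixSkel_self f i k.isLt⟩
  · rw [← hs.weight]
    simp only [skelWeight, affixSkel_zero, hMatrix_affixPath]

theorem hasSkeleton_cyclePos {n : ℕ} (hn : 3 ≤ n) :
    (cyclePos n).HasSkeleton n (fun _ => 0) 1 (fun i _ => finOfZMod hn i) := by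
  simpa [cyclePos] using hasSkeleton_mixedCycle hn (a := 0) (by omega)

theorem hasSkeleton_cycleIm {n : ℕ} (hn : 3 ≤ n) :
    (cycleIm n).HasSkeleton n (fun _ => 0) Complex.I (fun i _ => finOfZMod hn i) := by
  simpa [cycleIm] using hasSkeleton_mixedCycle hn (a := 1) (by omega)

theorem hasSkeleton_cycleNeg {n : ℕ} (hn : 3 ≤ n) :
    (cycleNeg n).HasSkeleton n (fun _ => 0) (-1) (fun i _ => finOfZMod hn i) := by
  simpa [cycleNeg] using hasSkeleton_mixedCycle hn (a := 2) (by omega)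

theorem finOfZMod_natCast {n : ℕ} (hn : 3 ≤ n) {k : ℕ} (hk : k < n) :
    finOfZMod hn (k : ZMod n) = ⟨k, hk⟩ :=
  Fin.ext (ZMod.val_natCast_of_lt hk)

theorem finOfZMod_zero {n : ℕ} (hn : 3 ≤ n) : finOfZMod hn 0 = ⟨0, by omega⟩ :=
  Fin.ext ZMod.val_zero

theorem natCast_ne_zero_of_lt {n k : ℕ} (hk : 1 ≤ k) (hkn : k < n) : (k : ZMod n) ≠ 0 := by
  rw [Ne, ZMod.natCast_eq_zero_iff]
  exact fun h => absurd (Nat.le_of_dvd (by omega) h) (by omega)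

theorem hasSkeleton_tailedCycleIm {k n : ℕ} (h : 3 ≤ k ∧ k < n) :
    ∃ f, (tailedCycleIm k n h).HasSkeleton k (Function.update (fun _ => 0) 0 (n - k)) Complex.I f :=
  ⟨_, (hasSkeleton_cycleIm h.1).affixPath rfl (finOfZMod_zero h.1).symm _⟩

theorem hasSkeleton_GNeg {n k : ℕ} (h : 3 ≤ n ∧ 2 ≤ k ∧ k ≤ n) :
    ∃ f, (GNeg n k h).HasSkeleton n
      (Function.update (Function.update (fun _ => 0) 0 1) ((k - 1 : ℕ) : ZMod n) 1) (-1) f := by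
  refine ⟨_, ((hasSkeleton_cycleNeg h.1).affixPath rfl (finOfZMod_zero h.1).symm 1).affixPath
    (i := ((k - 1 : ℕ) : ZMod n)) ?_ ?_ 1⟩
  · rw [Function.update_of_ne (natCast_ne_zero_of_lt (by omega) (by omega))]
  · rw [affixSkel_zero, finOfZMod_natCast h.1 (by omega)]

theorem hasSkeleton_UNeg (k l : ℕ) :
    ∃ f, (UNeg k l).HasSkeleton 6
      (Function.update (Function.update (fun _ => 0) 0 k) 3 l) (-1) f := by
  refine ⟨_, ((hasSkeleton_cycleNeg (n := 6) (by omega)).affixPath rfl (i := 0) ?_ k).affixPath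
    (i := 3) ?_ ?_ l⟩
  · rfl
  · rw [Function.update_of_ne (by decide)]
  · rw [affixSkel_zero]; rfl

theorem hasSkeleton_U6Neg :
    ∃ f, U6Neg.HasSkeleton 6
      (Function.update (Function.update (Function.update (fun _ => 0) 0 2) 2 1) 4 1) (-1) f := by
  refine ⟨_, (((hasSkeleton_cycleNeg (n := 6) (by omega)).affixPath rfl (i := 0) ?_ 2).affixPath
    (i := 2) ?_ ?_ 1).affixPath (i := 4) ?_ ?_ 1⟩
  · rfl
  · rw [Function.update_of_ne (by decide)]
  · rw [affixSkel_zero]; rfl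
  · rw [Function.update_of_ne (by decide), Function.update_of_ne (by decide)]
  · rw [affixSkel_zero, affixSkel_zero]; rfl

theorem hasSkeleton_U8Neg :
    ∃ f, U8Neg.HasSkeleton 8
      (Function.update (Function.update (fun _ => 0) 0 2) 4 2) (-1) f := by
  refine ⟨_, ((hasSkeleton_cycleNeg (n := 8) (by omega)).affixPath rfl (i := 0) ?_ 2).affixPath
    (i := 4) ?_ ?_ 2⟩
  · rfl
  · rw [Function.update_of_ne (by decide)]
  · rw [affixSkel_zero]; rfl

end MixedGraph

/-! ### Monotonicity of the spectral radius -/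

/-- Positive semidefiniteness passes to principal submatrices and is invariant under switching. -/
theorem energy_nonneg_of_embedding {V W : Type*} [Fintype V] [Fintype W] {H : Matrix V V ℂ}
    {K : Matrix W W ℂ} (hK : ∀ z, 0 ≤ energy K z) (ψ : V ↪ W) {d : V → ℂ}
    (hd : ∀ v, d v ∈ fourthRoots) (h : ∀ u v, H u v = (d u)⁻¹ * K (ψ u) (ψ v) * d v) (x : V → ℂ) :
    0 ≤ energy H x := by
  classical
  obtain ⟨z, hz⟩ : ∃ z, z = Function.extend ψ (fun v => d v * x v) 0 := ⟨_, rfl⟩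
  have hzv : ∀ v, z (ψ v) = d v * x v := fun v => by rw [hz, ψ.injective.extend_apply]
  have hz0 : ∀ w, w ∉ Set.range ψ → z w = 0 := fun w hw => by
    rw [hz, Function.extend_apply' _ _ _ hw]; rfl
  have e : energy H x = energy K z := by
    rw [energy, energy]
    congr 1
    · congr 1
      refine Fintype.sum_of_injective ψ ψ.injective _ _ (fun w hw => by simp [hz0 w hw]) fun v => ?_
      rw [hzv, map_mul, normSq_of_mem_fourthRoots (hd v), one_mul]
    · refine Fintype.sum_of_injective ψ ψ.injective _ _ (fun w hw => by simp [hz0 w hw]) fun u => ?_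
      refine Fintype.sum_of_injective ψ ψ.injective _ _ (fun w hw => by simp [hz0 w hw]) fun v => ?_
      rw [hzv, hzv, h, map_mul, conj_eq_inv_of_mem_fourthRoots (hd u)]
      ring_nf
  rw [e]
  exact hK z

theorem energy_conj_nonneg {W : Type*} [Fintype W] {K K' : Matrix W W ℂ}
    (hK : ∀ z, 0 ≤ energy K z) (h : ∀ u v, K' u v = conj (K u v)) (z : W → ℂ) :
    0 ≤ energy K' z := by
  have := hK (fun w => conj (z w))
  have e : energy K' z = energy K (fun w => conj (z w)) := by
    simp only [energy, Complex.normSq_conj, Complex.conj_conj]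
    congr 1
    refine sum_congr rfl fun u _ => sum_congr rfl fun v _ => ?_
    rw [h, ← Complex.conj_re]
    simp
  rwa [e]

namespace MixedGraph

theorem spectralRadius_le_of_isInducedSubgraph {V W : Type*} [Fintype V] [Fintype W]
    {M : MixedGraph V} {N : MixedGraph W} (hN : N.spectralRadius ≤ gr ^ 3)
    (h : M.IsInducedSubgraph N) : M.spectralRadius ≤ gr ^ 3 := by
  rw [spectralRadius_le_iff] at hN ⊢
  obtain ⟨s, e, h⟩ := h
  have key : ∀ N' : MixedGraph W, (∀ x, 0 ≤ energy N'.hMatrix x) → (∀ x, 0 ≤ energy (-N'.hMatrix) x) →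
      FourWaySwitching M ((N'.induce s).comap e.toEmbedding) →
      (∀ x, 0 ≤ energy M.hMatrix x) ∧ ∀ x, 0 ≤ energy (-M.hMatrix) x := by
    rintro N' h1 h2 ⟨d, hd, hM⟩
    have hM' : ∀ u v, M.hMatrix u v = (d u)⁻¹ * N'.hMatrix (e u) (e v) * d v := by
      intro u v
      rw [hM, hMatrix_comap, induce, hMatrix_comap]
      rfl
    refine ⟨energy_nonneg_of_embedding h1 (e.toEmbedding.trans (.subtype _)) hd hM',
      energy_nonneg_of_embedding h2 (e.toEmbedding.trans (.subtype _)) hd fun u v => ?_⟩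
    rw [Matrix.neg_apply, hM', Matrix.neg_apply, mul_neg, neg_mul]
    rfl
  rcases h with h | h
  · exact key N hN.1 hN.2 h
  · refine key N.converse (energy_conj_nonneg hN.1 fun u v => hMatrix_converse N u v)
      (energy_conj_nonneg hN.2 fun u v => ?_) h
    rw [Matrix.neg_apply, Matrix.neg_apply, hMatrix_converse, map_neg]

/-! ### The special mixed graphs have small spectral radius -/

/-- The matrix `-H` has the same skeleton as `H`, with the weight of the cycle multiplied by
`(-1) ^ g`. -/
theorem HasSkeleton.spectralRadius_le {W : Type*} [Fintype W] {N : MixedGraph W} {g : ℕ}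
    {ℓ : ZMod g → ℕ} {w : ℂ} {f : ZMod g → ℕ → W} (hs : N.HasSkeleton g ℓ w f)
    (h1 : CycleNonneg g w (fun j => arcDiag (ℓ j + 1)))
    (h2 : CycleNonneg g ((-1) ^ g * w) (fun j => arcDiag (ℓ j + 1))) :
    N.spectralRadius ≤ gr ^ 3 := by
  have hw := hs.weight
  rw [spectralRadius_le_iff]
  refine ⟨hs.isSkeleton.energy_nonneg hs.covers (by rwa [hw]),
    hs.isSkeleton.neg.energy_nonneg hs.covers ?_⟩
  rwa [IsSkeleton.skelWeight_neg, hw]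

theorem neg_one_pow_mem_fourthRoots (g : ℕ) : (-1 : ℂ) ^ g ∈ fourthRoots := by
  rcases neg_one_pow_eq_or ℂ g with h | h <;> simp [h, fourthRoots]

theorem HasSkeleton.spectralRadius_le_of_zero {W : Type*} [Fintype W] {N : MixedGraph W} {g : ℕ}
    {w : ℂ} {f : ZMod g → ℕ → W} (hs : N.HasSkeleton g (fun _ => 0) w f) :
    N.spectralRadius ≤ gr ^ 3 := by
  have hw : w ∈ fourthRoots := hs.weight ▸ hs.isSkeleton.skelWeight_mem
  exact hs.spectralRadius_le (cycleNonneg_zero hw fun _ _ => arcDiag_one)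
    (cycleNonneg_zero (mul_mem_fourthRoots (neg_one_pow_mem_fourthRoots g) hw)
      fun _ _ => arcDiag_one)

theorem spectralRadius_tailedCycleIm_le {k n : ℕ} (h : 3 ≤ k ∧ k < n)
    (hkn : gr ^ 2 - 1 ≤ arcT (n - k + 1) + 2 * arcT k) :
    (tailedCycleIm k n h).spectralRadius ≤ gr ^ 3 := by
  obtain ⟨f, hs⟩ := hasSkeleton_tailedCycleIm h
  have hI : Complex.I ∈ fourthRoots := by simp [fourthRoots]
  have key : ∀ w ∈ fourthRoots, w.re = 0 → CycleNonneg k w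
      (fun j => arcDiag ((Function.update (fun _ => 0) 0 (n - k) : ZMod k → ℕ) j + 1)) := by
    intro w hw hre
    refine cycleNonneg_of_single (a := n - k + 1) (by omega) hw (by simp) (fun j hj h0 => ?_) ?_
    · rw [Function.update_of_ne (natCast_ne_zero_of_lt (by omega) hj), zero_add, arcDiag_one]
    · rw [hre]; linarith
  refine hs.spectralRadius_le (key _ hI Complex.I_re)
    (key _ (mul_mem_fourthRoots (neg_one_pow_mem_fourthRoots k) hI) ?_)
  rcases neg_one_pow_eq_or ℂ k with h | h <;> simp [h]

/-- Two paths affixed to an even cycle of weight `-1`. -/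
theorem HasSkeleton.spectralRadius_le_of_pair {W : Type*} [Fintype W] {N : MixedGraph W} {d e a b : ℕ}
    (hd : 1 ≤ d) (he : 1 ≤ e) (hde : Even (d + e)) {f : ZMod (d + e) → ℕ → W}
    (hs : N.HasSkeleton (d + e)
      (Function.update (Function.update (fun _ => 0) 0 a) (d : ZMod (d + e)) b) (-1) f)
    (h : PairNonneg d e (a + 1) (b + 1) (-1)) : N.spectralRadius ≤ gr ^ 3 := by
  have hd0 : (d : ZMod (d + e)) ≠ 0 := natCast_ne_zero_of_lt hd (by omega)
  have key : CycleNonneg (d + e) (-1) (fun j => arcDiag ((Function.update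
      (Function.update (fun _ => 0) 0 a) (d : ZMod (d + e)) b : ZMod (d + e) → ℕ) j + 1)) := by
    refine cycleNonneg_of_pair (a := a + 1) (b := b + 1) hd he (by simp [fourthRoots])
      ?_ ?_ (fun j hj h0 h1 => ?_) h
    · simp [hd0.symm]
    · simp
    · have hj0 : (j : ZMod (d + e)) ≠ 0 := natCast_ne_zero_of_lt (by omega) hj
      have hjd : (j : ZMod (d + e)) ≠ d := by
        intro he'
        have := congrArg ZMod.val he'
        rw [ZMod.val_natCast_of_lt hj, ZMod.val_natCast_of_lt (by omega)] at this
        exact h1 this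
      rw [Function.update_of_ne hjd, Function.update_of_ne hj0, zero_add, arcDiag_one]
  refine hs.spectralRadius_le key ?_
  rwa [hde.neg_one_pow, one_mul]

theorem spectralRadius_GNeg_le {d e : ℕ} (h : 3 ≤ d + e ∧ 2 ≤ d + 1 ∧ d + 1 ≤ d + e)
    (hde : Even (d + e)) (hp : PairNonneg d e 2 2 (-1)) :
    (GNeg (d + e) (d + 1) h).spectralRadius ≤ gr ^ 3 := by
  obtain ⟨f, hs⟩ := hasSkeleton_GNeg h
  exact hs.spectralRadius_le_of_pair (by omega) (by omega) hde hp

theorem le_arcT_add_of_three {a : ℕ} (ha : 1 ≤ a) : gr ^ 2 - 1 ≤ arcT a + 2 * arcT 3 := by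
  rw [arcT_three]
  linarith [arcT_pos ha]

theorem le_arcT_add_of_four {a : ℕ} (ha : 1 ≤ a) (ha' : a ≤ 3) :
    gr ^ 2 - 1 ≤ arcT a + 2 * arcT 4 := by
  have := arcT_anti ha ha'
  rw [arcT_three] at this
  rw [arcT_four]
  linarith [gr_sq_gt]

theorem le_arcT_add_of_two {a m : ℕ} (ha : 1 ≤ a) (ha' : a ≤ 2) (hm : 1 ≤ m) :
    gr ^ 2 - 1 ≤ arcT a + 2 * arcT m := by
  have := arcT_anti ha ha'
  rw [arcT_two] at this
  linarith [arcT_pos hm]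

theorem spectralRadius_UNeg_le (k l : ℕ) : (UNeg k l).spectralRadius ≤ gr ^ 3 := by
  obtain ⟨f, hs⟩ := hasSkeleton_UNeg k l
  exact HasSkeleton.spectralRadius_le_of_pair (d := 3) (e := 3) (by omega) (by omega) (by decide) hs
    (pairNonneg_neg_antipodal (le_arcT_add_of_three (by omega)) (le_arcT_add_of_three (by omega)))

theorem spectralRadius_U8Neg_le : U8Neg.spectralRadius ≤ gr ^ 3 := by
  obtain ⟨f, hs⟩ := hasSkeleton_U8Neg
  exact HasSkeleton.spectralRadius_le_of_pair (d := 4) (e := 4) (by omega) (by omega) (by decide) hs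
    (pairNonneg_neg_antipodal (le_arcT_add_of_four (by omega) (by omega))
      (le_arcT_add_of_four (by omega) (by omega)))

/-- The form that remains of `U''_6` after eliminating all vertices but the three of degree `3`. -/
theorem U6_form_nonneg {e : ℝ} (he : e ^ 2 = 1 - e) (h1 : 0.6 < e) (h2 : e < 0.62) (p q r : ℝ) :
    0 ≤ 3 / 2 * e * p ^ 2 + 2 * e * (q ^ 2 + r ^ 2) - 2 * (p * q) - 2 * (q * r) + 2 * (r * p) := by
  refine nonneg_of_mul_nonneg_right (a := 4 * e + 2) ?_ (by linarith)
  have h3 : 0 ≤ (4 * e + 2) * (4 * e - 2) * ((q + r) / 2) ^ 2 :=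
    mul_nonneg (mul_nonneg (by linarith) (by linarith)) (sq_nonneg _)
  have h4 : 0 ≤ (2 - 3 * e) * p ^ 2 := mul_nonneg (by linarith) (sq_nonneg _)
  have h5 := sq_nonneg ((4 * e + 2) * ((r - q) / 2) + 2 * p)
  linear_combination h3 + h4 + h5 - 6 * p ^ 2 * he

theorem spectralRadius_U6Neg_le : U6Neg.spectralRadius ≤ gr ^ 3 := by
  obtain ⟨f, hs⟩ := hasSkeleton_U6Neg
  suffices key : CycleNonneg 6 (-1) (fun j => arcDiag ((Function.update (Function.update
      (Function.update (fun _ => 0) 0 2) 2 1) 4 1 : ZMod 6 → ℕ) j + 1)) from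
    hs.spectralRadius_le key (by simpa [show (-1 : ℂ) ^ 6 = 1 by norm_num] using key)
  intro y hy
  obtain ⟨c, hc⟩ : ∃ c : ℕ → ℝ, c = fun j : ℕ => arcDiag ((Function.update (Function.update
      (Function.update (fun _ => 0) 0 2) 2 1) 4 1 : ZMod 6 → ℕ) j + 1) := ⟨_, rfl⟩
  have hsum : ∑ j ∈ range 6, c j * Complex.normSq (y j) = arcDiag 3 * Complex.normSq (y 0) +
      arcDiag 2 * Complex.normSq (y 2) + arcDiag 2 * Complex.normSq (y 4) := by
    have c0 : c 0 = arcDiag 3 := by rw [hc]; rfl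
    have c1 : c 1 = 0 := by rw [hc]; exact arcDiag_one
    have c2 : c 2 = arcDiag 2 := by rw [hc]; rfl
    have c3 : c 3 = 0 := by rw [hc]; exact arcDiag_one
    have c4 : c 4 = arcDiag 2 := by rw [hc]; rfl
    have c5 : c 5 = 0 := by rw [hc]; exact arcDiag_one
    simp only [sum_range_succ, sum_range_zero, c0, c1, c2, c3, c4, c5]
    ring
  rw [sum_sub_distrib, ← hc, hsum, show 6 = 2 + (2 + 2) from rfl, sum_edgeEnergy_add,
    sum_edgeEnergy_add]
  have k1 := arc_ge (m := 2) (by norm_num) y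
  have k2 := arc_ge (m := 2) (by norm_num) (fun j => y (2 + j))
  have k3 := arc_ge (m := 2) (by norm_num) (fun j => y (2 + (2 + j)))
  simp only [add_zero, Nat.reduceAdd] at k1 k2 k3
  rw [hy] at k3
  refine le_trans ?_ (sub_le_sub_right (add_le_add k1 (add_le_add k2 k3)) _)
  refine nonneg_of_mul_nonneg_right (a := gr ^ 3) ?_ (pow_pos gr_pos 3)
  have e1 := cube_mul_arcDiag 2
  have e2 := cube_mul_arcDiag 3
  have e3 := cube_mul_arcOff 2
  have e4 : arcS 2 = 1 := by rw [arcS_eq, arcT_two]; linear_combination gr_pow_four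
  rw [arcT_two] at e1
  rw [arcT_three] at e2
  rw [e4] at e3
  have e5 := gr_pow_six
  have he : (gr ^ 2 - 1) ^ 2 = 1 - (gr ^ 2 - 1) := by linear_combination gr_pow_four
  have f1 := U6_form_nonneg he (by linarith [gr_sq_gt]) (by linarith [gr_sq_lt])
    (y 0).re (y 2).re (y 4).re
  have f2 := U6_form_nonneg he (by linarith [gr_sq_gt]) (by linarith [gr_sq_lt])
    (y 0).im (y 2).im (y 4).im
  simp only [Complex.normSq_apply, Complex.mul_re, Complex.mul_im, Complex.conj_re,
    Complex.conj_im, Complex.neg_re, Complex.neg_im, Complex.one_re, Complex.one_im]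
  generalize (y 0).re = p1 at *
  generalize (y 0).im = p2 at *
  generalize (y 2).re = q1 at *
  generalize (y 2).im = q2 at *
  generalize (y 4).re = r1 at *
  generalize (y 4).im = r2 at *
  linear_combination f1 + f2 + (2 * (p1 ^ 2 + p2 ^ 2) + 3 * (q1 ^ 2 + q2 ^ 2)
    + 3 * (r1 ^ 2 + r2 ^ 2)) * e1 + (p1 ^ 2 + p2 ^ 2) * e2
    + 2 * (p1 * q1 + p2 * q2 + q1 * r1 + q2 * r2 - r1 * p1 - r2 * p2) * e3
    - (p1 ^ 2 + p2 ^ 2 + q1 ^ 2 + q2 ^ 2 + r1 ^ 2 + r2 ^ 2) * e5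

end MixedGraph

namespace MixedGraph

variable {V W : Type*}

/-! ### Classification of the skeletons of bounded mixed graphs -/

theorem HasSkeleton.isInducedSubgraph {M : MixedGraph V} {N : MixedGraph W} {g : ℕ}
    {ℓ ℓ' : ZMod g → ℕ} {f : ZMod g → ℕ → V} {f' : ZMod g → ℕ → W} {w' : ℂ}
    (hN : N.HasSkeleton g ℓ' w' f') (hs : IsSkeleton M.hMatrix g ℓ f) (hf : SkelCovers ℓ f)
    (hw : skelWeight M.hMatrix g f = w' ∨ skelWeight M.hMatrix g f = conj w') (r : ZMod g)
    (hl : ∀ i, ℓ (i + r) ≤ ℓ' i) : M.IsInducedSubgraph N :=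
  isInducedSubgraph_of_isSkeleton (hs.rotate r) (hf.rotate r) hN.isSkeleton hl
    (by rw [hs.skelWeight_rotate, hN.weight]; exact hw)

/-- A cycle of length `4` and weight `-1` is excluded in a `C''_4`-free mixed graph. -/
theorem Free.skelWeight_ne {M : MixedGraph V} (hfree : M.Free (cycleNeg 4)) {ℓ : ZMod 4 → ℕ}
    {f : ZMod 4 → ℕ → V} (hs : IsSkeleton M.hMatrix 4 ℓ f) : skelWeight M.hMatrix 4 f ≠ -1 := by
  intro hw
  have hC := hasSkeleton_cycleNeg (n := 4) (by norm_num)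
  obtain ⟨s, e, h⟩ := isInducedSubgraph_of_isSkeleton hC.isSkeleton hC.covers hs
    (fun _ => Nat.zero_le _) (Or.inl (hC.weight.trans hw.symm))
  refine hfree ((M.induce s).comap e.toEmbedding) ⟨Equiv.refl _, ?_⟩
    ⟨e.toEmbedding.trans (.subtype _), fun u v huv => ⟨huv, Iff.rfl⟩⟩
  rcases h with h | h
  · exact Or.inl h.symm
  · exact Or.inr h.symm.converse

theorem isInducedSubgraph_tailedCycleIm {M : MixedGraph V} {g : ℕ} {ℓ : ZMod g → ℕ}
    {f : ZMod g → ℕ → V} (hs : IsSkeleton M.hMatrix g ℓ f) (hf : SkelCovers ℓ f)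
    (hw : skelWeight M.hMatrix g f = Complex.I ∨ skelWeight M.hMatrix g f = -Complex.I)
    {r : ZMod g} (hr : ∀ i, i ≠ r → ℓ i = 0) {n : ℕ} (hn : g + ℓ r ≤ n) (h : 3 ≤ g ∧ g < n) :
    M.IsInducedSubgraph (tailedCycleIm g n h) := by
  obtain ⟨f', hN⟩ := hasSkeleton_tailedCycleIm h
  refine hN.isInducedSubgraph hs hf (by simpa using hw) r fun i => ?_
  by_cases hi : i = 0
  · subst hi
    rw [zero_add, Function.update_self]
    omega
  · rw [hr _ (by simpa using hi)]
    exact Nat.zero_le _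

/-- If paths are affixed only at two cycle vertices, comparison with a mixed graph of this
shape amounts to comparing their lengths. -/
theorem HasSkeleton.isInducedSubgraph_of_two {M : MixedGraph V} {N : MixedGraph W} {g d a b : ℕ} {w' : ℂ}
    {ℓ : ZMod g → ℕ} {f : ZMod g → ℕ → V} {f' : ZMod g → ℕ → W}
    (hN : N.HasSkeleton g (Function.update (Function.update (fun _ => 0) 0 a) (d : ZMod g) b) w' f')
    (hs : IsSkeleton M.hMatrix g ℓ f) (hf : SkelCovers ℓ f)
    (hw : skelWeight M.hMatrix g f = w') {r : ZMod g}
    (hr : ∀ j, ℓ j ≠ 0 → j = r ∨ j = r + d) (ha : ℓ r ≤ a) (hb : ℓ (r + d) ≤ b) :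
    M.IsInducedSubgraph N := by
  refine hN.isInducedSubgraph hs hf (Or.inl hw) r fun i => ?_
  by_cases h1 : i = d
  · subst h1
    rwa [Function.update_self, add_comm]
  · rw [Function.update_of_ne h1]
    by_cases h0 : i = 0
    · subst h0
      rwa [Function.update_self, zero_add]
    · rw [Function.update_of_ne h0, Nat.le_zero]
      by_contra hne
      rcases hr _ hne with h | h
      · exact h0 (by simpa using h)
      · rw [add_comm] at h
        exact h1 (add_left_cancel h)

theorem isInducedSubgraph_U6Neg {M : MixedGraph V} {ℓ : ZMod 6 → ℕ} {f : ZMod 6 → ℕ → V}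
    (hs : IsSkeleton M.hMatrix 6 ℓ f) (hf : SkelCovers ℓ f)
    (hw : skelWeight M.hMatrix 6 f = -1) {r : ZMod 6} (h1 : ℓ (r + 1) = 0) (h3 : ℓ (r + 3) = 0)
    (h5 : ℓ (r + 5) = 0) (h0 : ℓ r ≤ 2) (h2 : ℓ (r + 2) ≤ 1) (h4 : ℓ (r + 4) ≤ 1) :
    M.IsInducedSubgraph U6Neg := by
  obtain ⟨f', hN⟩ := hasSkeleton_U6Neg
  refine hN.isInducedSubgraph hs hf (Or.inl hw) r fun i => ?_
  rw [add_comm]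
  fin_cases i
  · exact (add_zero r).symm ▸ h0
  · exact h1.le
  · exact h2
  · exact h3.le
  · exact h4
  · exact h5.le

variable [Fintype V]

section Imaginary

variable {M : MixedGraph V} {g : ℕ} {ℓ : ZMod g → ℕ} {f : ZMod g → ℕ → V}

/-- At most one path is affixed to a cycle of weight `i` or `-i`. -/
theorem exists_eq_zero_of_im (hs : IsSkeleton M.hMatrix g ℓ f)
    (h : ∀ x, 0 ≤ energy M.hMatrix x)
    (hw : skelWeight M.hMatrix g f = Complex.I ∨ skelWeight M.hMatrix g f = -Complex.I) :
    ∃ r, ∀ i, i ≠ r → ℓ i = 0 := by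
  have := hs.neZero
  have hg := hs.three_le
  by_cases hr : ∃ r, ℓ r ≠ 0
  · obtain ⟨r, hr⟩ := hr
    refine ⟨r, fun i hi => ?_⟩
    by_contra h0
    have hd : 1 ≤ (i - r).val := Nat.one_le_iff_ne_zero.2 fun h' =>
      hi (sub_eq_zero.1 ((ZMod.val_eq_zero _).1 h'))
    have hd' := (i - r).val_lt
    have hp := hs.pair h r hd (e := g - (i - r).val) (by omega) (by omega)
    rw [ZMod.natCast_zmod_val, add_sub_cancel] at hp
    exact hp.false_of_im hw hd (by omega) (by omega) (by omega) (by omega)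
  · push Not at hr
    exact ⟨0, fun i _ => hr i⟩

end Imaginary

section Negative

variable {M : MixedGraph V} {m : ℕ} {ℓ : ZMod (2 * m) → ℕ} {f : ZMod (2 * m) → ℕ → V}

theorem _root_.IsSkeleton.neg_single (hs : IsSkeleton M.hMatrix (2 * m) ℓ f)
    (h : ∀ x, 0 ≤ energy M.hMatrix x) (hw : skelWeight M.hMatrix (2 * m) f = -1)
    (i : ZMod (2 * m)) : gr ^ 2 - 1 ≤ arcT (ℓ i + 1) + 2 * arcT m := by
  have hg := hs.three_le
  have h1 := hs.single h i
  rw [hw] at h1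
  linarith [arc_neg_two_mul (show 1 ≤ m by omega)]

theorem _root_.IsSkeleton.neg_pair (hs : IsSkeleton M.hMatrix (2 * m) ℓ f)
    (h : ∀ x, 0 ≤ energy M.hMatrix x) (hw : skelWeight M.hMatrix (2 * m) f = -1)
    (i : ZMod (2 * m)) {d e : ℕ} (hd : 1 ≤ d) (he : 1 ≤ e) (hde : d + e = 2 * m) :
    PairNonneg d e (ℓ i + 1) (ℓ (i + d) + 1) (-1) :=
  hw ▸ hs.pair h i hd he hde

/-- Two affixed paths on an even cycle of weight `-1` are antipodal, or nearly so on a short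
cycle. -/
theorem _root_.IsSkeleton.neg_dist (hs : IsSkeleton M.hMatrix (2 * m) ℓ f)
    (h : ∀ x, 0 ≤ energy M.hMatrix x) (hw : skelWeight M.hMatrix (2 * m) f = -1)
    {i j : ZMod (2 * m)} (hij : i ≠ j) (hi : ℓ i ≠ 0) (hj : ℓ j ≠ 0) :
    j = i + m ∨ (m ≤ 5 ∧ (j = i + (m - 1 : ℕ) ∨ i = j + (m - 1 : ℕ))) := by
  have := hs.neZero
  have hg := hs.three_le
  -- the statement for the shorter of the two arcs
  have key : ∀ {i j : ZMod (2 * m)}, ℓ i ≠ 0 → ℓ j ≠ 0 → 1 ≤ (j - i).val → (j - i).val ≤ m →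
      j = i + m ∨ (m ≤ 5 ∧ j = i + (m - 1 : ℕ)) := by
    intro i j hi hj h1 hm
    have hji : j = i + ((j - i).val : ZMod (2 * m)) := by
      rw [ZMod.natCast_zmod_val, add_sub_cancel]
    have hp := hs.neg_pair h hw i h1 (e := 2 * m - (j - i).val) (by omega) (by omega)
    rw [← hji] at hp
    have hd := hp.neg_dist h1 (by omega) (by omega) (by omega)
    rcases (show (j - i).val = m ∨ (j - i).val = m - 1 by omega) with hv | hv
    · exact Or.inl (by rw [hv] at hji; exact hji)
    · exact Or.inr ⟨by omega, by rw [hv] at hji; exact hji⟩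
  have hne : ∀ {i j : ZMod (2 * m)}, i ≠ j → 1 ≤ (j - i).val := fun hij =>
    Nat.one_le_iff_ne_zero.2 fun h' => hij (sub_eq_zero.1 ((ZMod.val_eq_zero _).1 h')).symm
  rcases Nat.lt_or_ge m (j - i).val with hlt | hle
  · have hv : (i - j).val ≤ m := by
      have : NeZero (j - i) := ⟨sub_ne_zero.2 hij.symm⟩
      rw [← neg_sub, ZMod.val_neg_of_ne_zero]
      omega
    rcases key hj hi (hne hij.symm) hv with h1 | ⟨h1, h2⟩
    · left
      have h2 : ((m : ZMod (2 * m)) + m) = 0 := by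
        rw [← two_mul]
        exact_mod_cast ZMod.natCast_self (2 * m)
      rw [h1, add_assoc, h2, add_zero]
    · exact Or.inr ⟨h1, Or.inr h2⟩
  · rcases key hi hj (hne hij) hle with h1 | ⟨h1, h2⟩
    · exact Or.inl h1
    · exact Or.inr ⟨h1, Or.inl h2⟩

/-- Two paths affixed at distance `2` on a cycle of length `6` and weight `-1`. -/
theorem isInducedSubgraph_U6Neg_of_dist_two {ℓ : ZMod 6 → ℕ} {f : ZMod 6 → ℕ → V}
    (hs : IsSkeleton M.hMatrix 6 ℓ f) (hf : SkelCovers ℓ f) (h : ∀ x, 0 ≤ energy M.hMatrix x)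
    (hw : skelWeight M.hMatrix 6 f = -1) {i : ZMod 6} (hi : ℓ i ≠ 0) (hi2 : ℓ (i + 2) ≠ 0) :
    M.IsInducedSubgraph U6Neg := by
  have hadj : ∀ j : ZMod 6, ℓ j ≠ 0 → ℓ (j + 1) = 0 := by
    intro j hj
    by_contra hj1
    have hp := IsSkeleton.neg_pair (m := 3) hs h hw j (d := 1) (e := 5) le_rfl (by norm_num) rfl
    rw [Nat.cast_one] at hp
    have := hp.neg_dist le_rfl (by norm_num) (by omega) (by omega)
    omega
  have htwo : ∀ j : ZMod 6, ℓ j ≠ 0 → ℓ (j + 2) ≠ 0 →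
      ℓ j ≤ 2 ∧ ℓ (j + 2) ≤ 2 ∧ (ℓ j ≤ 1 ∨ ℓ (j + 2) ≤ 1) := by
    intro j hj hj2
    have hp := IsSkeleton.neg_pair (m := 3) hs h hw j (d := 2) (e := 4) (by norm_num)
      (by norm_num) rfl
    have := PairNonneg.two_four hp (by omega) (by
      change 2 ≤ ℓ (j + 2) + 1; omega)
    change _ ∧ ℓ (j + 2) + 1 ≤ 3 ∧ (_ ∨ ℓ (j + 2) + 1 ≤ 2) at this
    omega
  have a22 : i + 2 + 2 = i + 4 := by rw [add_assoc]; rfl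
  have a42 : i + 4 + 2 = i := by rw [add_assoc]; exact add_zero i
  have a24 : i + 2 + 4 = i := by rw [add_assoc]; exact add_zero i
  have a44 : i + 4 + 4 = i + 2 := by rw [add_assoc]; rfl
  have h1 := hadj i hi
  have h3 : ℓ (i + 3) = 0 := by
    have := hadj _ hi2
    rw [add_assoc] at this
    exact this
  have h5 : ℓ (i + 5) = 0 := by
    by_contra h5
    have := hadj _ h5
    rw [add_assoc] at this
    exact hi (by rw [← add_zero i]; exact this)
  have t1 := htwo i hi hi2
  have t2 := htwo (i + 2) hi2
  have t3 := htwo (i + 4)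
  rw [a22] at t2
  rw [a42] at t3
  by_cases hb : ℓ (i + 2) = 2
  · refine isInducedSubgraph_U6Neg hs hf hw (r := i + 2) ?_ ?_ ?_ hb.le ?_ ?_
    · rw [add_assoc]; exact h3
    · rw [add_assoc]; exact h5
    · rw [add_assoc]; exact h1
    · rw [a22]; omega
    · rw [a24]; omega
  by_cases hc : ℓ (i + 4) = 2
  · refine isInducedSubgraph_U6Neg hs hf hw (r := i + 4) ?_ ?_ ?_ hc.le ?_ ?_
    · rw [add_assoc]; exact h5
    · rw [add_assoc]; exact h1
    · rw [add_assoc]; exact h3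
    · rw [a42]; omega
    · rw [a44]; omega
  exact isInducedSubgraph_U6Neg hs hf hw (r := i) h1 h3 h5 (by omega) (by omega) (by omega)

/-- A mixed graph bounded by the limit value whose cycle has even length `2 m ≥ 6` and weight `-1`. -/
theorem classification_neg (hm : 3 ≤ m) (hs : IsSkeleton M.hMatrix (2 * m) ℓ f)
    (hf : SkelCovers ℓ f) (h : ∀ x, 0 ≤ energy M.hMatrix x)
    (hw : skelWeight M.hMatrix (2 * m) f = -1) :
    (∃ (n : ℕ) (_ : 10 ≤ n), Even n ∧
        M.IsInducedSubgraph (MixedGraph.GNeg (n - 2) (n / 2) (by omega))) ∨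
      (∃ n k : ℕ, 1 ≤ k ∧ k + 7 ≤ n ∧
        M.IsInducedSubgraph (MixedGraph.UNeg k (n - 6 - k))) ∨
      M.IsInducedSubgraph (MixedGraph.GNeg 8 4 (by omega)) ∨
      M.IsInducedSubgraph (MixedGraph.GNeg 10 5 (by omega)) ∨
      M.IsInducedSubgraph MixedGraph.U6Neg ∨
      M.IsInducedSubgraph MixedGraph.U8Neg := by
  have h1 : ∀ i, 5 ≤ m → ℓ i ≤ 1 := fun i h5 => by
    have := le_two_of_single h5 (IsSkeleton.neg_single hs h hw i)
    omega
  by_cases hA : m ≤ 5 ∧ ∃ i, ℓ i ≠ 0 ∧ ℓ (i + (m - 1 : ℕ)) ≠ 0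
  · obtain ⟨hm5, i, hi, hi'⟩ := hA
    obtain rfl | rfl | rfl : m = 3 ∨ m = 4 ∨ m = 5 := by omega
    · right; right; right; right; left
      exact isInducedSubgraph_U6Neg_of_dist_two hs hf h hw hi hi'
    · right; right; left
      obtain ⟨f', hN⟩ := hasSkeleton_GNeg (n := 8) (k := 4) (by omega)
      have hp := PairNonneg.three_five (IsSkeleton.neg_pair hs h hw i (d := 3) (e := 5)
        (by norm_num) (by norm_num) rfl) (by omega)
        (by change ℓ (i + (3 : ℕ)) ≠ 0 at hi'; omega)
      refine hN.isInducedSubgraph_of_two hs hf hw (r := i) (fun j hj => ?_)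
        (by omega) (by have := hp.2; change ℓ (i + (3 : ℕ)) ≤ 1; omega)
      by_contra! hne
      have k1 := IsSkeleton.neg_dist hs h hw (Ne.symm hne.1) hi hj
      have k2 := IsSkeleton.neg_dist hs h hw (Ne.symm hne.2) hi' hj
      have key : ∀ i j : ZMod 8, (j = i + (4 : ℕ) ∨ j = i + (3 : ℕ) ∨ i = j + (3 : ℕ)) →
          (j = i + (3 : ℕ) + (4 : ℕ) ∨ j = i + (3 : ℕ) + (3 : ℕ) ∨ i + (3 : ℕ) = j + (3 : ℕ)) →
          j = i ∨ j = i + (3 : ℕ) := by decide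
      exact (key i j (k1.imp_right And.right) (k2.imp_right And.right)).elim hne.1 hne.2
    · right; right; right; left
      obtain ⟨f', hN⟩ := hasSkeleton_GNeg (n := 10) (k := 5) (by omega)
      refine hN.isInducedSubgraph_of_two hs hf hw (r := i) (fun j hj => ?_) (h1 _ le_rfl)
        (h1 _ le_rfl)
      by_contra! hne
      have k1 := IsSkeleton.neg_dist hs h hw (Ne.symm hne.1) hi hj
      have k2 := IsSkeleton.neg_dist hs h hw (Ne.symm hne.2) hi' hj
      have key : ∀ i j : ZMod 10, (j = i + (5 : ℕ) ∨ j = i + (4 : ℕ) ∨ i = j + (4 : ℕ)) →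
          (j = i + (4 : ℕ) + (5 : ℕ) ∨ j = i + (4 : ℕ) + (4 : ℕ) ∨ i + (4 : ℕ) = j + (4 : ℕ)) →
          j = i ∨ j = i + (4 : ℕ) := by decide
      exact (key i j (k1.imp_right And.right) (k2.imp_right And.right)).elim hne.1 hne.2
  · have hA' : ∀ i, m ≤ 5 → ℓ i ≠ 0 → ℓ (i + (m - 1 : ℕ)) = 0 := fun i h5 hi => by
      by_contra hne
      exact hA ⟨h5, i, hi, hne⟩
    obtain ⟨r, hr⟩ : ∃ r, ∀ j, ℓ j ≠ 0 → j = r ∨ j = r + m := by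
      by_cases hr : ∃ r, ℓ r ≠ 0
      · obtain ⟨r, hr⟩ := hr
        refine ⟨r, fun j hj => or_iff_not_imp_left.2 fun hjr => ?_⟩
        rcases IsSkeleton.neg_dist hs h hw (Ne.symm hjr) hr hj with h2 | ⟨h5, h2 | h2⟩
        · exact h2
        · exact absurd (hA' r h5 hr) (h2 ▸ hj)
        · exact absurd (hA' j h5 hj) (h2 ▸ hr)
      · push Not at hr
        exact ⟨0, fun j hj => absurd (hr j) hj⟩
    rcases (show m = 3 ∨ m = 4 ∨ 5 ≤ m by omega) with rfl | rfl | h5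
    · right; left
      refine ⟨6 + (ℓ r + 1) + (ℓ (r + (3 : ℕ)) + 1), ℓ r + 1, by omega, by omega, ?_⟩
      rw [show 6 + (ℓ r + 1) + (ℓ (r + (3 : ℕ)) + 1) - 6 - (ℓ r + 1) = ℓ (r + (3 : ℕ)) + 1 by omega]
      obtain ⟨f', hN⟩ := hasSkeleton_UNeg (ℓ r + 1) (ℓ (r + (3 : ℕ)) + 1)
      exact HasSkeleton.isInducedSubgraph_of_two (d := 3) hN hs hf hw hr (by omega) (by omega)
    · right; right; right; right; right
      have h2 : ∀ i, ℓ i ≤ 2 := fun i => by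
        have := le_three_of_single (IsSkeleton.neg_single hs h hw i)
        omega
      obtain ⟨f', hN⟩ := hasSkeleton_U8Neg
      exact HasSkeleton.isInducedSubgraph_of_two (d := 4) hN hs hf hw hr (h2 _) (h2 _)
    · left
      have key : ∀ a b (hab : 3 ≤ a ∧ 2 ≤ b ∧ b ≤ a), a = 2 * m → b = m + 1 →
          M.IsInducedSubgraph (GNeg a b hab) := by
        rintro a b hab rfl rfl
        obtain ⟨f', hN⟩ := hasSkeleton_GNeg hab
        exact hN.isInducedSubgraph_of_two hs hf hw hr (h1 _ h5) (h1 _ h5)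
      exact ⟨2 * m + 2, by omega, by simp [parity_simps], key _ _ _ (by omega) (by omega)⟩

end Negative

/-- A cycle of weight `1` is the whole graph: paths and branches are excluded. This is applied to the
Hermitian adjacency matrix and, for an odd cycle of weight `-1`, to its negative. -/
theorem _root_.IsSkeleton.eq_zero_and_covers {H : Matrix V V ℂ} {g : ℕ} {ℓ : ZMod g → ℕ}
    {f : ZMod g → ℕ → V} (hs : IsSkeleton H g ℓ f) (h : ∀ x, 0 ≤ energy H x)
    (hw : skelWeight H g f = 1) (hc : SkelCovers ℓ f ∨ ∃ v, IsSkeleton.IsBranch H ℓ f v) :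
    SkelCovers ℓ f ∧ ∀ i, ℓ i = 0 :=
  ⟨hc.resolve_right fun ⟨v, hv⟩ => hs.not_isBranch_of_one h hw v hv, hs.eq_zero_of_one h hw⟩

end MixedGraph

theorem mainTheorem3 {V : Type*} [Fintype V] (M : MixedGraph V)
    (hM : M.IsUnicyclic) (hfree : M.Free (MixedGraph.cycleNeg 4)) :
    M.spectralRadius ≤ Real.sqrt (2 + Real.sqrt 5) ↔
      -- (i)
      (∃ n : ℕ, 3 ≤ n ∧ M.IsInducedSubgraph (MixedGraph.cyclePos n)) ∨
      -- (ii)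
      (∃ n : ℕ, 3 ≤ n ∧ Odd n ∧ M.IsInducedSubgraph (MixedGraph.cycleNeg n)) ∨
      (∃ (n : ℕ) (_ : 10 ≤ n), Even n ∧
        M.IsInducedSubgraph (MixedGraph.GNeg (n - 2) (n / 2) (by omega))) ∨
      (∃ n k : ℕ, 1 ≤ k ∧ k + 7 ≤ n ∧
        M.IsInducedSubgraph (MixedGraph.UNeg k (n - 6 - k))) ∨
      M.IsInducedSubgraph (MixedGraph.GNeg 8 4 (by omega)) ∨
      M.IsInducedSubgraph (MixedGraph.GNeg 10 5 (by omega)) ∨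
      M.IsInducedSubgraph MixedGraph.U6Neg ∨
      M.IsInducedSubgraph MixedGraph.U8Neg ∨
      -- (iii)
      (∃ (n : ℕ) (_ : 6 ≤ n),
        M.IsInducedSubgraph (MixedGraph.tailedCycleIm (n - 1) n (by omega))) ∨
      (∃ (n : ℕ) (_ : 4 ≤ n),
        M.IsInducedSubgraph (MixedGraph.tailedCycleIm 3 n (by omega))) ∨
      M.IsInducedSubgraph (MixedGraph.tailedCycleIm 4 6 (by omega)) := by
  rw [← gr_cube]
  constructor
  · intro hρ
    obtain ⟨h, h'⟩ := M.spectralRadius_le_iff.1 hρ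
    obtain ⟨g, ℓ, f, hs, hc⟩ := hM.exists_isSkeleton
    have hg := hs.three_le
    have im : skelWeight M.hMatrix g f = Complex.I ∨ skelWeight M.hMatrix g f = -Complex.I →
        (∃ (n : ℕ) (_ : 6 ≤ n),
          M.IsInducedSubgraph (MixedGraph.tailedCycleIm (n - 1) n (by omega))) ∨
        (∃ (n : ℕ) (_ : 4 ≤ n),
          M.IsInducedSubgraph (MixedGraph.tailedCycleIm 3 n (by omega))) ∨
        M.IsInducedSubgraph (MixedGraph.tailedCycleIm 4 6 (by omega)) := by
      intro hw
      have hre : (skelWeight M.hMatrix g f).re = 0 := by rcases hw with hw | hw <;> simp [hw]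
      have hf := hc.resolve_right fun ⟨v, hv⟩ => hs.not_isBranch_of_im h hre v hv
      obtain ⟨r, hr⟩ := MixedGraph.exists_eq_zero_of_im hs h hw
      have hsingle := hs.single h r
      rw [hre, mul_zero, sub_zero] at hsingle
      obtain rfl | rfl | h5 : g = 3 ∨ g = 4 ∨ 5 ≤ g := by omega
      · exact Or.inr (Or.inl ⟨4 + ℓ r, by omega,
          MixedGraph.isInducedSubgraph_tailedCycleIm hs hf hw hr (by omega) _⟩)
      · have := le_three_of_single hsingle
        exact Or.inr (Or.inr
          (MixedGraph.isInducedSubgraph_tailedCycleIm hs hf hw hr (by omega) _))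
      · have := le_two_of_single h5 hsingle
        exact Or.inl ⟨g + 1, by omega,
          MixedGraph.isInducedSubgraph_tailedCycleIm hs hf hw hr (by omega) (by omega)⟩
    rcases hs.skelWeight_mem with hw | hw | hw | hw
    · left
      obtain ⟨hf, h0⟩ := hs.eq_zero_and_covers h hw hc
      exact ⟨g, hg, (MixedGraph.hasSkeleton_cyclePos hg).isInducedSubgraph hs hf (Or.inl hw) 0
        fun i => (h0 _).le⟩
    · right
      rcases Nat.even_or_odd g with hev | hodd
      · right
        obtain ⟨m, hm⟩ := hev
        rw [← two_mul] at hm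
        subst hm
        have hm2 : m ≠ 2 := by
          rintro rfl
          exact hfree.skelWeight_ne hs hw
        have hf := hc.resolve_right fun ⟨v, hv⟩ => hs.not_isBranch_of_neg (by omega) h hw v hv
        exact (MixedGraph.classification_neg (by omega) hs hf h hw).imp_right fun h =>
          h.imp_right fun h => h.imp_right fun h => h.imp_right fun h => h.imp_right Or.inl
      · left
        have hc' : SkelCovers ℓ f ∨ ∃ v, IsSkeleton.IsBranch (-M.hMatrix) ℓ f v :=
          hc.imp_right fun ⟨v, hv⟩ => ⟨v, hv.neg⟩
        obtain ⟨hf, h0⟩ := hs.neg.eq_zero_and_covers h'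
          (by rw [IsSkeleton.skelWeight_neg, hw, hodd.neg_one_pow]; norm_num) hc'
        exact ⟨g, hg, hodd, (MixedGraph.hasSkeleton_cycleNeg hg).isInducedSubgraph hs hf
          (Or.inl hw) 0 fun i => (h0 _).le⟩
    · exact Or.inr (Or.inr (Or.inr (Or.inr (Or.inr (Or.inr (Or.inr (Or.inr (im (Or.inl hw)))))))))
    · exact Or.inr (Or.inr (Or.inr (Or.inr (Or.inr (Or.inr (Or.inr (Or.inr (im (Or.inr hw)))))))))
  · rintro (⟨n, hn, h⟩ | ⟨n, hn, -, h⟩ | ⟨n, hn, hev, h⟩ | ⟨n, k, -, -, h⟩ | h | h | h | h |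
      ⟨n, hn, h⟩ | ⟨n, hn, h⟩ | h) <;> refine MixedGraph.spectralRadius_le_of_isInducedSubgraph ?_ h
    · exact (MixedGraph.hasSkeleton_cyclePos hn).spectralRadius_le_of_zero
    · exact (MixedGraph.hasSkeleton_cycleNeg hn).spectralRadius_le_of_zero
    · have key : ∀ d a b (hab : 3 ≤ a ∧ 2 ≤ b ∧ b ≤ a), a = d + d → b = d + 1 →
          (MixedGraph.GNeg a b hab).spectralRadius ≤ gr ^ 3 := by
        rintro d a b hab rfl rfl
        have hd := MixedGraph.le_arcT_add_of_two (a := 2) (by norm_num) le_rfl (show 1 ≤ d by omega)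
        exact MixedGraph.spectralRadius_GNeg_le _ ⟨d, rfl⟩ (pairNonneg_neg_antipodal hd hd)
      obtain ⟨m, rfl⟩ := hev
      exact key (m - 1) _ _ _ (by omega) (by omega)
    · exact MixedGraph.spectralRadius_UNeg_le _ _
    · exact MixedGraph.spectralRadius_GNeg_le (d := 3) (e := 5) _ (by decide) pairNonneg_three_five
    · exact MixedGraph.spectralRadius_GNeg_le (d := 4) (e := 6) _ (by decide) pairNonneg_four_six
    · exact MixedGraph.spectralRadius_U6Neg_le
    · exact MixedGraph.spectralRadius_U8Neg_le
    · exact MixedGraph.spectralRadius_tailedCycleIm_le _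
        (MixedGraph.le_arcT_add_of_two (by omega) (by omega) (by omega))
    · exact MixedGraph.spectralRadius_tailedCycleIm_le _
        (MixedGraph.le_arcT_add_of_three (by omega))
    · exact MixedGraph.spectralRadius_tailedCycleIm_le _
        (MixedGraph.le_arcT_add_of_four (by omega) (by omega))
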